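/- Let $n\ge 1$ be an integer and $Q=n+2$. On $\mathbb{R}^{n+1}=\mathbb{R}^n_x\times\mathbb{R}_t$, with origin $o$, let $$\nabla_G=(\nabla_x,\,|x|\partial_t),\qquad \mathcal{L}_G=\Delta_x+|x|^2\partial_t^2,\qquad \varrho(x,t)=\big(|x|^4+4t^2\big)^{1/4}$$ be the Grushin gradient, the Grushin operator and the homogeneous norm. For $r>0$ let $\delta_r(x,t)=(rx,r^2t)$, and for $p\ne o$ let $$u_\varrho(p)=\frac{d}{dr}\Big|_{r=\varrho(p)}u\big(\delta_{r/\varrho(p)}\,p\big)$$ be the radial derivative of $u$. Assume $Q\ge 5$. Then for every real-valued $u\in C_c^\infty(\mathbb{R}^{n+1}\setminus\{o\})$ all the integrals below are finite, and the following hold. (a) (Hardy–Rellich inequality) $$\int_{\mathbb{R}^{n+1}}\frac{(\mathcal{L}_Gu)^2}{|\nabla_G\varrho|^2}\,dx\,dt\;\ge\;\frac{Q^2}{4}\int_{\mathbb{R}^{n+1}}\frac{|\nabla_Gu|^2}{\varrho^2}\,dx\,dt+\int_{\mathbb{R}^{n+1}}\varrho^{2-Q}\Big|\nabla_G\Big(u_\varrho\,\varrho^{\frac{Q-2}{2}}\Big)\Big|^2dx\,dt.$$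 (b) (Rellich inequality) $$\int_{\mathbb{R}^{n+1}}\frac{(\mathcal{L}_Gu)^2}{|\nabla_G\varrho|^2}\,dx\,dt\;\ge\;\frac{Q^2(Q-4)^2}{16}\int_{\mathbb{R}^{n+1}}\frac{u^2|\nabla_G\varrho|^2}{\varrho^4}\,dx\,dt+\frac{Q^2}{4}\int_{\mathbb{R}^{n+1}}\varrho^{2-Q}\Big|\nabla_G\Big(u\,\varrho^{\frac{Q-4}{2}}\Big)\Big|^2dx\,dt+\int_{\mathbb{R}^{n+1}}\varrho^{2-Q}\Big|\nabla_G\Big(u_\varrho\,\varrho^{\frac{Q-2}{2}}\Big)\Big|^2dx\,dt.$$ Moreover, both leading constants are sharp: for every $C>\frac{Q^2}{4}$ there is $u\in C_c^\infty(\mathbb{R}^{n+1}\setminus\{o\})$ with $$\int_{\mathbb{R}^{n+1}}\frac{(\mathcal{L}_Gu)^2}{|\nabla_G\varrho|^2}\,dx\,dt<C\int_{\mathbb{R}^{n+1}}\frac{|\nabla_Gu|^2}{\varrho^2}\,dx\,dt,$$ and for every $C>\frac{Q^2(Q-4)^2}{16}$ there is $u\in C_c^\infty(\mathbb{R}^{n+1}\setminus\{o\})$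 with $$\int_{\mathbb{R}^{n+1}}\frac{(\mathcal{L}_Gu)^2}{|\nabla_G\varrho|^2}\,dx\,dt<C\int_{\mathbb{R}^{n+1}}\frac{u^2|\nabla_G\varrho|^2}{\varrho^4}\,dx\,dt.$$ -/

import Mathlib

open MeasureTheory
open scoped ContDiff

noncomputable section

/-- The underlying space `ℝⁿ × ℝ` of the Grushin space, with points `p = (x, t)`; its `volume` is
Lebesgue measure `dx dt`. -/
abbrev GrushinSpace (n : ℕ) : Type := EuclideanSpace ℝ (Fin n) × ℝ

namespace GrushinSpace

variable {n : ℕ}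

/-- The Grushin gradient `∇_G f = (∇ₓ f, |x| ∂ₜ f)`, a vector of the Euclidean space `ℝⁿ⁺¹`. -/
def grad (f : GrushinSpace n → ℝ) (p : GrushinSpace n) :
    WithLp 2 (EuclideanSpace ℝ (Fin n) × ℝ) :=
  WithLp.toLp 2 (gradient (fun x => f (x, p.2)) p.1, ‖p.1‖ * deriv (fun t => f (p.1, t)) p.2)

/-- The Grushin operator `𝓛_G f = Δₓ f + |x|² ∂ₜ² f`. -/
def op (f : GrushinSpace n → ℝ) (p : GrushinSpace n) : ℝ :=
  Laplacian.laplacian (fun x => f (x, p.2)) p.1 +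
    ‖p.1‖ ^ 2 * iteratedDeriv 2 (fun t => f (p.1, t)) p.2

/-- The homogeneous norm `ϱ(x, t) = (|x|⁴ + 4 t²)^{1/4}`. -/
def rho (p : GrushinSpace n) : ℝ := (‖p.1‖ ^ 4 + 4 * p.2 ^ 2) ^ (1 / 4 : ℝ)

/-- The anisotropic dilation `δ_r (x, t) = (r x, r² t)`. -/
def dil (r : ℝ) (p : GrushinSpace n) : GrushinSpace n := (r • p.1, r ^ 2 * p.2)

/-- The radial derivative `u_ϱ = ∂u/∂ϱ` in the polar coordinates `p = δ_ϱ σ`, where `ϱ = ϱ(p) > 0`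
and `σ = δ_{1/ϱ} p` lies on the unit `ϱ`-sphere: differentiate `r ↦ u (δ_r σ)` at `r = ϱ`. -/
def radialDeriv (u : GrushinSpace n → ℝ) (p : GrushinSpace n) : ℝ :=
  deriv (fun r => u (dil r (dil (rho p)⁻¹ p))) (rho p)

/-- `u ∈ C_c^∞(ℝⁿ⁺¹ ∖ {o})`, the function being extended by zero to `ℝⁿ⁺¹`. -/
structure IsTestFunction (u : GrushinSpace n → ℝ) : Prop where
  contDiff : ContDiff ℝ ∞ u
  hasCompactSupport : HasCompactSupport u
  zero_notMem_tsupport : (0 : GrushinSpace n) ∉ tsupport u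

end GrushinSpace

end

/-! Let `E = x·∇ₓ + 2t∂ₜ` generate the dilations, let `ψ = |x|²/ϱ² = |∇_G ϱ|²`, and integrate
against the dilation invariant measure `ϱ^{-Q} dx dt`. Away from the origin `ϱ² 𝓛_G = ψ(E² + nE) +
A`, where `A` (`angOp`) only sees the level sets of `ϱ`. For this measure `E` is antisymmetric, `Eψ
= 0`, and `-A` is the operator of a nonnegative form `Γ` (`carre`) which the dilations preserve and
which annihilates functions of `ϱ`.

Write `u = ϱ^{-(Q-4)/2} w`. The operator becomes `ψ(E² + 2E - b) + A` with `b = Q(Q-4)/4`, and every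
integral of the theorem becomes a combination of `‖w‖²`, `‖Ew‖²`, `‖E²w‖²` (norms of `L²(ψ
ϱ^{-Q})`), `Γ(w)`, `Γ(Ew)` and `∫(Aw)²/ψ`; see `weighted_integrals`. In (a) the norms cancel
exactly, and the difference of the two sides is `Γ(Ew) + ∫(Aw)²/ψ - 4Γ(w)`. In (b) the difference is
the same, because `∫|∇_G u|²/ϱ² = Γ(w) + ‖Ew‖² + ((Q-4)/2)²‖w‖²` and the middle remainder of (b) is
`Γ(w) + ‖Ew‖²`. So both parts rest on the spectral gap `4Γ(w) ≤ ∫(Aw)²/ψ`, `four_mul_wInt_carre_le`.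

The gap is dual to a Poincaré inequality on the level sets of `ϱ` (`fiber_poincare`). Off the
`t`-axis a level set is a cylinder with coordinates `σ = x/|x|` on the sphere and `τ = t/|x|²` on
the line, carrying powers of `1 + 4τ²` as weights. The mean over `σ` satisfies a one-dimensional
inequality with constant `2n+4`; the rest satisfies one with constant `n+1`, by the sharp Poincaré
inequality of the round sphere, itself read off from the Gaussian one. Both constants are at least
`4` because `n = Q - 2 ≥ 3`.

For sharpness take `w = η(log ϱ / k)`: then `Aw = 0`, `Γ(w) = Γ(Ew) = 0`, and each `E` costs a
factor `1/k`, so only `b²‖w‖²` survives for large `k`. -/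

/-! ### One-dimensional weighted inequalities by completing squares -/

open Filter Topology Set in
theorem integral_nonneg_of_hasDerivAt_le {φ : ℝ → ℝ} (hφ : Integrable φ)
    {a : ℝ → ℝ} (ha : Tendsto a atTop (𝓝 0))
    (h : ∀ R > 0, a R ≤ ∫ z in (-R)..R, φ z) : 0 ≤ ∫ z, φ z := by
  have h1 : Tendsto (fun R : ℝ => ∫ z in (-R)..R, φ z) atTop (𝓝 (∫ z, φ z)) :=
    intervalIntegral_tendsto_integral hφ tendsto_neg_atTop_atBot tendsto_id
  refine le_of_tendsto_of_tendsto ha h1 ?_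
  filter_upwards [eventually_gt_atTop 0] with R hR using h R hR

open Filter Topology Set in
/-- A weighted one-dimensional inequality for functions vanishing at the origin. -/
theorem integral_le_integral_deriv_of_vanishing {F F' v v' A P : ℝ → ℝ}
    (hF : ∀ z, HasDerivAt F (F' z) z) (hF0 : F 0 = 0) (hv : ∀ z, HasDerivAt v (v' z) z)
    (hv0 : ∀ z, 0 ≤ v z)
    (h : ∀ z, z ≠ 0 → ∀ a b : ℝ, v z * (2 * a * b / z - a ^ 2 / z ^ 2) + a ^ 2 * v' z / z ≤
      A z * b ^ 2 - P z * a ^ 2)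
    (hA : Integrable fun z => A z * F' z ^ 2) (hP : Integrable fun z => P z * F z ^ 2) :
    ∫ z, P z * F z ^ 2 ≤ ∫ z, A z * F' z ^ 2 := by
  rw [← sub_nonneg, ← integral_sub hA hP]
  set φ : ℝ → ℝ := fun z => A z * F' z ^ 2 - P z * F z ^ 2 with hφdef
  have hφ : Integrable φ := hA.sub hP
  -- The primitive is `F²v/z`: its derivative is the left side of `h`. Since `G(R) ≥ 0 ≥ G(-R)`, the
  -- boundary terms have the right sign and no decay at infinity is needed.
  set G : ℝ → ℝ := fun z => F z * (F z / z) * v z with hG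
  have hG0 : G 0 = 0 := by simp [hG]
  have hGd : ∀ z, z ≠ 0 → HasDerivAt G (v z * (2 * F z * F' z / z - F z ^ 2 / z ^ 2) +
      F z ^ 2 * v' z / z) z := by
    intro z hz
    have := ((hF z).mul ((hF z).div (hasDerivAt_id z) hz)).mul (hv z)
    convert! this using 1
    simp only [id, Pi.mul_apply, Pi.div_apply]
    field_simp
    ring
  -- At `0` the quotient `F/z` tends to `F'(0)` while `F` tends to `0`, which agrees with the value
  -- `G 0 = 0` given by division by zero.
  have hGc : Continuous G := by
    rw [continuous_iff_continuousAt]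
    intro z
    by_cases hz : z = 0
    · subst hz
      rw [continuousAt_iff_punctured_nhds, hG0]
      have h1 : Tendsto (fun z => F z / z) (𝓝[≠] 0) (𝓝 (F' 0)) := by
        have := (hF 0).tendsto_slope
        refine this.congr' ?_
        filter_upwards with z
        simp [slope_def_field, hF0]
      have h2 : Tendsto F (𝓝[≠] 0) (𝓝 0) := by
        have := (hF 0).continuousAt.tendsto
        rw [hF0] at this
        exact this.mono_left nhdsWithin_le_nhds
      have h3 : Tendsto v (𝓝[≠] 0) (𝓝 (v 0)) :=
        (hv 0).continuousAt.tendsto.mono_left nhdsWithin_le_nhds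
      simpa using (h2.mul h1).mul h3
    · exact (hGd z hz).continuousAt
  refine integral_nonneg_of_hasDerivAt_le hφ tendsto_const_nhds fun R hR => ?_
  have e1 := intervalIntegral.sub_le_integral_of_hasDeriv_right_of_le (φ := φ) hR.le
    hGc.continuousOn (fun x hx => (hGd x hx.1.ne').hasDerivWithinAt) hφ.integrableOn
    (fun x hx => h x hx.1.ne' _ _)
  have e2 := intervalIntegral.sub_le_integral_of_hasDeriv_right_of_le (φ := φ)
    (neg_nonpos.2 hR.le)
    hGc.continuousOn (fun x hx => (hGd x hx.2.ne).hasDerivWithinAt) hφ.integrableOn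
    (fun x hx => h x hx.2.ne _ _)
  rw [← intervalIntegral.integral_add_adjacent_intervals (b := 0) hφ.intervalIntegrable
    hφ.intervalIntegrable]
  have e3 : 0 ≤ G R := by
    have : G R = F R ^ 2 / R * v R := by simp only [hG]; ring
    rw [this]
    exact mul_nonneg (by positivity) (hv0 R)
  have e4 : G (-R) ≤ 0 := by
    have : G (-R) = -(F (-R) ^ 2 / R * v (-R)) := by simp only [hG]; field_simp
    rw [this, neg_nonpos]
    exact mul_nonneg (by positivity) (hv0 _)
  linarith

theorem hasDerivAt_one_add_four_sq_rpow (s z : ℝ) :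
    HasDerivAt (fun τ : ℝ => (1 + 4 * τ ^ 2) ^ s) (8 * s * z * (1 + 4 * z ^ 2) ^ (s - 1)) z := by
  have h1 : HasDerivAt (fun τ : ℝ => 1 + 4 * τ ^ 2) (8 * z) z := by
    convert! ((hasDerivAt_pow 2 z).const_mul 4).const_add 1 using 1
    simp; ring
  convert! h1.rpow_const (p := s) (Or.inl (by positivity)) using 1
  ring

/-- The axially symmetric part of the spectral gap on the Grushin sphere. -/
theorem integral_sq_le_integral_deriv_of_vanishing {N : ℝ} {F F' : ℝ → ℝ}
    (hF : ∀ z, HasDerivAt F (F' z) z) (hF0 : F 0 = 0)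
    (hA : Integrable fun z => (1 + 4 * z ^ 2) ^ (1 - N / 4) * F' z ^ 2)
    (hP : Integrable fun z => (1 + 4 * z ^ 2) ^ (-N / 4 - 1) * F z ^ 2) :
    (2 * N + 4) * ∫ z, (1 + 4 * z ^ 2) ^ (-N / 4 - 1) * F z ^ 2 ≤
      ∫ z, (1 + 4 * z ^ 2) ^ (1 - N / 4) * F' z ^ 2 := by
  have key := integral_le_integral_deriv_of_vanishing
    (P := fun z => (2 * N + 4) * (1 + 4 * z ^ 2) ^ (-N / 4 - 1))
    (A := fun z => (1 + 4 * z ^ 2) ^ (1 - N / 4)) hF hF0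
    (fun z => hasDerivAt_one_add_four_sq_rpow (-N / 4) z) (fun z => by positivity)
    ?_ hA (by simpa only [mul_assoc] using hP.const_mul (2 * N + 4))
  · simpa only [mul_assoc, integral_const_mul] using key
  · intro z hz a b
    set m := 1 + 4 * z ^ 2 with hm
    have hm0 : 0 < m := by positivity
    have e1 : m ^ (-N / 4) = m ^ (-N / 4 - 1) * m := by
      rw [← Real.rpow_add_one hm0.ne']; ring_nf
    have e2 : m ^ (1 - N / 4) = m ^ (-N / 4 - 1) * m ^ 2 := by
      rw [← Real.rpow_natCast, ← Real.rpow_add hm0]; norm_num; ring_nf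
    rw [e1, e2]
    set k := m ^ (-N / 4 - 1) with hk
    have hk0 : 0 < k := Real.rpow_pos_of_pos hm0 _
    -- The defect is an exact square, zero for `F = z(1+4z²)^{-1/2}`, which is `t/ϱ²` on the
    -- cylinder; hence the constant `2N+4`.
    have : k * m ^ 2 * b ^ 2 - (2 * N + 4) * k * a ^ 2 -
        (k * m * (2 * a * b / z - a ^ 2 / z ^ 2) + a ^ 2 * (8 * (-N / 4) * z * k) / z)
        = k * (m * b - a / z) ^ 2 := by
      have : a ^ 2 * 4 = a ^ 2 * (m - 1) / z ^ 2 := by rw [hm]; field_simp; ring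
      field_simp
      rw [hm]
      ring
    have h0 : 0 ≤ k * (m * b - a / z) ^ 2 := by positivity
    linarith

open Filter Topology Set in
/-- The non-axially-symmetric part of the spectral gap on the Grushin sphere. -/
theorem integral_sq_le_integral_deriv_add {N : ℝ} (hN : 2 < N) {F F' : ℝ → ℝ} {M : ℝ}
    (hF : ∀ z, HasDerivAt F (F' z) z) (hM : ∀ z, |F z| ≤ M)
    (hA : Integrable fun z => (1 + 4 * z ^ 2) ^ (1 - N / 4) * F' z ^ 2)
    (hP : Integrable fun z => (1 + 4 * z ^ 2) ^ (-N / 4 - 1) * F z ^ 2)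
    (hP' : Integrable fun z => (1 + 4 * z ^ 2) ^ (-N / 4) * F z ^ 2) :
    (N + 1) * ∫ z, (1 + 4 * z ^ 2) ^ (-N / 4 - 1) * F z ^ 2 ≤
      (∫ z, (1 + 4 * z ^ 2) ^ (1 - N / 4) * F' z ^ 2) +
        (N - 1) * ∫ z, (1 + 4 * z ^ 2) ^ (-N / 4) * F z ^ 2 := by
  have hi : Integrable fun z => (1 + 4 * z ^ 2) ^ (1 - N / 4) * F' z ^ 2 +
      (N - 1) * ((1 + 4 * z ^ 2) ^ (-N / 4) * F z ^ 2) -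
      (N + 1) * ((1 + 4 * z ^ 2) ^ (-N / 4 - 1) * F z ^ 2) :=
    (hA.add (hP'.const_mul _)).sub (hP.const_mul _)
  rw [← integral_const_mul, ← integral_const_mul, ← integral_add hA (hP'.const_mul _),
    ← sub_nonneg, ← integral_sub (by exact hA.add (hP'.const_mul _)) (hP.const_mul _)]
  -- Chosen so that the integrand minus `G'` is a multiple of `((1+4z²)F' + 2zF)²`, which vanishes
  -- for `F = (1+4z²)^{-1/4}`, that is for `|x|/ϱ`. Here the boundary terms have the wrong sign, but
  -- they are `O(R^{1-N/2})` and vanish in the limit since `N > 2`.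
  set G : ℝ → ℝ := fun z => -(2 * z * (1 + 4 * z ^ 2) ^ (-N / 4) * F z ^ 2) with hG
  have hGd : ∀ z, HasDerivAt G (-((2 * (1 + 4 * z ^ 2) ^ (-N / 4) +
      2 * z * (8 * (-N / 4) * z * (1 + 4 * z ^ 2) ^ (-N / 4 - 1))) * F z ^ 2 +
      2 * z * (1 + 4 * z ^ 2) ^ (-N / 4) * (2 * F z * F' z))) z := by
    intro z
    have := ((((hasDerivAt_id z).const_mul 2).mul
      (hasDerivAt_one_add_four_sq_rpow (-N / 4) z)).mul ((hF z).pow 2)).neg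
    convert! this using 1
    simp
  have hlim : Tendsto (fun R : ℝ => -(4 * M ^ 2 * (R ^ (1 - N / 2)))) atTop (𝓝 0) := by
    have : Tendsto (fun R : ℝ => R ^ (-(N / 2 - 1))) atTop (𝓝 0) :=
      tendsto_rpow_neg_atTop (by linarith)
    have := (this.const_mul (4 * M ^ 2)).neg
    simpa [show -(N / 2 - 1) = 1 - N / 2 by ring] using this
  have hbd : ∀ R > 0, ∀ z : ℝ, |z| = R → |G z| ≤ 2 * M ^ 2 * R ^ (1 - N / 2) := by
    intro R hR z hz
    have h2 : z ^ 2 = R ^ 2 := by rw [← hz, sq_abs]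
    have e : |G z| = 2 * R * (1 + 4 * R ^ 2) ^ (-N / 4) * F z ^ 2 := by
      simp only [hG, abs_neg, abs_mul, hz, h2]
      rw [abs_of_pos (by positivity : (0 : ℝ) < (1 + 4 * R ^ 2) ^ (-N / 4)), abs_two,
        abs_of_nonneg (sq_nonneg (F z))]
    have h3 : (1 + 4 * R ^ 2) ^ (-N / 4) ≤ R ^ (-N / 2) := by
      have : R ^ (-N / 2) = (R ^ 2) ^ (-N / 4) := by
        rw [← Real.rpow_natCast, ← Real.rpow_mul hR.le]; norm_num; ring_nf
      rw [this]
      exact Real.rpow_le_rpow_of_nonpos (by positivity) (by nlinarith) (by linarith)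
    have h4 : F z ^ 2 ≤ M ^ 2 := by
      rw [← sq_abs]; exact pow_le_pow_left₀ (abs_nonneg _) (hM z) 2
    have h5 : R ^ (1 - N / 2) = R * R ^ (-N / 2) := by
      rw [← Real.rpow_one_add' hR.le (by linarith)]; ring_nf
    rw [e, h5]
    calc 2 * R * (1 + 4 * R ^ 2) ^ (-N / 4) * F z ^ 2 ≤ 2 * R * R ^ (-N / 2) * M ^ 2 := by
          gcongr
      _ = _ := by ring
  refine integral_nonneg_of_hasDerivAt_le hi hlim fun R hR => ?_
  have e1 := intervalIntegral.sub_le_integral_of_hasDeriv_right_of_le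
    (by linarith : -R ≤ R) (fun x _ => (hGd x).continuousAt.continuousWithinAt)
    (fun x hx => (hGd x).hasDerivWithinAt) hi.integrableOn
    (fun z hx => ?_)
  · have b1 := (abs_le.1 (hbd R hR R (abs_of_pos hR))).1
    have b2 := (abs_le.1 (hbd R hR (-R) (by rw [abs_neg, abs_of_pos hR]))).2
    linarith
  · set m := 1 + 4 * z ^ 2 with hm
    have hm0 : 0 < m := by positivity
    have e1 : m ^ (-N / 4) = m ^ (-N / 4 - 1) * m := by
      rw [← Real.rpow_add_one hm0.ne']; ring_nf
    have e2 : m ^ (1 - N / 4) = m ^ (-N / 4 - 1) * m ^ 2 := by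
      rw [← Real.rpow_natCast, ← Real.rpow_add hm0]; norm_num; ring_nf
    rw [e1, e2]
    set k := m ^ (-N / 4 - 1) with hk
    have hk0 : 0 < k := Real.rpow_pos_of_pos hm0 _
    have h0 : 0 ≤ k * (m * F' z + 2 * z * F z) ^ 2 := by positivity
    have : z ^ 2 = (m - 1) / 4 := by rw [hm]; ring
    nlinarith [this]

/-! ### Gaussian Poincaré inequality and tensorization -/

open ProbabilityTheory in
/-- Gaussian Poincaré inequality on the line, for Lipschitz functions. -/
theorem integral_sq_sub_sq_integral_gaussianReal_le {F F' : ℝ → ℝ} {B : ℝ}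
    (hF : ∀ z, HasDerivAt F (F' z) z) (hB : ∀ z, |F' z| ≤ B) :
    ∫ z, F z ^ 2 ∂(gaussianReal 0 1) - (∫ z, F z ∂(gaussianReal 0 1)) ^ 2 ≤
      ∫ z, F' z ^ 2 ∂(gaussianReal 0 1) := by
  have hB0 : 0 ≤ B := (abs_nonneg _).trans (hB 0)
  have hF'eq : F' = deriv F := funext fun z => (hF z).deriv.symm
  have hF'm : Measurable F' := hF'eq ▸ measurable_deriv F
  have hFc : Continuous F := continuous_iff_continuousAt.2 fun z => (hF z).continuousAt
  set H : ℝ → ℝ := fun z => F z - F 0 with hHdef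
  have hHc : Continuous H := hFc.sub continuous_const
  have hH : ∀ z, HasDerivAt H (F' z) z := fun z => (hF z).sub_const _
  have hHb : ∀ z, |H z| ≤ B * |z| := by
    intro z
    have := Convex.norm_image_sub_le_of_norm_hasDerivWithin_le (s := Set.univ) (f := F) (f' := F')
      (C := B) (x := 0) (y := z) (fun x _ => (hF x).hasDerivWithinAt) (fun x _ => hB x)
      convex_univ (Set.mem_univ _) (Set.mem_univ _)
    simpa using this
  have hL : MemLp H 2 (gaussianReal 0 1) := by
    have h1 : MemLp (fun z : ℝ => B * z) 2 (gaussianReal 0 1) :=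
      (memLp_id_gaussianReal 2).const_mul B
    refine h1.of_le hHc.aestronglyMeasurable (Filter.Eventually.of_forall fun z => ?_)
    rw [Real.norm_eq_abs, Real.norm_eq_abs, abs_mul, abs_of_nonneg hB0]
    exact hHb z
  have hH2 : Integrable (fun z => H z ^ 2) (gaussianReal 0 1) := hL.integrable_sq
  have hH1 : Integrable H (gaussianReal 0 1) := hL.integrable (by norm_num)
  have hF2 : Integrable (fun z => F' z ^ 2) (gaussianReal 0 1) := by
    refine Integrable.of_bound (C := B ^ 2) (by fun_prop) (Filter.Eventually.of_forall fun z => ?_)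
    rw [Real.norm_eq_abs, abs_pow]
    exact pow_le_pow_left₀ (abs_nonneg _) (hB z) 2
  have e1 : ∫ z, F z ^ 2 ∂(gaussianReal 0 1) - (∫ z, F z ∂(gaussianReal 0 1)) ^ 2 =
      ∫ z, H z ^ 2 ∂(gaussianReal 0 1) - (∫ z, H z ∂(gaussianReal 0 1)) ^ 2 := by
    have hFH : ∀ z, F z = H z + F 0 := fun z => by simp [hHdef]
    have h1 : ∫ z, F z ∂(gaussianReal 0 1) = ∫ z, H z ∂(gaussianReal 0 1) + F 0 := by
      rw [integral_congr_ae (Filter.Eventually.of_forall hFH),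
        integral_add hH1 (integrable_const _)]
      simp
    have h2 : ∫ z, F z ^ 2 ∂(gaussianReal 0 1) = ∫ z, H z ^ 2 ∂(gaussianReal 0 1) +
        2 * F 0 * ∫ z, H z ∂(gaussianReal 0 1) + F 0 ^ 2 := by
      have : ∀ z, F z ^ 2 = H z ^ 2 + 2 * F 0 * H z + F 0 ^ 2 := fun z => by rw [hFH]; ring
      rw [integral_congr_ae (Filter.Eventually.of_forall this),
        integral_add (by exact hH2.add (hH1.const_mul _)) (integrable_const _),
        integral_add hH2 (hH1.const_mul _), integral_const_mul]
      simp
    rw [h1, h2]; ring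
  rw [e1]
  -- The variance is at most the second moment about `F 0`, and `H` vanishes at `0`, so the
  -- inequality for functions vanishing at the origin applies with the Gaussian density as `v`.
  refine (sub_le_self _ (sq_nonneg _)).trans ?_
  rw [gaussianReal_of_var_ne_zero _ one_ne_zero,
    integrable_withDensity_iff_integrable_smul' (by fun_prop) (by simp [gaussianPDF])] at hH2 hF2
  simp only [toReal_gaussianPDF, smul_eq_mul] at hH2 hF2
  rw [integral_gaussianReal_eq_integral_smul one_ne_zero,
    integral_gaussianReal_eq_integral_smul one_ne_zero]
  simp only [smul_eq_mul]
  refine integral_le_integral_deriv_of_vanishing (v := gaussianPDFReal 0 1)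
    (v' := fun z => -z * gaussianPDFReal 0 1 z) hH (by simp [hHdef]) ?_
    (fun z => gaussianPDFReal_nonneg _ _ _) ?_ hF2 hH2
  · intro z
    simp only [gaussianPDFReal_def]
    have h1 : HasDerivAt (fun x : ℝ => -(x - 0) ^ 2 / (2 * ((1 : NNReal) : ℝ))) (-z) z := by
      have := ((hasDerivAt_pow 2 z).neg).div_const 2
      convert! this using 1
      · ext x; simp
      · simp; ring
    convert! (h1.exp.const_mul _) using 1
    ring
  · intro z hz a b
    have h0 := gaussianPDFReal_nonneg 0 1 z
    set k := gaussianPDFReal 0 1 z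
    have : k * b ^ 2 - k * a ^ 2 - (k * (2 * a * b / z - a ^ 2 / z ^ 2) + a ^ 2 * (-z * k) / z)
        = k * (b - a / z) ^ 2 := by field_simp; ring
    have : 0 ≤ k * (b - a / z) ^ 2 := by positivity
    linarith

theorem sq_integral_le_integral_sq {Z : Type*} [MeasurableSpace Z] (κ : Measure Z)
    [IsProbabilityMeasure κ] {g : Z → ℝ} (h1 : Integrable g κ)
    (h2 : Integrable (fun z => g z ^ 2) κ) : (∫ z, g z ∂κ) ^ 2 ≤ ∫ z, g z ^ 2 ∂κ := by
  have : 0 ≤ ∫ z, (g z - ∫ z, g z ∂κ) ^ 2 ∂κ := integral_nonneg fun z => sq_nonneg _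
  have e : ∀ z, (g z - ∫ z, g z ∂κ) ^ 2 =
    g z ^ 2 - 2 * (∫ z, g z ∂κ) * g z + (∫ z, g z ∂κ) ^ 2 := fun z => by ring
  rw [integral_congr_ae (Filter.Eventually.of_forall e),
    integral_add (by exact h2.sub (h1.const_mul _)) (integrable_const _),
    integral_sub h2 (h1.const_mul _), integral_const_mul] at this
  simp only [integral_const, probReal_univ, one_smul] at this
  nlinarith

/-- The expansion of `∫ (f - p - q + m)² ≥ 0`. With `p`, `q` the two partial means of `f` and `m`
its mean, this is the subadditivity of the variance. -/
theorem integral_sq_add_sq_le {Z : Type*} [MeasurableSpace Z] {κ : Measure Z}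
    [IsProbabilityMeasure κ] {f p q : Z → ℝ} (hf : MemLp f 2 κ) (hp : MemLp p 2 κ)
    (hq : MemLp q 2 κ) (m : ℝ) :
    0 ≤ (∫ z, f z ^ 2 ∂κ) + (∫ z, p z ^ 2 ∂κ) + (∫ z, q z ^ 2 ∂κ) + m ^ 2
      - 2 * (∫ z, f z * p z ∂κ) - 2 * (∫ z, f z * q z ∂κ) + 2 * (∫ z, p z * q z ∂κ)
      + 2 * m * (∫ z, f z ∂κ) - 2 * m * (∫ z, p z ∂κ) - 2 * m * (∫ z, q z ∂κ) := by
  have hpos : 0 ≤ ∫ z, (f z - p z - q z + m) ^ 2 ∂κ :=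
    integral_nonneg fun z => sq_nonneg _
  have e : ∀ z, (f z - p z - q z + m) ^ 2 = f z ^ 2 + p z ^ 2 + q z ^ 2 + m ^ 2
      - 2 * (f z * p z) - 2 * (f z * q z) + 2 * (p z * q z)
      + 2 * m * f z - 2 * m * p z - 2 * m * q z := fun z => by ring
  have h1 : Integrable (fun z => f z ^ 2) κ := hf.integrable_sq
  have h2 : Integrable (fun z => p z ^ 2) κ := hp.integrable_sq
  have h3 : Integrable (fun z => q z ^ 2) κ := hq.integrable_sq
  have h4 : Integrable (fun z => f z * p z) κ := hf.integrable_mul hp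
  have h5 : Integrable (fun z => f z * q z) κ := hf.integrable_mul hq
  have h6 : Integrable (fun z => p z * q z) κ := hp.integrable_mul hq
  have h7 : Integrable f κ := hf.integrable (by norm_num)
  have h8 : Integrable p κ := hp.integrable (by norm_num)
  have h9 : Integrable q κ := hq.integrable (by norm_num)
  have h10 : Integrable (fun _ : Z => m ^ 2) κ := integrable_const _
  rw [integral_congr_ae (Filter.Eventually.of_forall e),
    integral_sub (by fun_prop) (by fun_prop), integral_sub (by fun_prop) (by fun_prop),
    integral_add (by fun_prop) (by fun_prop), integral_add (by fun_prop) (by fun_prop),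
    integral_sub (by fun_prop) (by fun_prop), integral_sub (by fun_prop) (by fun_prop),
    integral_add (by fun_prop) (by fun_prop), integral_add (by fun_prop) (by fun_prop),
    integral_add (by fun_prop) (by fun_prop)] at hpos
  simpa only [integral_const_mul, integral_const, probReal_univ, one_smul] using hpos

theorem integrable_sq_integral_left {X Y : Type*} [MeasurableSpace X] [MeasurableSpace Y]
    (μ : Measure X) (ν : Measure Y) [IsProbabilityMeasure μ] [IsProbabilityMeasure ν]
    {f : X × Y → ℝ} (hf : MemLp f 2 (μ.prod ν)) :
    Integrable (fun x => (∫ y, f (x, y) ∂ν) ^ 2) μ := by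
  have hf1 : Integrable f (μ.prod ν) := hf.integrable (by norm_num)
  have hf2 : Integrable (fun z => f z ^ 2) (μ.prod ν) := hf.integrable_sq
  refine hf2.integral_prod_left.mono' (hf1.integral_prod_left.1.pow 2) ?_
  filter_upwards [hf1.prod_right_ae, hf2.prod_right_ae] with x h1 h2
  rw [Real.norm_of_nonneg (sq_nonneg _)]
  exact sq_integral_le_integral_sq ν h1 h2

theorem integrable_sq_integral_right {X Y : Type*} [MeasurableSpace X] [MeasurableSpace Y]
    (μ : Measure X) (ν : Measure Y) [IsProbabilityMeasure μ] [IsProbabilityMeasure ν]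
    {f : X × Y → ℝ} (hf : MemLp f 2 (μ.prod ν)) :
    Integrable (fun y => (∫ x, f (x, y) ∂μ) ^ 2) ν := by
  have hf1 : Integrable f (μ.prod ν) := hf.integrable (by norm_num)
  have hf2 : Integrable (fun z => f z ^ 2) (μ.prod ν) := hf.integrable_sq
  refine hf2.integral_prod_right.mono' (hf1.integral_prod_right.1.pow 2) ?_
  filter_upwards [hf1.prod_left_ae, hf2.prod_left_ae] with y h1 h2
  rw [Real.norm_of_nonneg (sq_nonneg _)]
  exact sq_integral_le_integral_sq μ h1 h2

/-- Subadditivity of the variance over two independent variables. -/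
theorem variance_prod_le {X Y : Type*} [MeasurableSpace X] [MeasurableSpace Y]
    (μ : Measure X) (ν : Measure Y) [IsProbabilityMeasure μ] [IsProbabilityMeasure ν]
    {f : X × Y → ℝ} (hf : MemLp f 2 (μ.prod ν)) :
    ∫ z, f z ^ 2 ∂(μ.prod ν) - (∫ z, f z ∂(μ.prod ν)) ^ 2 ≤
      (∫ y, (∫ x, f (x, y) ^ 2 ∂μ - (∫ x, f (x, y) ∂μ) ^ 2) ∂ν) +
      ∫ x, (∫ y, f (x, y) ^ 2 ∂ν - (∫ y, f (x, y) ∂ν) ^ 2) ∂μ := by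
  have hf1 : Integrable f (μ.prod ν) := hf.integrable (by norm_num)
  have hf2 : Integrable (fun z => f z ^ 2) (μ.prod ν) := hf.integrable_sq
  set p : X → ℝ := fun x => ∫ y, f (x, y) ∂ν with hp
  set q : Y → ℝ := fun y => ∫ x, f (x, y) ∂μ with hq
  have hpi : Integrable p μ := hf1.integral_prod_left
  have hqi : Integrable q ν := hf1.integral_prod_right
  have hp2 : Integrable (fun x => p x ^ 2) μ := integrable_sq_integral_left μ ν hf
  have hq2 : Integrable (fun y => q y ^ 2) ν := integrable_sq_integral_right μ ν hf
  set m : ℝ := ∫ z, f z ∂(μ.prod ν) with hm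
  have e0 : ∫ z, f z ^ 2 ∂(μ.prod ν) = ∫ x, ∫ y, f (x, y) ^ 2 ∂ν ∂μ := integral_prod _ hf2
  have e0' : ∫ z, f z ^ 2 ∂(μ.prod ν) = ∫ y, ∫ x, f (x, y) ^ 2 ∂μ ∂ν := integral_prod_symm _ hf2
  have em : m = ∫ x, p x ∂μ := integral_prod _ hf1
  have em' : m = ∫ y, q y ∂ν := integral_prod_symm _ hf1
  rw [integral_sub hf2.integral_prod_right hq2, integral_sub hf2.integral_prod_left hp2,
    ← e0, ← e0']
  have hpL : MemLp (fun z : X × Y => p z.1) 2 (μ.prod ν) :=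
    ((memLp_two_iff_integrable_sq hpi.1).2 hp2).comp_fst ν
  have hqL : MemLp (fun z : X × Y => q z.2) 2 (μ.prod ν) :=
    ((memLp_two_iff_integrable_sq hqi.1).2 hq2).comp_snd μ
  have hfp : Integrable (fun z : X × Y => f z * p z.1) (μ.prod ν) := hf.integrable_mul hpL
  have hfq : Integrable (fun z : X × Y => f z * q z.2) (μ.prod ν) := hf.integrable_mul hqL
  have hpq : Integrable (fun z : X × Y => p z.1 * q z.2) (μ.prod ν) := hpi.mul_prod hqi
  have i1 : ∫ z, f z * p z.1 ∂(μ.prod ν) = ∫ x, p x ^ 2 ∂μ := by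
    rw [integral_prod _ hfp]
    congr 1; ext x
    simp only [integral_mul_const]
    rw [sq]
  have i2 : ∫ z, f z * q z.2 ∂(μ.prod ν) = ∫ y, q y ^ 2 ∂ν := by
    rw [integral_prod_symm _ hfq]
    congr 1; ext y
    simp only [integral_mul_const]
    rw [sq]
  have i3 : ∫ z, p z.1 * q z.2 ∂(μ.prod ν) = m ^ 2 := by
    rw [integral_prod_mul, ← em, ← em', sq]
  have i4 : ∫ z, p z.1 ^ 2 ∂(μ.prod ν) = ∫ x, p x ^ 2 ∂μ := by
    simp [integral_fun_fst (μ := μ) (ν := ν) (fun x => p x ^ 2)]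
  have i5 : ∫ z, q z.2 ^ 2 ∂(μ.prod ν) = ∫ y, q y ^ 2 ∂ν := by
    simp [integral_fun_snd (μ := μ) (ν := ν) (fun x => q x ^ 2)]
  have i6 : ∫ z, p z.1 ∂(μ.prod ν) = m := by
    simp [integral_fun_fst (μ := μ) (ν := ν) p, em]
  have i7 : ∫ z, q z.2 ∂(μ.prod ν) = m := by
    simp [integral_fun_snd (μ := μ) (ν := ν) q, em']
  have hpp := hpL.integrable_sq
  have hqq := hqL.integrable_sq
  have hp1 : Integrable (fun z : X × Y => p z.1) (μ.prod ν) := hpL.integrable (by norm_num)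
  have hq1 : Integrable (fun z : X × Y => q z.2) (μ.prod ν) := hqL.integrable (by norm_num)
  have := integral_sq_add_sq_le hf hpL hqL m
  rw [i1, i2, i3, i4, i5, i6, i7, ← hm] at this
  nlinarith

/-- Tensorization of Poincaré inequalities over the coordinates of a product space. -/
theorem variance_pi_le (γ : Measure ℝ) [IsProbabilityMeasure γ] (n : ℕ) :
    ∀ (f : (Fin n → ℝ) → ℝ) (D : Fin n → (Fin n → ℝ) → ℝ),
    MemLp f 2 (Measure.pi fun _ => γ) → (∀ i, Integrable (D i) (Measure.pi fun _ => γ)) →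
    (∀ i, ∀ᵐ x ∂(Measure.pi fun _ : Fin n => γ), ∫ s, f (Function.update x i s) ^ 2 ∂γ -
      (∫ s, f (Function.update x i s) ∂γ) ^ 2 ≤ ∫ s, D i (Function.update x i s) ∂γ) →
    ∫ x, f x ^ 2 ∂(Measure.pi fun _ => γ) - (∫ x, f x ∂(Measure.pi fun _ => γ)) ^ 2 ≤
      ∑ i, ∫ x, D i x ∂(Measure.pi fun _ => γ) := by
  induction n with
  | zero =>
    intro f D hf hD h
    simp [Measure.pi_of_empty fun _ : Fin 0 => γ]
  | succ n ih =>
    intro f D hf hD h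
    have mp : MeasurePreserving (fun z : ℝ × (Fin n → ℝ) => (Fin.cons z.1 z.2 : Fin (n + 1) → ℝ))
        (γ.prod (Measure.pi fun _ => γ)) (Measure.pi fun _ => γ) := by
      have := (measurePreserving_piFinSuccAbove (fun _ : Fin (n + 1) => γ) 0).symm
      convert! this using 1
      ext z i
      simp [MeasurableEquiv.piFinSuccAbove, Fin.insertNthEquiv]
    have me : MeasurableEmbedding
        (fun z : ℝ × (Fin n → ℝ) => (Fin.cons z.1 z.2 : Fin (n + 1) → ℝ)) := by
      have := (MeasurableEquiv.piFinSuccAbove (fun _ : Fin (n + 1) => ℝ) 0).symm.measurableEmbedding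
      convert! this using 1
      ext z i
      simp [MeasurableEquiv.piFinSuccAbove, Fin.insertNthEquiv]
    have hf' : MemLp (fun z : ℝ × (Fin n → ℝ) => f (Fin.cons z.1 z.2)) 2
        (γ.prod (Measure.pi fun _ => γ)) := hf.comp_measurePreserving mp
    have hD' : ∀ i, Integrable (fun z : ℝ × (Fin n → ℝ) => D i (Fin.cons z.1 z.2))
        (γ.prod (Measure.pi fun _ => γ)) := fun i => mp.integrable_comp_of_integrable (hD i)
    have hf2 := hf'.integrable_sq
    have h' : ∀ i, ∀ᵐ z ∂(γ.prod (Measure.pi fun _ : Fin n => γ)),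
      ∫ s, f (Function.update (Fin.cons z.1 z.2) i s) ^ 2 ∂γ -
      (∫ s, f (Function.update (Fin.cons z.1 z.2) i s) ∂γ) ^ 2 ≤
        ∫ s, D i (Function.update (Fin.cons z.1 z.2) i s) ∂γ := fun i =>
      mp.quasiMeasurePreserving.ae (h i)
    rw [← mp.integral_comp me, ← mp.integral_comp me, Fin.sum_univ_succ]
    refine (variance_prod_le γ _ hf').trans (add_le_add ?_ ?_)
    · rw [← mp.integral_comp me, integral_prod_symm _ (hD' 0)]
      refine integral_mono_ae
        (hf2.integral_prod_right.sub (integrable_sq_integral_right _ _ hf'))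
        (hD' 0).integral_prod_right ?_
      -- The condition in coordinate `0` overwrites that coordinate, so a single generic value `a`
      -- of it serves for almost all `y`.
      have := (Measure.ae_ae_of_ae_prod (h' 0)).exists
      obtain ⟨a, ha⟩ := this
      filter_upwards [ha] with y hy
      simpa only [Fin.update_cons_zero] using hy
    · have hsum : Integrable (fun z : ℝ × (Fin n → ℝ) => ∑ i, D (Fin.succ i) (Fin.cons z.1 z.2))
          (γ.prod (Measure.pi fun _ => γ)) := integrable_finsetSum _ fun i _ => hD' _
      have e : ∑ i : Fin n, ∫ x, D i.succ x ∂(Measure.pi fun _ => γ) =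
          ∫ x, ∫ y, ∑ i : Fin n, D i.succ (Fin.cons x y) ∂(Measure.pi fun _ => γ) ∂γ := by
        rw [← integral_prod _ hsum, integral_finsetSum _ fun i _ => hD' _]
        refine Finset.sum_congr rfl fun i _ => ?_
        rw [← mp.integral_comp me]
      rw [e]
      refine integral_mono_ae
        (hf2.integral_prod_left.sub (integrable_sq_integral_left _ _ hf'))
        hsum.integral_prod_left ?_
      have hall := ae_all_iff.2 fun i : Fin n => Measure.ae_ae_of_ae_prod (h' i.succ)
      have hDall := ae_all_iff.2 fun i : Fin n => (hD' i.succ).prod_right_ae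
      filter_upwards [hall, hDall, hf2.prod_right_ae,
        (hf'.integrable (by norm_num)).prod_right_ae,
        hf'.1.prodMk_left] with x hx hDx hfx hfx1 hm
      rw [integral_finsetSum _ fun i _ => hDx i]
      refine ih (fun y => f (Fin.cons x y)) (fun i y => D i.succ (Fin.cons x y)) ?_ hDx ?_
      · exact (memLp_two_iff_integrable_sq hm).2 hfx
      · intro i
        filter_upwards [hx i] with y hy
        simpa only [Fin.cons_update] using hy

/-! ### Euclidean polar coordinates and Gaussian moments -/

theorem nontrivial_euclideanSpace {n : ℕ} (hn : 1 ≤ n) :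
    Nontrivial (EuclideanSpace ℝ (Fin n)) := by
  have : NeZero n := ⟨by omega⟩
  have : Nontrivial (Fin n → ℝ) := inferInstance
  exact (WithLp.toLp_injective 2).nontrivial

section Polar

open Set Metric Measure

variable {E : Type*} [NormedAddCommGroup E] [NormedSpace ℝ E] [MeasurableSpace E] [BorelSpace E]
  [FiniteDimensional ℝ E] [Nontrivial E] (μ : Measure E) [μ.IsAddHaarMeasure]

theorem lintegral_eq_lintegral_toSphere {F : E → ENNReal} (hF : Measurable F) :
    ∫⁻ x, F x ∂μ = ∫⁻ σ : sphere (0 : E) 1, ∫⁻ r in Ioi (0 : ℝ),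
      ENNReal.ofReal (r ^ (Module.finrank ℝ E - 1)) * F (r • (σ : E)) ∂volume ∂μ.toSphere := by
  have h1 : ∫⁻ x, F x ∂μ = ∫⁻ x : ({(0)}ᶜ : Set E), F x ∂(μ.comap (↑)) := by
    rw [lintegral_subtype_comap (measurableSet_singleton _).compl F, restrict_compl_singleton]
  rw [h1]
  have h2 := μ.measurePreserving_homeomorphUnitSphereProd.lintegral_comp_emb
    (Homeomorph.measurableEmbedding _) (fun z => F ((z.2 : ℝ) • (z.1 : E)))
  have h3 : ∀ x : ({(0)}ᶜ : Set E), F (((homeomorphUnitSphereProd E x).2 : ℝ) •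
      ((homeomorphUnitSphereProd E x).1 : E)) = F x := by
    intro x
    have : ‖(x : E)‖ ≠ 0 := norm_ne_zero_iff.2 x.2
    simp [smul_smul, this]
  simp_rw [h3] at h2
  rw [h2, lintegral_prod _ (by fun_prop)]
  congr 1
  ext σ
  rw [volumeIoiPow, lintegral_withDensity_eq_lintegral_mul _ (by fun_prop) (by fun_prop)]
  exact lintegral_subtype_comap measurableSet_Ioi
    fun r => ENNReal.ofReal (r ^ (Module.finrank ℝ E - 1)) * F (r • (σ : E))

/-- Separation of variables: it reduces Gaussian integrals of homogeneous functions to integrals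
over the sphere, up to radial moments. -/
theorem integral_norm_mul_toSphere (h : ℝ → ℝ) (Φ : E → ℝ) :
    ∫ x, h ‖x‖ * Φ (‖x‖⁻¹ • x) ∂μ = (∫ σ : sphere (0 : E) 1, Φ σ ∂μ.toSphere) *
      ∫ r in Ioi (0 : ℝ), r ^ (Module.finrank ℝ E - 1) * h r := by
  have h1 : ∫ x, h ‖x‖ * Φ (‖x‖⁻¹ • x) ∂μ =
      ∫ x : ({(0)}ᶜ : Set E), h ‖(x : E)‖ * Φ (‖(x : E)‖⁻¹ • (x : E)) ∂(μ.comap (↑)) := by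
    rw [integral_subtype_comap (measurableSet_singleton _).compl
      (fun x => h ‖x‖ * Φ (‖x‖⁻¹ • x)), restrict_compl_singleton]
  rw [h1]
  have h2 := μ.measurePreserving_homeomorphUnitSphereProd.integral_comp
    (Homeomorph.measurableEmbedding _) (fun z => Φ (z.1 : E) * h (z.2 : ℝ))
  have h3 : ∀ x : ({(0)}ᶜ : Set E), Φ ((homeomorphUnitSphereProd E x).1 : E) *
      h ((homeomorphUnitSphereProd E x).2 : ℝ) =
      h ‖(x : E)‖ * Φ (‖(x : E)‖⁻¹ • (x : E)) := by
    intro x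
    simp [mul_comm]
  simp_rw [h3] at h2
  rw [h2, integral_prod_mul (fun σ : sphere (0 : E) 1 => Φ σ) (fun r : Ioi (0 : ℝ) => h r)]
  congr 1
  rw [volumeIoiPow, integral_withDensity_eq_integral_toReal_smul (by fun_prop) (by simp),
    integral_subtype_comap measurableSet_Ioi
      (fun a : ℝ => (ENNReal.ofReal (a ^ (Module.finrank ℝ E - 1))).toReal • h a)]
  refine setIntegral_congr_fun measurableSet_Ioi fun r hr => ?_
  rw [ENNReal.toReal_ofReal (pow_nonneg (le_of_lt hr) _), smul_eq_mul]

end Polar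

-- The recursion `Γ(s+1) = sΓ(s)`. With `k = n - 1` it yields the factor `n` that becomes the
-- constant `n - 1` of the sphere.
open Set in
theorem integral_pow_add_two_mul_exp (k : ℕ) :
    ∫ r in Ioi (0 : ℝ), r ^ k * (r ^ 2 * Real.exp (-r ^ 2 / 2)) =
      (k + 1) * ∫ r in Ioi (0 : ℝ), r ^ k * Real.exp (-r ^ 2 / 2) := by
  have key : ∀ j : ℕ, ∫ r in Ioi (0 : ℝ), r ^ j * Real.exp (-r ^ 2 / 2) =
      (1 / 2 : ℝ) ^ (-(j + 1 : ℝ) / 2) * (1 / 2) * Real.Gamma ((j + 1) / 2) := by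
    intro j
    have := integral_rpow_mul_exp_neg_mul_rpow (p := 2) (q := j) (b := 1 / 2) (by norm_num)
      (by have := Nat.cast_nonneg (α := ℝ) j; linarith) (by norm_num)
    rw [← this]
    refine setIntegral_congr_fun measurableSet_Ioi fun r _ => ?_
    simp only [Real.rpow_natCast, Real.rpow_two]
    congr 2; ring
  have e : ∫ r in Ioi (0 : ℝ), r ^ k * (r ^ 2 * Real.exp (-r ^ 2 / 2)) =
      ∫ r in Ioi (0 : ℝ), r ^ (k + 2) * Real.exp (-r ^ 2 / 2) := by
    congr 1; ext r; ring
  rw [e, key, key]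
  have h1 : (((k + 2 : ℕ) : ℝ) + 1) / 2 = (k + 1 : ℝ) / 2 + 1 := by push_cast; ring
  have h2 : -(((k + 2 : ℕ) : ℝ) + 1) / 2 = -(k + 1 : ℝ) / 2 + (-1 : ℝ) := by push_cast; ring
  rw [h1, h2, Real.Gamma_add_one (by positivity), Real.rpow_add (by norm_num),
    Real.rpow_neg_one]
  ring

open Set in
theorem integral_pow_mul_exp_pos (k : ℕ) :
    0 < ∫ r in Ioi (0 : ℝ), r ^ k * Real.exp (-r ^ 2 / 2) := by
  have := integral_rpow_mul_exp_neg_mul_rpow (p := 2) (q := k) (b := 1 / 2) (by norm_num)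
      (by have := Nat.cast_nonneg (α := ℝ) k; linarith) (by norm_num)
  have e : ∫ r in Ioi (0 : ℝ), r ^ k * Real.exp (-r ^ 2 / 2) =
      ∫ (x : ℝ) in Ioi 0, x ^ (k : ℝ) * Real.exp (-(1 / 2) * x ^ (2 : ℝ)) := by
    refine setIntegral_congr_fun measurableSet_Ioi fun r _ => ?_
    simp only [Real.rpow_natCast, Real.rpow_two]
    congr 2; ring
  rw [e, this]
  have : 0 < Real.Gamma (((k : ℝ) + 1) / 2) := Real.Gamma_pos_of_pos (by positivity)
  positivity

open ProbabilityTheory in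
theorem pi_gaussianReal_eq_withDensity (n : ℕ) :
    Measure.pi (fun _ : Fin n => gaussianReal 0 1) =
      (volume : Measure (Fin n → ℝ)).withDensity
        fun x => ENNReal.ofReal (∏ i, gaussianPDFReal 0 1 (x i)) := by
  refine Measure.pi_eq fun s hs => ?_
  have hint : Integrable (fun x : Fin n → ℝ => ∏ i, gaussianPDFReal 0 1 (x i)) :=
    Integrable.fin_nat_prod fun i => integrable_gaussianPDFReal 0 1
  have hnn : ∀ x : Fin n → ℝ, 0 ≤ ∏ i, gaussianPDFReal 0 1 (x i) := fun x =>
    Finset.prod_nonneg fun i _ => gaussianPDFReal_nonneg _ _ _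
  rw [withDensity_apply _ (MeasurableSet.univ_pi hs),
    ← ofReal_integral_eq_lintegral_ofReal hint.integrableOn
      (Filter.Eventually.of_forall hnn),
    ← integral_indicator (MeasurableSet.univ_pi hs)]
  have e : (Set.univ.pi s).indicator (fun x : Fin n → ℝ => ∏ i, gaussianPDFReal 0 1 (x i)) =
      fun x => ∏ i, (s i).indicator (gaussianPDFReal 0 1) (x i) := by
    ext x
    by_cases hx : x ∈ Set.univ.pi s
    · rw [Set.indicator_of_mem hx]
      exact Finset.prod_congr rfl fun i _ => (Set.indicator_of_mem (hx i (Set.mem_univ i)) _).symm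
    · rw [Set.indicator_of_notMem hx]
      simp only [Set.mem_univ_pi, not_forall] at hx
      obtain ⟨i, hi⟩ := hx
      exact (Finset.prod_eq_zero (Finset.mem_univ i) (Set.indicator_of_notMem hi _)).symm
  rw [e, integral_fintype_prod_volume_eq_prod, ENNReal.ofReal_prod_of_nonneg
    fun i _ => integral_nonneg fun x => Set.indicator_nonneg
      (fun x _ => gaussianPDFReal_nonneg _ _ _) _]
  refine Finset.prod_congr rfl fun i _ => ?_
  rw [gaussianReal_apply_eq_integral _ one_ne_zero, integral_indicator (hs i)]

open ProbabilityTheory in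
theorem integral_pi_gaussianReal (n : ℕ) (F : EuclideanSpace ℝ (Fin n) → ℝ) :
    ∫ x, F (WithLp.toLp 2 x) ∂(Measure.pi fun _ : Fin n => gaussianReal 0 1) =
      ((√(2 * Real.pi))⁻¹) ^ n * ∫ x, Real.exp (-‖x‖ ^ 2 / 2) * F x := by
  rw [pi_gaussianReal_eq_withDensity, integral_withDensity_eq_integral_toReal_smul
    (by fun_prop) (by simp), ← integral_const_mul,
    ← (PiLp.volume_preserving_toLp (Fin n)).integral_comp
      (MeasurableEquiv.toLp 2 (Fin n → ℝ)).measurableEmbedding]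
  congr 1; ext x
  rw [ENNReal.toReal_ofReal (Finset.prod_nonneg fun i _ => gaussianPDFReal_nonneg _ _ _),
    EuclideanSpace.norm_sq_eq]
  simp only [gaussianPDFReal_def, Finset.prod_mul_distrib, Finset.prod_const, Finset.card_univ,
    Fintype.card_fin, ← Real.exp_sum, smul_eq_mul, Real.norm_eq_abs, sq_abs, sub_zero,
    NNReal.coe_one, mul_one, neg_div, Finset.sum_neg_distrib, Finset.sum_div]
  ring

/-! ### The sharp Poincaré inequality on the round sphere -/

open scoped InnerProductSpace in
theorem hasDerivAt_norm_mul_normalize {E : Type*} [NormedAddCommGroup E] [InnerProductSpace ℝ E]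
    {f : E → ℝ} (hf : Differentiable ℝ f) {c : ℝ → E} {v : E} {z : ℝ}
    (hc : HasDerivAt c v z) (h0 : c z ≠ 0) :
    HasDerivAt (fun s => ‖c s‖ * f (‖c s‖⁻¹ • c s))
      (fderiv ℝ f (‖c z‖⁻¹ • c z) v + (f (‖c z‖⁻¹ • c z) -
        fderiv ℝ f (‖c z‖⁻¹ • c z) (‖c z‖⁻¹ • c z)) * ⟪‖c z‖⁻¹ • c z, v⟫_ℝ) z := by
  have hn : ‖c z‖ ≠ 0 := norm_ne_zero_iff.2 h0
  have h1 : HasDerivAt (fun s => ‖c s‖) (⟪c z, v⟫_ℝ / ‖c z‖) z := by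
    have := hc.norm_sq.sqrt (by positivity)
    simp only [Real.sqrt_sq (norm_nonneg _)] at this
    convert! this using 1
    field_simp
  have h2 := ((hf _).hasFDerivAt.comp_hasDerivAt z ((h1.inv hn).smul hc))
  have h3 := h1.mul h2
  convert! h3 using 1
  simp only [Function.comp, map_add, map_smul, smul_eq_mul, real_inner_smul_left, Pi.inv_apply,
    Pi.smul_apply']
  field_simp
  ring

open ProbabilityTheory in
theorem memLp_norm_pi_gaussianReal (n : ℕ) :
    MemLp (fun x : Fin n → ℝ => ‖WithLp.toLp 2 x‖) 2
      (Measure.pi fun _ : Fin n => gaussianReal 0 1) := by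
  have h1 : MemLp (fun x : Fin n → ℝ => ∑ i, |x i|) 2
      (Measure.pi fun _ : Fin n => gaussianReal 0 1) := by
    refine memLp_finsetSum _ fun i _ => ?_
    have := (memLp_id_gaussianReal (μ := 0) (v := 1) 2).comp_measurePreserving
      (measurePreserving_eval (fun _ : Fin n => gaussianReal 0 1) i)
    exact this.norm
  refine h1.of_le (measurable_norm.comp (WithLp.measurable_toLp 2 _)).aestronglyMeasurable
    (Filter.Eventually.of_forall fun x => ?_)
  rw [norm_norm, EuclideanSpace.norm_eq]
  refine (Real.sqrt_le_iff.2 ⟨Finset.sum_nonneg fun i _ => abs_nonneg (x i), ?_⟩).trans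
    (le_abs_self _)
  exact Finset.sum_sq_le_sq_sum_of_nonneg fun i _ => abs_nonneg _

/-- Pythagoras for the gradient of the 1-homogeneous extension of `f`, with `ℓ = df` and `b = f(σ)`:
the tangential part is that of `ℓ` and the radial part is `b`. -/
theorem sum_sq_add_mul_eq {n : ℕ} (ℓ : EuclideanSpace ℝ (Fin n) →L[ℝ] ℝ) (b : ℝ)
    {σ : EuclideanSpace ℝ (Fin n)} (hσ : ‖σ‖ = 1) :
    ∑ i, (ℓ (EuclideanSpace.single i 1) + (b - ℓ σ) * σ i) ^ 2 =
      (∑ i, ℓ (EuclideanSpace.single i 1) ^ 2 - ℓ σ ^ 2) + b ^ 2 := by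
  have hs : ∑ i, σ i ^ 2 = 1 := by
    have : ‖σ‖ ^ 2 = 1 := by rw [hσ]; norm_num
    rw [EuclideanSpace.norm_sq_eq] at this
    simpa using this
  have hs2 : ∑ i, ℓ (EuclideanSpace.single i 1) * σ i = ℓ σ := by
    have := (EuclideanSpace.basisFun (Fin n) ℝ).sum_repr σ
    conv_rhs => rw [← this]
    simp [mul_comm]
  have e : ∀ i, (ℓ (EuclideanSpace.single i 1) + (b - ℓ σ) * σ i) ^ 2 =
      ℓ (EuclideanSpace.single i 1) ^ 2 + 2 * (b - ℓ σ) * (ℓ (EuclideanSpace.single i 1) * σ i) +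
      (b - ℓ σ) ^ 2 * σ i ^ 2 := fun i => by ring
  simp_rw [e]
  rw [Finset.sum_add_distrib, Finset.sum_add_distrib, ← Finset.mul_sum, ← Finset.mul_sum, hs, hs2]
  ring

set_option maxHeartbeats 1000000 in
open ProbabilityTheory Metric Measure in
/-- The sharp Poincaré inequality on the round sphere. -/
theorem sphere_poincare {n : ℕ} (hn : 2 ≤ n) {f : EuclideanSpace ℝ (Fin n) → ℝ}
    (hf : ContDiff ℝ 1 f)
    (h0 : ∫ σ : sphere (0 : EuclideanSpace ℝ (Fin n)) 1, f σ ∂volume.toSphere = 0) :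
    ((n : ℝ) - 1) * ∫ σ : sphere (0 : EuclideanSpace ℝ (Fin n)) 1, f σ ^ 2 ∂volume.toSphere ≤
      ∫ σ : sphere (0 : EuclideanSpace ℝ (Fin n)) 1,
        (∑ i, fderiv ℝ f σ (EuclideanSpace.single i 1) ^ 2 - fderiv ℝ f σ σ ^ 2)
          ∂volume.toSphere := by
  have := nontrivial_euclideanSpace (n := n) (by omega)
  have hfd : Differentiable ℝ f := hf.differentiable (by norm_num)
  have hfc : Continuous f := hf.continuous
  have hdc : Continuous (fderiv ℝ f) := hf.continuous_fderiv (by norm_num)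
  obtain ⟨K, hK⟩ := (isCompact_closedBall
    (0 : EuclideanSpace ℝ (Fin n)) 1).exists_bound_of_continuousOn
    (f := fun x => (f x, fderiv ℝ f x)) (by fun_prop)
  have hK1 : ∀ σ : EuclideanSpace ℝ (Fin n), ‖σ‖ ≤ 1 → |f σ| ≤ K := fun σ hσ =>
    (le_max_left _ _).trans (hK σ (by simpa using hσ))
  have hK2 : ∀ σ : EuclideanSpace ℝ (Fin n), ‖σ‖ ≤ 1 → ‖fderiv ℝ f σ‖ ≤ K := fun σ hσ =>
    (le_max_right _ _).trans (hK σ (by simpa using hσ))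
  have hK0 : 0 ≤ K := (abs_nonneg _).trans (hK1 0 (by simp))
  have hω : ∀ x : EuclideanSpace ℝ (Fin n), ‖‖x‖⁻¹ • x‖ ≤ 1 := by
    intro x
    rw [norm_smul, norm_inv, norm_norm]
    exact inv_mul_le_one
  -- the directional derivative of the homogeneous extension
  set d : Fin n → EuclideanSpace ℝ (Fin n) → ℝ := fun i σ =>
    fderiv ℝ f σ (EuclideanSpace.single i 1) + (f σ - fderiv ℝ f σ σ) * σ i with hd
  have hdcont : ∀ i, Continuous (d i) := fun i => by
    simp only [hd]; fun_prop
  have hdb : ∀ i σ, ‖σ‖ ≤ 1 → |d i σ| ≤ 3 * K := by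
    intro i σ hσ
    have h1 : |fderiv ℝ f σ (EuclideanSpace.single i 1)| ≤ K := by
      refine ((fderiv ℝ f σ).le_opNorm _).trans ?_
      simpa using hK2 σ hσ
    have h2 : |fderiv ℝ f σ σ| ≤ K := by
      refine ((fderiv ℝ f σ).le_opNorm _).trans ?_
      calc _ ≤ K * 1 := mul_le_mul (hK2 σ hσ) hσ (norm_nonneg _) hK0
        _ = K := mul_one K
    have h3 : |σ i| ≤ 1 := (PiLp.norm_apply_le σ i).trans hσ
    calc |d i σ| ≤ |fderiv ℝ f σ (EuclideanSpace.single i 1)| +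
          |(f σ - fderiv ℝ f σ σ) * σ i| := abs_add_le _ _
      _ ≤ K + (K + K) * 1 := by
          rw [abs_mul]
          gcongr
          exact (abs_sub _ _).trans (add_le_add (hK1 σ hσ) h2)
      _ = 3 * K := by ring
  set γ := Measure.pi fun _ : Fin n => gaussianReal 0 1 with hγ
  -- Homogeneity of degree one keeps the inequality sharp: degree-one harmonics extend to linear
  -- functions, which are extremal for the Gaussian inequality.
  set g : EuclideanSpace ℝ (Fin n) → ℝ := fun x => ‖x‖ * f (‖x‖⁻¹ • x) with hg
  have hnm : Measurable fun x : EuclideanSpace ℝ (Fin n) => ‖x‖⁻¹ • x := by fun_prop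
  have hgm : Measurable g := measurable_norm.mul (hfc.measurable.comp hnm)
  have hgL : MemLp (fun x => g (WithLp.toLp 2 x)) 2 γ := by
    refine ((memLp_norm_pi_gaussianReal n).const_mul K).of_le
      (hgm.comp (WithLp.measurable_toLp 2 _)).aestronglyMeasurable
      (Filter.Eventually.of_forall fun x => ?_)
    rw [Real.norm_eq_abs, Real.norm_eq_abs, abs_of_nonneg (by positivity :
      0 ≤ K * ‖WithLp.toLp 2 x‖)]
    simp only [hg, abs_mul, abs_norm]
    rw [mul_comm]
    exact mul_le_mul_of_nonneg_right (hK1 _ (hω _)) (norm_nonneg _)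
  have hDint : ∀ i, Integrable (fun x : Fin n → ℝ =>
      d i (‖WithLp.toLp 2 x‖⁻¹ • WithLp.toLp 2 x) ^ 2) γ := by
    intro i
    refine Integrable.of_bound (C := (3 * K) ^ 2)
      ((((hdcont i).measurable.comp hnm).comp (WithLp.measurable_toLp 2 _)).pow_const
        2).aestronglyMeasurable
      (Filter.Eventually.of_forall fun x => ?_)
    rw [Real.norm_eq_abs, abs_pow]
    exact pow_le_pow_left₀ (abs_nonneg _) (hdb i _ (hω _)) 2
  have main := variance_pi_le (gaussianReal 0 1) n (fun x => g (WithLp.toLp 2 x))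
    (fun i x => d i (‖WithLp.toLp 2 x‖⁻¹ • WithLp.toLp 2 x) ^ 2) hgL hDint ?_
  · set c : ℝ := ((√(2 * Real.pi))⁻¹) ^ n with hc
    have hc0 : 0 < c := by positivity
    have hdim : Module.finrank ℝ (EuclideanSpace ℝ (Fin n)) = n := by simp
    set J := ∫ r in Set.Ioi (0 : ℝ), r ^ (n - 1) * Real.exp (-r ^ 2 / 2) with hJ
    have hJ0 : 0 < J := integral_pow_mul_exp_pos _
    have e1 : ∫ x, g (WithLp.toLp 2 x) ∂γ = 0 := by
      rw [hγ, integral_pi_gaussianReal]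
      have := integral_norm_mul_toSphere (volume : Measure (EuclideanSpace ℝ (Fin n)))
        (fun r => Real.exp (-r ^ 2 / 2) * r) f
      simp only [hg]
      simp only [mul_assoc] at this
      rw [this, h0]; simp
    have e2 : ∫ x, g (WithLp.toLp 2 x) ^ 2 ∂γ = c * ((∫ σ : sphere (0 : EuclideanSpace ℝ (Fin n)) 1,
        f σ ^ 2 ∂volume.toSphere) * (n * J)) := by
      rw [hγ, integral_pi_gaussianReal (F := fun x => g x ^ 2)]
      have := integral_norm_mul_toSphere (volume : Measure (EuclideanSpace ℝ (Fin n)))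
        (fun r => r ^ 2 * Real.exp (-r ^ 2 / 2)) (fun σ => f σ ^ 2)
      rw [hdim, integral_pow_add_two_mul_exp, ← hJ, Nat.cast_sub (by omega)] at this
      rw [← hc]
      congr 1
      convert! this using 1
      · congr 1; ext x; simp only [hg]; ring
      · simp
    have e3 : ∀ i, ∫ x : Fin n → ℝ, d i (‖WithLp.toLp 2 x‖⁻¹ • WithLp.toLp 2 x) ^ 2 ∂γ =
        c * ((∫ σ : sphere (0 : EuclideanSpace ℝ (Fin n)) 1, d i σ ^ 2 ∂volume.toSphere) * J) := by
      intro i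
      rw [hγ, integral_pi_gaussianReal (F := fun x => d i (‖x‖⁻¹ • x) ^ 2)]
      have := integral_norm_mul_toSphere (volume : Measure (EuclideanSpace ℝ (Fin n)))
        (fun r => Real.exp (-r ^ 2 / 2)) (fun σ => d i σ ^ 2)
      rw [hdim] at this
      rw [this]
    have ic : ∀ {φ : EuclideanSpace ℝ (Fin n) → ℝ}, Continuous φ →
        Integrable (fun σ : sphere (0 : EuclideanSpace ℝ (Fin n)) 1 => φ σ) volume.toSphere := by
      intro φ hφ
      exact (hφ.comp continuous_subtype_val).integrable_of_hasCompactSupport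
        (HasCompactSupport.of_compactSpace _)
    rw [e1, e2] at main
    rw [Finset.sum_congr rfl fun i _ => e3 i] at main
    rw [← Finset.mul_sum, ← Finset.sum_mul, ← integral_finsetSum _ fun i _ =>
      ic (φ := fun σ => d i σ ^ 2) ((hdcont i).pow 2)] at main
    have e4 : ∀ σ : sphere (0 : EuclideanSpace ℝ (Fin n)) 1, ∑ i, d i σ ^ 2 =
        (∑ i, fderiv ℝ f σ (EuclideanSpace.single i 1) ^ 2 - fderiv ℝ f σ σ ^ 2) + f σ ^ 2 :=
      fun σ => sum_sq_add_mul_eq _ _ (by simp)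
    rw [integral_congr_ae (Filter.Eventually.of_forall e4)] at main
    rw [integral_add (ic (φ := fun σ => ∑ i, fderiv ℝ f σ (EuclideanSpace.single i 1) ^ 2 -
      fderiv ℝ f σ σ ^ 2) (by fun_prop)) (ic (φ := fun σ => f σ ^ 2) (by fun_prop))] at main
    -- After cancelling `c * J`, `main` reads `n ∫f² ≤ ∫|∇_σ f|² + ∫f²`; the last term comes from
    -- the radial derivative and lowers `n` to `n - 1`.
    have hcJ : 0 < c * J := mul_pos hc0 hJ0
    refine le_of_mul_le_mul_left ?_ hcJ
    nlinarith
  · intro i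
    -- A line in direction `i` avoids the origin, where the extension may fail to be differentiable,
    -- as soon as another coordinate is nonzero; this is where `2 ≤ n` enters.
    obtain ⟨j, hj⟩ : ∃ j : Fin n, j ≠ i := by
      have : Nontrivial (Fin n) := Fin.nontrivial_iff_two_le.2 hn
      exact exists_ne i
    have hae : ∀ᵐ x : Fin n → ℝ ∂γ, x j ≠ 0 := by
      have : NullSingletonClass (gaussianReal 0 1) := nullSingletonClass_gaussianReal one_ne_zero
      rw [ae_iff]
      simp only [not_not]
      exact Measure.pi_hyperplane (fun _ : Fin n => gaussianReal 0 1) j 0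
    filter_upwards [hae] with x hx
    set cu : ℝ → EuclideanSpace ℝ (Fin n) := fun s => WithLp.toLp 2 (Function.update x i s) with hcu
    have hcu0 : ∀ s, cu s ≠ 0 := by
      intro s h
      have := congrArg (fun y : EuclideanSpace ℝ (Fin n) => y j) h
      simp [hcu, Function.update_of_ne hj] at this
      exact hx this
    have hcd : ∀ s, HasDerivAt cu (EuclideanSpace.single i 1) s := by
      intro s
      have := (PiLp.hasFDerivAt_toLp (𝕜 := ℝ) 2 (Function.update x i s)).comp_hasDerivAt s
        (hasDerivAt_update x i s)
      convert! this using 1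
    refine integral_sq_sub_sq_integral_gaussianReal_le (B := 3 * K)
      (F' := fun s => d i (‖cu s‖⁻¹ • cu s)) (fun s => ?_) fun s => hdb i _ (hω _)
    have := hasDerivAt_norm_mul_normalize hfd (hcd s) (hcu0 s)
    convert! this using 1
    simp only [hd]
    rw [EuclideanSpace.inner_single_right]
    simp

/-! ### Poincaré inequality on the weighted cylinder -/

theorem integrable_one_add_four_sq_rpow {s : ℝ} (hs : s < -1 / 2) :
    Integrable fun τ : ℝ => (1 + 4 * τ ^ 2) ^ s := by
  have h1 : Integrable fun τ : ℝ => (1 + ‖τ‖ ^ 2) ^ (-(-2 * s) / 2) :=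
    integrable_rpow_neg_one_add_norm_sq (by simp; linarith)
  have h2 := h1.comp_mul_left' (two_ne_zero)
  refine h2.congr (Filter.Eventually.of_forall fun τ => ?_)
  simp only [Real.norm_eq_abs, sq_abs]
  ring_nf

/-- The deviation from the mean is orthogonal to constants. This separates the spherical mean from
the remainder in both sides of the cylinder inequality. -/
theorem integral_sq_sub_mean {X : Type*} [MeasurableSpace X] {ν : Measure X} [IsFiniteMeasure ν]
    {f : X → ℝ} (h1 : Integrable f ν) (h2 : Integrable (fun x => f x ^ 2) ν) (c : ℝ)
    (hν : ν.real Set.univ ≠ 0) :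
    ∫ x, (f x - c) ^ 2 ∂ν = ∫ x, (f x - (∫ y, f y ∂ν) / ν.real Set.univ) ^ 2 ∂ν +
      ν.real Set.univ * ((∫ y, f y ∂ν) / ν.real Set.univ - c) ^ 2 := by
  have e : ∀ b : ℝ, ∫ x, (f x - b) ^ 2 ∂ν =
      ∫ x, f x ^ 2 ∂ν - 2 * b * ∫ x, f x ∂ν + b ^ 2 * ν.real Set.univ := by
    intro b
    have : ∀ x, (f x - b) ^ 2 = f x ^ 2 - 2 * b * f x + b ^ 2 := fun x => by ring
    rw [integral_congr_ae (Filter.Eventually.of_forall this),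
      integral_add (by exact h2.sub (h1.const_mul _)) (integrable_const _),
      integral_sub h2 (h1.const_mul _), integral_const_mul]
    simp [mul_comm]
  rw [e, e]
  field_simp
  ring

/-- If `f(x, τ)` is bounded and its `x`-oscillation is controlled by `g`, then `f` satisfies a
Poincaré inequality on the weighted cylinder parametrizing the Grushin sphere. -/
theorem cylinder_poincare {X : Type*} [TopologicalSpace X] [CompactSpace X]
    [SecondCountableTopology X] [MeasurableSpace X] [BorelSpace X] {ν : Measure X}
    [IsFiniteMeasure ν] (hν : ν ≠ 0) {N : ℝ} (hN : 3 ≤ N) {f f' g : X × ℝ → ℝ}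
    (hf : Continuous f) (hf' : Continuous f') (hg : Continuous g)
    (hd : ∀ x τ, HasDerivAt (fun τ => f (x, τ)) (f' (x, τ)) τ) {M : ℝ}
    (hfM : ∀ z, |f z| ≤ M) (hf'M : ∀ x τ, |f' (x, τ)| ≤ M * (1 + 4 * τ ^ 2) ^ (-3 / 4 : ℝ))
    (hgM : ∀ z, |g z| ≤ M)
    (hX : ∀ τ, (N - 1) * ∫ x, (f (x, τ) - (∫ y, f (y, τ) ∂ν) / ν.real Set.univ) ^ 2 ∂ν ≤
      ∫ x, g (x, τ) ∂ν) :
    Integrable (fun z : X × ℝ => (1 + 4 * z.2 ^ 2) ^ (-N / 4 - 1) *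
      (f z - (∫ y, f (y, 0) ∂ν) / ν.real Set.univ) ^ 2) (ν.prod volume) ∧
    Integrable (fun z : X × ℝ => (1 + 4 * z.2 ^ 2) ^ (1 - N / 4) * f' z ^ 2 +
      (1 + 4 * z.2 ^ 2) ^ (-N / 4) * g z) (ν.prod volume) ∧
    4 * ∫ z : X × ℝ, (1 + 4 * z.2 ^ 2) ^ (-N / 4 - 1) *
        (f z - (∫ y, f (y, 0) ∂ν) / ν.real Set.univ) ^ 2 ∂(ν.prod volume) ≤
      ∫ z : X × ℝ, ((1 + 4 * z.2 ^ 2) ^ (1 - N / 4) * f' z ^ 2 +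
        (1 + 4 * z.2 ^ 2) ^ (-N / 4) * g z) ∂(ν.prod volume) := by
  set V := ν.real Set.univ with hV
  have hV0 : 0 < V := by
    rw [hV, measureReal_def]
    exact ENNReal.toReal_pos (by simpa using hν) (measure_ne_top _ _)
  obtain ⟨x0, -⟩ : (Set.univ : Set X).Nonempty :=
    nonempty_of_measure_ne_zero (μ := ν) (by simpa using hν)
  have hM0 : 0 ≤ M := (abs_nonneg _).trans (hfM (x0, 0))
  have hwc : ∀ s : ℝ, Continuous fun τ : ℝ => (1 + 4 * τ ^ 2) ^ s := fun s =>
    Continuous.rpow_const (by fun_prop) fun τ => Or.inl (by positivity)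
  have hwc2 : ∀ s : ℝ, Continuous fun z : X × ℝ => (1 + 4 * z.2 ^ 2) ^ s := fun s =>
    (hwc s).comp continuous_snd
  have hw1 : ∀ τ : ℝ, (1 + 4 * τ ^ 2) ^ (-3 / 4 : ℝ) ≤ 1 := fun τ =>
    Real.rpow_le_one_of_one_le_of_nonpos (by nlinarith [sq_nonneg τ]) (by norm_num)
  have hf'M' : ∀ x τ, |f' (x, τ)| ≤ M := fun x τ =>
    (hf'M x τ).trans (mul_le_of_le_one_right hM0 (hw1 τ))
  -- The weight `(1+4τ²)^{1-N/4}` alone need not be integrable; the decay `-3/4` of the derivative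
  -- brings its exponent down to `-N/4 - 1/2 < -1/2`.
  have hq : ∀ C τ a : ℝ, |a| ≤ C * (1 + 4 * τ ^ 2) ^ (-3 / 4 : ℝ) →
      (1 + 4 * τ ^ 2) ^ (1 - N / 4) * a ^ 2 ≤ C ^ 2 * (1 + 4 * τ ^ 2) ^ (-N / 4 - 1 / 2) := by
    intro C τ a ha
    have h1 : a ^ 2 ≤ (C * (1 + 4 * τ ^ 2) ^ (-3 / 4 : ℝ)) ^ 2 := by
      rw [← sq_abs a]; exact pow_le_pow_left₀ (abs_nonneg _) ha 2
    calc _ ≤ (1 + 4 * τ ^ 2) ^ (1 - N / 4) * (C * (1 + 4 * τ ^ 2) ^ (-3 / 4 : ℝ)) ^ 2 := by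
          gcongr
      _ = _ := by
          rw [mul_pow, ← Real.rpow_natCast (((1 + 4 * τ ^ 2) ^ (-3 / 4 : ℝ))),
            ← Real.rpow_mul (by positivity), mul_left_comm, ← Real.rpow_add (by positivity)]
          norm_num; left; ring_nf
  -- integrability on the product and on the line
  have ip : ∀ {s : ℝ} {φ : X × ℝ → ℝ} {C : ℝ}, s < -1 / 2 → Continuous φ → (∀ z, |φ z| ≤ C) →
      Integrable (fun z : X × ℝ => (1 + 4 * z.2 ^ 2) ^ s * φ z) (ν.prod volume) := by
    intro s φ C hs hφ hC
    refine Integrable.mul_bdd (c := C) ?_ hφ.aestronglyMeasurable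
      (Filter.Eventually.of_forall hC)
    exact (integrable_one_add_four_sq_rpow hs).comp_snd ν
  have il : ∀ {s : ℝ} {φ : ℝ → ℝ} {C : ℝ}, s < -1 / 2 → Continuous φ → (∀ z, |φ z| ≤ C) →
      Integrable (fun z : ℝ => (1 + 4 * z ^ 2) ^ s * φ z) := by
    intro s φ C hs hφ hC
    exact Integrable.mul_bdd (c := C) (integrable_one_add_four_sq_rpow hs)
      hφ.aestronglyMeasurable (Filter.Eventually.of_forall hC)
  have iqp : ∀ {φ : X × ℝ → ℝ} {C : ℝ}, Continuous φ →
      (∀ x τ, |φ (x, τ)| ≤ C * (1 + 4 * τ ^ 2) ^ (-3 / 4 : ℝ)) →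
      Integrable (fun z : X × ℝ => (1 + 4 * z.2 ^ 2) ^ (1 - N / 4) * φ z ^ 2)
        (ν.prod volume) := by
    intro φ C hφ hC
    refine Integrable.mono' (g := fun z : X × ℝ => C ^ 2 * (1 + 4 * z.2 ^ 2) ^ (-N / 4 - 1 / 2))
      (((integrable_one_add_four_sq_rpow (by linarith)).comp_snd ν).const_mul _)
      ((hwc2 _).mul (hφ.pow 2)).aestronglyMeasurable (Filter.Eventually.of_forall fun z => ?_)
    rw [Real.norm_of_nonneg (by positivity)]
    exact hq _ _ _ (hC z.1 z.2)
  have iql : ∀ {φ : ℝ → ℝ} {C : ℝ}, Continuous φ →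
      (∀ τ, |φ τ| ≤ C * (1 + 4 * τ ^ 2) ^ (-3 / 4 : ℝ)) →
      Integrable (fun z : ℝ => (1 + 4 * z ^ 2) ^ (1 - N / 4) * φ z ^ 2) := by
    intro φ C hφ hC
    refine Integrable.mono' (g := fun z : ℝ => C ^ 2 * (1 + 4 * z ^ 2) ^ (-N / 4 - 1 / 2))
      ((integrable_one_add_four_sq_rpow (by linarith)).const_mul _)
      ((hwc _).mul (hφ.pow 2)).aestronglyMeasurable (Filter.Eventually.of_forall fun z => ?_)
    rw [Real.norm_of_nonneg (by positivity)]
    exact hq _ _ _ (hC z)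
  have ix : ∀ {φ : X → ℝ}, Continuous φ → Integrable φ ν := fun hφ =>
    hφ.integrable_of_hasCompactSupport (HasCompactSupport.of_compactSpace _)
  have avgc : ∀ {φ : X × ℝ → ℝ}, Continuous φ → Continuous fun τ => (∫ y, φ (y, τ) ∂ν) / V := by
    intro φ hφ
    have := continuous_parametric_integral_of_continuous (μ := ν)
      (f := fun (τ : ℝ) (y : X) => φ (y, τ)) (by fun_prop) (isCompact_univ)
    simp only [Measure.restrict_univ] at this
    exact this.div_const _
  have avgb : ∀ {φ : X × ℝ → ℝ} {C : ℝ} (τ : ℝ), (∀ y, |φ (y, τ)| ≤ C) →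
      |(∫ y, φ (y, τ) ∂ν) / V| ≤ C := by
    intro φ C τ h
    have := norm_integral_le_of_norm_le_const (μ := ν) (f := fun y => φ (y, τ)) (C := C)
      (Filter.Eventually.of_forall h)
    rw [abs_div, abs_of_pos hV0, div_le_iff₀ hV0]
    exact this
  set fb : ℝ → ℝ := fun τ => (∫ y, f (y, τ) ∂ν) / V with hfb
  set fb' : ℝ → ℝ := fun τ => (∫ y, f' (y, τ) ∂ν) / V with hfb'
  have hfbc : Continuous fb := avgc hf
  have hfb'c : Continuous fb' := avgc hf'
  have hfbM : ∀ τ, |fb τ| ≤ M := fun τ => avgb τ fun y => hfM _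
  have hfb'M : ∀ τ, |fb' τ| ≤ M * (1 + 4 * τ ^ 2) ^ (-3 / 4 : ℝ) := fun τ =>
    avgb τ fun y => hf'M _ _
  have hfbd : ∀ τ, HasDerivAt fb (fb' τ) τ := by
    intro τ
    have := hasDerivAt_integral_of_dominated_loc_of_deriv_le (μ := ν) (𝕜 := ℝ)
      (F := fun (τ : ℝ) (y : X) => f (y, τ)) (F' := fun (τ : ℝ) (y : X) => f' (y, τ))
      (x₀ := τ) (s := Set.univ) (bound := fun _ => M) Filter.univ_mem
      (Filter.Eventually.of_forall fun τ => Continuous.aestronglyMeasurable (by fun_prop))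
      (ix (by fun_prop)) (Continuous.aestronglyMeasurable (by fun_prop))
      (Filter.Eventually.of_forall fun y τ _ => hf'M' y τ) (integrable_const _)
      (Filter.Eventually.of_forall fun y τ _ => hd y τ)
    exact this.2.div_const V
  -- The constant is the spherical mean at `τ = 0` rather than the weighted mean over the cylinder,
  -- so that `fb - c` vanishes at the origin.
  set c := fb 0 with hc
  have hsub : ∀ (a b C : ℝ), |a| ≤ C → |b| ≤ C → |a - b| ≤ 2 * C := fun a b C ha hb =>
    (abs_sub _ _).trans (by linarith)
  have sqb : ∀ (a C : ℝ), |a| ≤ C → |a ^ 2| ≤ C ^ 2 := fun a C h => by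
    rw [abs_pow]; exact pow_le_pow_left₀ (abs_nonneg _) h 2
  -- integrability of all the terms
  have I1 : Integrable (fun z : X × ℝ => (1 + 4 * z.2 ^ 2) ^ (-N / 4 - 1) * (f z - c) ^ 2)
      (ν.prod volume) :=
    ip (by linarith) (by fun_prop) fun z => sqb _ _ (hsub _ _ M (hfM z) (hfbM 0))
  have I2 := iqp hf' hf'M
  have I3 : Integrable (fun z : X × ℝ => (1 + 4 * z.2 ^ 2) ^ (-N / 4) * g z)
      (ν.prod volume) := ip (by linarith) hg hgM
  have I4 : Integrable (fun z : X × ℝ => (1 + 4 * z.2 ^ 2) ^ (-N / 4 - 1) * (f z - fb z.2) ^ 2)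
      (ν.prod volume) :=
    ip (by linarith) (by fun_prop) fun z => sqb _ _ (hsub _ _ M (hfM z) (hfbM _))
  have I5 : Integrable (fun z : X × ℝ => (1 + 4 * z.2 ^ 2) ^ (-N / 4) * (f z - fb z.2) ^ 2)
      (ν.prod volume) :=
    ip (by linarith) (by fun_prop) fun z => sqb _ _ (hsub _ _ M (hfM z) (hfbM _))
  have I6 : Integrable (fun z : X × ℝ => (1 + 4 * z.2 ^ 2) ^ (1 - N / 4) *
      (f' z - fb' z.2) ^ 2) (ν.prod volume) :=
    iqp (C := 2 * M) (by fun_prop) fun x τ => by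
      rw [mul_assoc]; exact hsub _ _ _ (hf'M _ _) (hfb'M _)
  have I7 : Integrable fun τ : ℝ => (1 + 4 * τ ^ 2) ^ (-N / 4 - 1) * (fb τ - c) ^ 2 :=
    il (by linarith) (by fun_prop) fun z => sqb _ _ (hsub _ _ M (hfbM _) (hfbM 0))
  have I8 := iql hfb'c hfb'M
  refine ⟨I1, I2.add I3, ?_⟩
  -- the nonsymmetric part
  have S1 : (N + 1) * ∫ z : X × ℝ, (1 + 4 * z.2 ^ 2) ^ (-N / 4 - 1) * (f z - fb z.2) ^ 2
      ∂(ν.prod volume) ≤ (∫ z : X × ℝ, (1 + 4 * z.2 ^ 2) ^ (1 - N / 4) *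
      (f' z - fb' z.2) ^ 2 ∂(ν.prod volume)) + (N - 1) * ∫ z : X × ℝ,
      (1 + 4 * z.2 ^ 2) ^ (-N / 4) * (f z - fb z.2) ^ 2 ∂(ν.prod volume) := by
    rw [integral_prod _ I4, integral_prod _ I5, integral_prod _ I6, ← integral_const_mul,
      ← integral_const_mul, ← integral_add I6.integral_prod_left
        (I5.integral_prod_left.const_mul _)]
    refine integral_mono (I4.integral_prod_left.const_mul _) (I6.integral_prod_left.add
        (I5.integral_prod_left.const_mul _)) fun x => ?_
    refine integral_sq_le_integral_deriv_add (M := 2 * M) (by linarith)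
      (fun τ => (hd x τ).sub (hfbd τ)) (fun τ => hsub _ _ _ (hfM _) (hfbM _)) ?_ ?_ ?_
    · exact iql (C := 2 * M) (by fun_prop) fun τ => by
        rw [mul_assoc]; exact hsub _ _ _ (hf'M _ _) (hfb'M _)
    · exact il (by linarith) (by fun_prop) fun z => sqb _ _ (hsub _ _ M (hfM _) (hfbM _))
    · exact il (by linarith) (by fun_prop) fun z => sqb _ _ (hsub _ _ M (hfM _) (hfbM _))
  -- the symmetric part
  have S2 : (2 * N + 4) * ∫ τ : ℝ, (1 + 4 * τ ^ 2) ^ (-N / 4 - 1) * (fb τ - c) ^ 2 ≤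
      ∫ τ : ℝ, (1 + 4 * τ ^ 2) ^ (1 - N / 4) * fb' τ ^ 2 :=
    integral_sq_le_integral_deriv_of_vanishing (fun τ => (hfbd τ).sub_const c) (by simp [hc])
      I8 I7
  have S3 : (N - 1) * ∫ z : X × ℝ, (1 + 4 * z.2 ^ 2) ^ (-N / 4) * (f z - fb z.2) ^ 2
      ∂(ν.prod volume) ≤ ∫ z : X × ℝ, (1 + 4 * z.2 ^ 2) ^ (-N / 4) * g z ∂(ν.prod volume) := by
    rw [integral_prod_symm _ I5, integral_prod_symm _ I3, ← integral_const_mul]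
    refine integral_mono (I5.integral_prod_right.const_mul _) I3.integral_prod_right fun τ => ?_
    simp only [integral_const_mul]
    have := mul_le_mul_of_nonneg_left (hX τ)
      (by positivity : (0 : ℝ) ≤ (1 + 4 * τ ^ 2) ^ (-N / 4))
    linarith
  -- `S4` and `S5` split mass and `τ`-energy orthogonally. The `σ`-energy goes entirely to the
  -- remainder, through `S3`.
  have S4 : ∫ z : X × ℝ, (1 + 4 * z.2 ^ 2) ^ (-N / 4 - 1) * (f z - c) ^ 2 ∂(ν.prod volume) =
      (∫ z : X × ℝ, (1 + 4 * z.2 ^ 2) ^ (-N / 4 - 1) * (f z - fb z.2) ^ 2 ∂(ν.prod volume)) +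
      V * ∫ τ : ℝ, (1 + 4 * τ ^ 2) ^ (-N / 4 - 1) * (fb τ - c) ^ 2 := by
    rw [integral_prod_symm _ I1, integral_prod_symm _ I4, ← integral_const_mul,
      ← integral_add I4.integral_prod_right (I7.const_mul _)]
    refine integral_congr_ae (Filter.Eventually.of_forall fun τ => ?_)
    simp only [integral_const_mul]
    rw [integral_sq_sub_mean (ix (by fun_prop)) (ix (by fun_prop)) c hV0.ne']
    ring
  have S5 : ∫ z : X × ℝ, (1 + 4 * z.2 ^ 2) ^ (1 - N / 4) * f' z ^ 2 ∂(ν.prod volume) =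
      (∫ z : X × ℝ, (1 + 4 * z.2 ^ 2) ^ (1 - N / 4) * (f' z - fb' z.2) ^ 2 ∂(ν.prod volume)) +
      V * ∫ τ : ℝ, (1 + 4 * τ ^ 2) ^ (1 - N / 4) * fb' τ ^ 2 := by
    rw [integral_prod_symm _ I2, integral_prod_symm _ I6, ← integral_const_mul,
      ← integral_add I6.integral_prod_right (I8.const_mul _)]
    refine integral_congr_ae (Filter.Eventually.of_forall fun τ => ?_)
    simp only [integral_const_mul]
    have := integral_sq_sub_mean (ν := ν) (f := fun y => f' (y, τ)) (ix (by fun_prop))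
      (ix (by fun_prop)) 0 hV0.ne'
    simp only [sub_zero] at this
    rw [this]
    ring
  rw [integral_add I2 I3, S4, S5]
  set A := ∫ z : X × ℝ, (1 + 4 * z.2 ^ 2) ^ (-N / 4 - 1) * (f z - fb z.2) ^ 2 ∂(ν.prod volume)
  set B := ∫ τ : ℝ, (1 + 4 * τ ^ 2) ^ (-N / 4 - 1) * (fb τ - c) ^ 2
  have hA : 0 ≤ A := integral_nonneg fun z => by positivity
  have hB : 0 ≤ B := integral_nonneg fun z => by positivity
  have hVB := mul_le_mul_of_nonneg_left S2 hV0.le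
  -- The remainder has constant `N + 1` and the mean `2N + 4`; both are at least `4` when `N ≥ 3`.
  nlinarith [mul_nonneg (sub_nonneg.2 hN) hA, mul_nonneg (sub_nonneg.2 hN) (mul_nonneg hV0.le hB),
    mul_nonneg hV0.le hB]

/-! ### Differential operators and test functions on the Grushin space -/

noncomputable section

namespace GrushinSpace

variable {n : ℕ}

/-- The partial derivative `∂f/∂xᵢ`. -/
def dx (i : Fin n) (f : GrushinSpace n → ℝ) (p : GrushinSpace n) : ℝ :=
  fderiv ℝ f p (EuclideanSpace.single i 1, 0)

/-- The partial derivative `∂f/∂t`. -/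
def dt (f : GrushinSpace n → ℝ) (p : GrushinSpace n) : ℝ := fderiv ℝ f p (0, 1)

/-- The generator `x · ∇ₓ + 2 t ∂ₜ` of the anisotropic dilations. -/
def euler (f : GrushinSpace n → ℝ) (p : GrushinSpace n) : ℝ := fderiv ℝ f p (p.1, 2 * p.2)

/-- The angle function `|x|² / ϱ² = |∇_G ϱ|²`. -/
def psi (p : GrushinSpace n) : ℝ := ‖p.1‖ ^ 2 / rho p ^ 2

/-- The inner product of the Grushin gradients of two functions. -/
def gradInner (f g : GrushinSpace n → ℝ) (p : GrushinSpace n) : ℝ :=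
  ∑ i, dx i f p * dx i g p + ‖p.1‖ ^ 2 * (dt f p * dt g p)

/-- The angular part `ϱ² ⟨∇_G f, ∇_G g⟩ - ψ Ef Eg` of the inner product of the gradients. -/
def carre (f g : GrushinSpace n → ℝ) (p : GrushinSpace n) : ℝ :=
  rho p ^ 2 * gradInner f g p - psi p * (euler f p * euler g p)

/-- The Grushin operator in terms of partial derivatives. -/
def subLap (f : GrushinSpace n → ℝ) (p : GrushinSpace n) : ℝ :=
  ∑ i, dx i (dx i f) p + ‖p.1‖ ^ 2 * dt (dt f) p

/-- The angular part of the Grushin operator, weighted by the angle function. -/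
def angOp (f : GrushinSpace n → ℝ) (p : GrushinSpace n) : ℝ :=
  rho p ^ 2 * subLap f p - psi p * (euler (euler f) p + n * euler f p)

/-- Smoothness away from the origin. -/
def SmoothOff (f : GrushinSpace n → ℝ) : Prop := ∀ p, p ≠ 0 → ContDiffAt ℝ ∞ f p

theorem rho_nonneg (p : GrushinSpace n) : 0 ≤ rho p := by unfold rho; positivity

theorem rho_pow_four (p : GrushinSpace n) : rho p ^ 4 = ‖p.1‖ ^ 4 + 4 * p.2 ^ 2 := by
  unfold rho
  rw [← Real.rpow_natCast, ← Real.rpow_mul (by positivity)]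
  norm_num

theorem quartic_pos {p : GrushinSpace n} (hp : p ≠ 0) : 0 < ‖p.1‖ ^ 4 + 4 * p.2 ^ 2 := by
  by_cases h : p.1 = 0
  · have : p.2 ≠ 0 := fun h2 => hp (Prod.ext h h2)
    positivity
  · have : 0 < ‖p.1‖ := norm_pos_iff.2 h
    positivity

theorem rho_pos {p : GrushinSpace n} (hp : p ≠ 0) : 0 < rho p :=
  Real.rpow_pos_of_pos (quartic_pos hp) _

@[simp] theorem rho_zero : rho (0 : GrushinSpace n) = 0 := by simp [rho]

theorem continuous_rho : Continuous (rho : GrushinSpace n → ℝ) := by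
  unfold rho
  exact Continuous.rpow_const (by fun_prop) fun _ => Or.inr (by norm_num)

theorem rho_rpow_eq (p : GrushinSpace n) (s : ℝ) :
    rho p ^ s = (‖p.1‖ ^ 4 + 4 * p.2 ^ 2) ^ (s / 4) := by
  unfold rho
  rw [← Real.rpow_mul (by positivity)]
  ring_nf

theorem hasFDerivAt_quartic (p : GrushinSpace n) :
    HasFDerivAt (fun q : GrushinSpace n => ‖q.1‖ ^ 4 + 4 * q.2 ^ 2)
      ((4 * ‖p.1‖ ^ 2) • (innerSL ℝ p.1).comp (ContinuousLinearMap.fst ℝ _ ℝ) +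
        (8 * p.2) • ContinuousLinearMap.snd ℝ (EuclideanSpace ℝ (Fin n)) ℝ) p := by
  have h1 : HasFDerivAt (fun q : GrushinSpace n => ‖q.1‖ ^ 2)
      (2 • (innerSL ℝ p.1).comp (ContinuousLinearMap.fst ℝ _ ℝ)) p :=
    (hasFDerivAt_fst (𝕜 := ℝ) (p := p)).norm_sq
  have h2 := (h1.pow 2).add (((hasFDerivAt_snd (𝕜 := ℝ) (p := p)).pow 2).const_mul 4)
  convert! h2 using 1
  · ext q
    simp; ring
  · ext v <;> simp <;> ring

theorem hasFDerivAt_rho_rpow (s : ℝ) {p : GrushinSpace n} (hp : p ≠ 0) :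
    HasFDerivAt (fun q : GrushinSpace n => rho q ^ s)
      ((s * rho p ^ (s - 4)) •
        ((‖p.1‖ ^ 2) • (innerSL ℝ p.1).comp (ContinuousLinearMap.fst ℝ _ ℝ) +
        (2 * p.2) • ContinuousLinearMap.snd ℝ (EuclideanSpace ℝ (Fin n)) ℝ)) p := by
  have h := (hasFDerivAt_quartic p).rpow_const (p := s / 4) (Or.inl (quartic_pos hp).ne')
  have e : (fun q : GrushinSpace n => rho q ^ s) =
    fun q => (‖q.1‖ ^ 4 + 4 * q.2 ^ 2) ^ (s / 4) := funext fun q => rho_rpow_eq q s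
  rw [e, rho_rpow_eq]
  convert! h using 1
  rw [show (s - 4) / 4 = s / 4 - 1 by ring]
  ext v <;> simp <;> ring

theorem smoothOff_rho_rpow (s : ℝ) : SmoothOff fun q : GrushinSpace n => rho q ^ s := by
  intro p hp
  have e : (fun q : GrushinSpace n => rho q ^ s) =
    fun q => (‖q.1‖ ^ 4 + 4 * q.2 ^ 2) ^ (s / 4) := funext fun q => rho_rpow_eq q s
  rw [e]
  refine ContDiffAt.rpow_const_of_ne ?_ (quartic_pos hp).ne'
  have : ContDiff ℝ ∞ fun q : GrushinSpace n => (‖q.1‖ ^ 2) ^ 2 + 4 * q.2 ^ 2 := by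
    have : ContDiff ℝ ∞ fun q : GrushinSpace n => ‖q.1‖ ^ 2 := contDiff_fst.norm_sq ℝ
    fun_prop
  convert! this.contDiffAt using 1
  ext q; ring

theorem SmoothOff.mul {f g : GrushinSpace n → ℝ} (hf : SmoothOff f) (hg : SmoothOff g) :
    SmoothOff fun p => f p * g p := fun p hp => (hf p hp).mul (hg p hp)

theorem smoothOff_of_contDiff {f : GrushinSpace n → ℝ} (hf : ContDiff ℝ ∞ f) : SmoothOff f :=
  fun _ _ => hf.contDiffAt

theorem smoothOff_rho : SmoothOff (rho : GrushinSpace n → ℝ) := by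
  simpa using smoothOff_rho_rpow (n := n) 1

theorem smoothOff_rho_sq : SmoothOff fun p : GrushinSpace n => rho p ^ 2 := by
  simpa using smoothOff_rho_rpow (n := n) 2

theorem contDiff_norm_fst_sq : ContDiff ℝ ∞ fun q : GrushinSpace n => ‖q.1‖ ^ 2 :=
  contDiff_fst.norm_sq ℝ

theorem psi_eq : (psi : GrushinSpace n → ℝ) = fun p => ‖p.1‖ ^ 2 * rho p ^ (-2 : ℝ) := by
  ext p
  rw [psi, Real.rpow_neg (rho_nonneg p), Real.rpow_two]
  rfl

theorem smoothOff_psi : SmoothOff (psi : GrushinSpace n → ℝ) := by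
  rw [psi_eq]
  exact (smoothOff_of_contDiff contDiff_norm_fst_sq).mul (smoothOff_rho_rpow _)

theorem psi_nonneg (p : GrushinSpace n) : 0 ≤ psi p := by unfold psi; positivity

namespace IsTestFunction

variable {u v : GrushinSpace n → ℝ}

theorem eventuallyEq_zero (hu : IsTestFunction u) : u =ᶠ[nhds 0] 0 :=
  notMem_tsupport_iff_eventuallyEq.1 hu.zero_notMem_tsupport

theorem continuous (hu : IsTestFunction u) : Continuous u := hu.contDiff.continuous

theorem differentiable (hu : IsTestFunction u) : Differentiable ℝ u :=
  hu.contDiff.differentiable (by simp)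

theorem of_tsupport_subset (hu : IsTestFunction u) (hv : ContDiff ℝ ∞ v)
    (h : tsupport v ⊆ tsupport u) : IsTestFunction v :=
  ⟨hv, hu.hasCompactSupport.of_isClosed_subset (isClosed_tsupport _) h,
    fun h0 => hu.zero_notMem_tsupport (h h0)⟩

theorem mul_smoothOff (hu : IsTestFunction u) {φ : GrushinSpace n → ℝ} (hφ : SmoothOff φ) :
    IsTestFunction fun p => u p * φ p := by
  refine hu.of_tsupport_subset ?_ (tsupport_mul_subset_left)
  rw [contDiff_iff_contDiffAt]
  intro p
  by_cases hp : p = 0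
  · subst hp
    have : (fun p => u p * φ p) =ᶠ[nhds 0] fun _ => 0 := by
      filter_upwards [hu.eventuallyEq_zero] with q hq
      simp [hq]
    exact contDiffAt_const.congr_of_eventuallyEq this
  · exact hu.contDiff.contDiffAt.mul (hφ p hp)

theorem smoothOff_mul (hu : IsTestFunction u) {φ : GrushinSpace n → ℝ} (hφ : SmoothOff φ) :
    IsTestFunction fun p => φ p * u p := by
  simpa only [mul_comm] using hu.mul_smoothOff hφ

theorem smoothOff (hu : IsTestFunction u) : SmoothOff u := smoothOff_of_contDiff hu.contDiff

theorem mul (hu : IsTestFunction u) (hv : IsTestFunction v) :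
    IsTestFunction fun p => u p * v p := hu.mul_smoothOff hv.smoothOff

theorem const_mul (hu : IsTestFunction u) (c : ℝ) : IsTestFunction fun p => c * u p :=
  hu.smoothOff_mul (smoothOff_of_contDiff contDiff_const)

theorem add (hu : IsTestFunction u) (hv : IsTestFunction v) :
    IsTestFunction fun p => u p + v p := by
  refine ⟨hu.contDiff.add hv.contDiff, hu.hasCompactSupport.add hv.hasCompactSupport, ?_⟩
  rw [notMem_tsupport_iff_eventuallyEq]
  filter_upwards [hu.eventuallyEq_zero, hv.eventuallyEq_zero] with p h1 h2
  simp [h1, h2]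

theorem sub (hu : IsTestFunction u) (hv : IsTestFunction v) :
    IsTestFunction fun p => u p - v p := by
  simpa [sub_eq_add_neg] using hu.add (hv.const_mul (-1))

theorem sum {ι : Type*} (s : Finset ι) {f : ι → GrushinSpace n → ℝ}
    (hf : ∀ i, IsTestFunction (f i)) : IsTestFunction fun p => ∑ i ∈ s, f i p := by
  classical
  induction s using Finset.induction_on with
  | empty =>
    refine ⟨by simpa using contDiff_const, ?_, ?_⟩
    · simpa using! HasCompactSupport.zero
    · rw [notMem_tsupport_iff_eventuallyEq]
      exact Filter.Eventually.of_forall fun p => by simp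
  | insert a s ha ih =>
    simpa only [Finset.sum_insert ha] using (hf a).add ih

theorem fderiv_apply (hu : IsTestFunction u) {V : GrushinSpace n → GrushinSpace n}
    (hV : ContDiff ℝ ∞ V) : IsTestFunction fun p => fderiv ℝ u p (V p) := by
  refine hu.of_tsupport_subset ?_ ?_
  · exact (hu.contDiff.fderiv_right (m := ∞) (by simp)).clm_apply hV
  · refine closure_minimal (fun p hp => support_fderiv_subset ℝ fun h => hp ?_) isClosed_closure
    simp [h]

theorem dx (hu : IsTestFunction u) (i : Fin n) : IsTestFunction (dx i u) :=
  hu.fderiv_apply contDiff_const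

theorem dt (hu : IsTestFunction u) : IsTestFunction (dt u) :=
  hu.fderiv_apply contDiff_const

theorem euler (hu : IsTestFunction u) : IsTestFunction (euler u) :=
  hu.fderiv_apply (by fun_prop)

theorem integrable (hu : IsTestFunction u) : Integrable u :=
  hu.continuous.integrable_of_hasCompactSupport hu.hasCompactSupport

theorem subLap (hu : IsTestFunction u) : IsTestFunction (subLap u) :=
  (sum _ fun i => (hu.dx i).dx i).add
    (hu.dt.dt.smoothOff_mul (smoothOff_of_contDiff contDiff_norm_fst_sq))

theorem gradInner (hu : IsTestFunction u) (hv : IsTestFunction v) :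
    IsTestFunction (gradInner u v) :=
  (sum _ fun i => (hu.dx i).mul (hv.dx i)).add
    ((hu.dt.mul hv.dt).smoothOff_mul (smoothOff_of_contDiff contDiff_norm_fst_sq))

theorem carre (hu : IsTestFunction u) (hv : IsTestFunction v) : IsTestFunction (carre u v) :=
  ((hu.gradInner hv).smoothOff_mul smoothOff_rho_sq).sub
    ((hu.euler.mul hv.euler).smoothOff_mul smoothOff_psi)

theorem angOp (hu : IsTestFunction u) : IsTestFunction (angOp u) :=
  (hu.subLap.smoothOff_mul smoothOff_rho_sq).sub
    ((hu.euler.euler.add (hu.euler.const_mul n)).smoothOff_mul smoothOff_psi)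

end IsTestFunction

end GrushinSpace

end

/-! ### Pointwise calculus of the dilation generator and the angular form -/

noncomputable section

namespace GrushinSpace

variable {n : ℕ}

theorem euler_eq (f : GrushinSpace n → ℝ) (p : GrushinSpace n) :
    euler f p = ∑ i, p.1 i * dx i f p + 2 * p.2 * dt f p := by
  have h : ((p.1, 2 * p.2) : GrushinSpace n) =
      ∑ i, p.1 i • ((EuclideanSpace.single i 1, 0) : GrushinSpace n) +
        (2 * p.2) • ((0, 1) : GrushinSpace n) := by
    ext i
    · simp [Prod.fst_sum, Finset.sum_apply, Pi.single_apply]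
    · simp [Prod.snd_sum]
  unfold euler dx dt
  rw [h, map_add, map_sum]
  simp only [map_smul, smul_eq_mul]

theorem fderiv_rho_rpow_apply (s : ℝ) {p : GrushinSpace n} (hp : p ≠ 0) (v : GrushinSpace n) :
    fderiv ℝ (fun q : GrushinSpace n => rho q ^ s) p v =
      s * rho p ^ (s - 4) * (‖p.1‖ ^ 2 * inner ℝ p.1 v.1 + 2 * p.2 * v.2) := by
  rw [(hasFDerivAt_rho_rpow s hp).fderiv]
  simp
  ring

theorem dx_rho_rpow (s : ℝ) {p : GrushinSpace n} (hp : p ≠ 0) (i : Fin n) :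
    dx i (fun q : GrushinSpace n => rho q ^ s) p = s * rho p ^ (s - 4) * (‖p.1‖ ^ 2 * p.1 i) := by
  rw [dx, fderiv_rho_rpow_apply s hp, EuclideanSpace.inner_single_right]
  simp

theorem dt_rho_rpow (s : ℝ) {p : GrushinSpace n} (hp : p ≠ 0) :
    dt (fun q : GrushinSpace n => rho q ^ s) p = s * rho p ^ (s - 4) * (2 * p.2) := by
  rw [dt, fderiv_rho_rpow_apply s hp]
  simp

theorem euler_rho_rpow (s : ℝ) {p : GrushinSpace n} (hp : p ≠ 0) :
    euler (fun q : GrushinSpace n => rho q ^ s) p = s * rho p ^ s := by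
  rw [euler, fderiv_rho_rpow_apply s hp, real_inner_self_eq_norm_sq]
  have : rho p ^ s = rho p ^ (s - 4) * rho p ^ 4 := by
    rw [← Real.rpow_natCast, ← Real.rpow_add (rho_pos hp)]; norm_num
  rw [this, rho_pow_four]
  ring

/-- The Grushin gradient of `ϱ` is radial in the sense that pairing with it is `ψ E / ϱ`. Hence the
angular form annihilates powers of `ϱ`. -/
theorem gradInner_rho_rpow (s : ℝ) {p : GrushinSpace n} (hp : p ≠ 0) (g : GrushinSpace n → ℝ) :
    gradInner (fun q : GrushinSpace n => rho q ^ s) g p =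
      s * rho p ^ (s - 2) * (psi p * euler g p) := by
  have h0 := rho_pos hp
  have e : rho p ^ (s - 2) = rho p ^ (s - 4) * rho p ^ 2 := by
    rw [← Real.rpow_natCast, ← Real.rpow_add h0]; norm_num; ring_nf
  rw [gradInner, euler_eq, psi, e]
  simp_rw [dx_rho_rpow s hp, dt_rho_rpow s hp]
  have : ∑ i, s * rho p ^ (s - 4) * (‖p.1‖ ^ 2 * p.1 i) * dx i g p =
      s * rho p ^ (s - 4) * ‖p.1‖ ^ 2 * ∑ i, p.1 i * dx i g p := by
    rw [Finset.mul_sum]; exact Finset.sum_congr rfl fun i _ => by ring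
  rw [this]
  field_simp

theorem carre_rho_rpow (s : ℝ) {p : GrushinSpace n} (hp : p ≠ 0) (g : GrushinSpace n → ℝ) :
    carre (fun q : GrushinSpace n => rho q ^ s) g p = 0 := by
  rw [carre, gradInner_rho_rpow s hp, euler_rho_rpow s hp]
  have e : rho p ^ s = rho p ^ (s - 2) * rho p ^ 2 := by
    rw [← Real.rpow_natCast, ← Real.rpow_add (rho_pos hp)]; norm_num
  rw [e]; ring

theorem gradInner_comm (f g : GrushinSpace n → ℝ) (p : GrushinSpace n) :
    gradInner f g p = gradInner g f p := by
  simp only [gradInner, mul_comm]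

theorem carre_comm (f g : GrushinSpace n → ℝ) (p : GrushinSpace n) :
    carre f g p = carre g f p := by
  simp only [carre, gradInner_comm f g, mul_comm]

section Products

variable {f g k : GrushinSpace n → ℝ} {p : GrushinSpace n}

theorem fderiv_mul_apply (hf : DifferentiableAt ℝ f p) (hg : DifferentiableAt ℝ g p)
    (v : GrushinSpace n) : fderiv ℝ (fun q => f q * g q) p v =
      f p * fderiv ℝ g p v + g p * fderiv ℝ f p v := by
  rw [fderiv_fun_mul hf hg]; simp

theorem euler_mul (hf : DifferentiableAt ℝ f p) (hg : DifferentiableAt ℝ g p) :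
    euler (fun q => f q * g q) p = f p * euler g p + g p * euler f p := fderiv_mul_apply hf hg _

theorem gradInner_mul (hf : DifferentiableAt ℝ f p) (hg : DifferentiableAt ℝ g p) :
    gradInner (fun q => f q * g q) k p = f p * gradInner g k p + g p * gradInner f k p := by
  unfold gradInner dx dt
  simp_rw [fderiv_mul_apply hf hg]
  have : ∀ v : Fin n → GrushinSpace n, ∑ i, (f p * fderiv ℝ g p (v i) + g p * fderiv ℝ f p (v i)) *
      fderiv ℝ k p (v i) = f p * ∑ i, fderiv ℝ g p (v i) * fderiv ℝ k p (v i) +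
        g p * ∑ i, fderiv ℝ f p (v i) * fderiv ℝ k p (v i) := by
    intro v
    rw [Finset.mul_sum, Finset.mul_sum, ← Finset.sum_add_distrib]
    exact Finset.sum_congr rfl fun i _ => by ring
  rw [this]
  ring

theorem carre_mul (hf : DifferentiableAt ℝ f p) (hg : DifferentiableAt ℝ g p) :
    carre (fun q => f q * g q) k p = f p * carre g k p + g p * carre f k p := by
  unfold carre
  rw [gradInner_mul hf hg, euler_mul hf hg]
  ring

theorem SmoothOff.differentiableAt (hf : SmoothOff f) (hp : p ≠ 0) : DifferentiableAt ℝ f p :=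
  (hf p hp).differentiableAt (by simp)

theorem carre_rho_rpow_mul (s : ℝ) (hp : p ≠ 0) (hf : DifferentiableAt ℝ f p) :
    carre (fun q => rho q ^ s * f q) k p = rho p ^ s * carre f k p := by
  rw [carre_mul ((smoothOff_rho_rpow s).differentiableAt hp) hf, carre_rho_rpow s hp]
  ring

theorem euler_rho_rpow_mul (s : ℝ) (hp : p ≠ 0) (hf : DifferentiableAt ℝ f p) :
    euler (fun q => rho q ^ s * f q) p = rho p ^ s * (euler f p + s * f p) := by
  rw [euler_mul ((smoothOff_rho_rpow s).differentiableAt hp) hf, euler_rho_rpow s hp]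
  ring

theorem fderiv_norm_fst_sq_apply (p v : GrushinSpace n) :
    fderiv ℝ (fun q : GrushinSpace n => ‖q.1‖ ^ 2) p v = 2 * inner ℝ p.1 v.1 := by
  have h1 : HasFDerivAt (fun q : GrushinSpace n => ‖q.1‖ ^ 2)
      (2 • (innerSL ℝ p.1).comp (ContinuousLinearMap.fst ℝ _ ℝ)) p :=
    (hasFDerivAt_fst (𝕜 := ℝ) (p := p)).norm_sq
  rw [h1.fderiv]
  simp

theorem euler_norm_fst_sq (p : GrushinSpace n) :
    euler (fun q : GrushinSpace n => ‖q.1‖ ^ 2) p = 2 * ‖p.1‖ ^ 2 := by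
  rw [euler, fderiv_norm_fst_sq_apply, real_inner_self_eq_norm_sq]

theorem differentiableAt_norm_fst_sq :
    DifferentiableAt ℝ (fun q : GrushinSpace n => ‖q.1‖ ^ 2) p :=
  contDiff_norm_fst_sq.contDiffAt.differentiableAt (by simp)

/-- Numerator and denominator are both homogeneous of degree two, so the weight `ψ` passes freely
through `E`. -/
theorem euler_psi (hp : p ≠ 0) : euler (psi : GrushinSpace n → ℝ) p = 0 := by
  rw [psi_eq, euler_mul differentiableAt_norm_fst_sq
    ((smoothOff_rho_rpow _).differentiableAt hp), euler_rho_rpow _ hp, euler_norm_fst_sq]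
  ring

theorem euler_psi_mul (hp : p ≠ 0) (hf : DifferentiableAt ℝ f p) :
    euler (fun q => psi q * f q) p = psi p * euler f p := by
  rw [euler_mul (smoothOff_psi.differentiableAt hp) hf, euler_psi hp]
  ring

/-- Symmetry of second derivatives leaves only the derivative of the field `(x, 2t)`. This gives
`[∂ᵢ, E] = ∂ᵢ` and `[∂ₜ, E] = 2∂ₜ`. -/
theorem fderiv_euler_apply (hf : ContDiff ℝ ∞ f) (v : GrushinSpace n) :
    fderiv ℝ (euler f) p v = euler (fun q => fderiv ℝ f q v) p + fderiv ℝ f p (v.1, 2 * v.2) := by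
  have hd : ContDiff ℝ ∞ (fderiv ℝ f) := hf.fderiv_right (by simp)
  have hdd : DifferentiableAt ℝ (fderiv ℝ f) p := hd.contDiffAt.differentiableAt (by simp)
  have hsymm : IsSymmSndFDerivAt ℝ f p :=
    hf.contDiffAt.isSymmSndFDerivAt
      (by simpa using WithTop.coe_le_coe.2 (le_top : (2 : ℕ∞) ≤ ⊤))
  have hV : HasFDerivAt (fun q : GrushinSpace n => ((q.1, 2 * q.2) : GrushinSpace n))
      ((ContinuousLinearMap.fst ℝ _ ℝ).prod
        ((2 : ℝ) • ContinuousLinearMap.snd ℝ (EuclideanSpace ℝ (Fin n)) ℝ)) p :=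
    hasFDerivAt_fst.prodMk (hasFDerivAt_snd.const_mul 2)
  have h1 := hdd.hasFDerivAt.clm_apply hV
  have e1 : fderiv ℝ (euler f) p v = fderiv ℝ (fderiv ℝ f) p v (p.1, 2 * p.2) +
      fderiv ℝ f p (v.1, 2 * v.2) := by
    unfold euler
    rw [h1.fderiv]
    simp [add_comm]
  have h2 := hdd.hasFDerivAt.clm_apply (hasFDerivAt_const v p)
  have e2 : euler (fun q => fderiv ℝ f q v) p = fderiv ℝ (fderiv ℝ f) p (p.1, 2 * p.2) v := by
    unfold euler
    rw [h2.fderiv]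
    simp
  rw [e1, e2, hsymm.eq]

theorem euler_dx (hf : ContDiff ℝ ∞ f) (i : Fin n) :
    euler (dx i f) p = dx i (euler f) p - dx i f p := by
  have := fderiv_euler_apply (p := p) hf (EuclideanSpace.single i 1, 0)
  simp only [mul_zero] at this
  rw [dx, this]
  exact (add_sub_cancel_right _ _).symm

theorem euler_dt (hf : ContDiff ℝ ∞ f) : euler (dt f) p = dt (euler f) p - 2 * dt f p := by
  have := fderiv_euler_apply (p := p) hf (0, 1)
  have h2 : ((0, 2 * 1) : GrushinSpace n) = (2 : ℝ) • (0, 1) := by simp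
  simp only [h2, map_smul, smul_eq_mul] at this
  rw [dt, this]
  exact (add_sub_cancel_right _ _).symm

theorem euler_add (hf : DifferentiableAt ℝ f p) (hg : DifferentiableAt ℝ g p) :
    euler (fun q => f q + g q) p = euler f p + euler g p := by
  unfold euler; rw [fderiv_fun_add hf hg]; rfl

theorem euler_sub (hf : DifferentiableAt ℝ f p) (hg : DifferentiableAt ℝ g p) :
    euler (fun q => f q - g q) p = euler f p - euler g p := by
  unfold euler; rw [fderiv_fun_sub hf hg]; rfl

theorem euler_const_mul (c : ℝ) (hf : DifferentiableAt ℝ f p) :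
    euler (fun q => c * f q) p = c * euler f p := by
  unfold euler; rw [fderiv_const_mul hf]; rfl

theorem euler_sum {ι : Type*} (s : Finset ι) {F : ι → GrushinSpace n → ℝ}
    (hF : ∀ i, DifferentiableAt ℝ (F i) p) :
    euler (fun q => ∑ i ∈ s, F i q) p = ∑ i ∈ s, euler (F i) p := by
  unfold euler; rw [fderiv_fun_sum fun i _ => hF i]; simp

/-- The loss `-2` is the degree of the pairing: `∂ᵢ` lowers degree by one, while `∂ₜ` lowers it by
two and `|x|` restores one. The factor `ϱ²` in `carre` compensates. -/
theorem euler_gradInner (hf : IsTestFunction f) (hg : IsTestFunction g) :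
    euler (gradInner f g) p = gradInner (euler f) g p + gradInner f (euler g) p -
      2 * gradInner f g p := by
  have h1 : ∀ i, euler (fun q => dx i f q * dx i g q) p =
      dx i (euler f) p * dx i g p + dx i f p * dx i (euler g) p - 2 * (dx i f p * dx i g p) := by
    intro i
    rw [euler_mul ((hf.dx i).differentiable p) ((hg.dx i).differentiable p),
      euler_dx hf.contDiff, euler_dx hg.contDiff]
    ring
  have h2 : euler (fun q => ‖q.1‖ ^ 2 * (dt f q * dt g q)) p =
      ‖p.1‖ ^ 2 * (dt (euler f) p * dt g p) + ‖p.1‖ ^ 2 * (dt f p * dt (euler g) p)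
      - 2 * (‖p.1‖ ^ 2 * (dt f p * dt g p)) := by
    rw [euler_mul differentiableAt_norm_fst_sq ((hf.dt.mul hg.dt).differentiable p),
      euler_mul (hf.dt.differentiable p) (hg.dt.differentiable p), euler_norm_fst_sq,
      euler_dt hf.contDiff, euler_dt hg.contDiff]
    ring
  have h3 : euler (gradInner f g) p = ∑ i, euler (fun q => dx i f q * dx i g q) p +
      euler (fun q => ‖q.1‖ ^ 2 * (dt f q * dt g q)) p := by
    rw [← euler_sum _ fun i => ((hf.dx i).mul (hg.dx i)).differentiable p]
    exact euler_add
      ((IsTestFunction.sum _ fun i => (hf.dx i).mul (hg.dx i)).differentiable p)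
      (differentiableAt_norm_fst_sq.mul ((hf.dt.mul hg.dt).differentiable p))
  rw [h3, h2]
  simp_rw [h1]
  rw [Finset.sum_sub_distrib, Finset.sum_add_distrib, ← Finset.mul_sum]
  unfold gradInner
  ring

/-- The dilations preserve the angular inner product. -/
theorem euler_carre (hf : IsTestFunction f) (hg : IsTestFunction g) (hp : p ≠ 0) :
    euler (carre f g) p = carre (euler f) g p + carre f (euler g) p := by
  have hr : euler (fun q : GrushinSpace n => rho q ^ 2) p = 2 * rho p ^ 2 := by
    simpa using euler_rho_rpow 2 hp
  have h1 : euler (carre f g) p = euler (fun q => rho q ^ 2 * gradInner f g q) p -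
      euler (fun q => psi q * (euler f q * euler g q)) p :=
    euler_sub ((smoothOff_rho_sq.differentiableAt hp).mul ((hf.gradInner hg).differentiable p))
      ((smoothOff_psi.differentiableAt hp).mul ((hf.euler.mul hg.euler).differentiable p))
  rw [h1, euler_mul (smoothOff_rho_sq.differentiableAt hp) ((hf.gradInner hg).differentiable p),
    euler_psi_mul hp ((hf.euler.mul hg.euler).differentiable p),
    euler_mul (hf.euler.differentiable p) (hg.euler.differentiable p), euler_gradInner hf hg, hr]
  unfold carre
  ring

/-- The form is what remains of the gradient after removing its component along `∇_G ϱ`;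
nonnegativity is Cauchy–Schwarz in `x` plus one square involving `∂ₜ`. -/
theorem carre_self_nonneg (f : GrushinSpace n → ℝ) (p : GrushinSpace n) : 0 ≤ carre f f p := by
  by_cases hp : p = 0
  · subst hp; simp [carre, psi]
  have hr := rho_pos hp
  set A := ∑ i, dx i f p ^ 2 with hA
  set d := ∑ i, p.1 i * dx i f p with hd
  set b := dt f p
  set X := ‖p.1‖ ^ 2 with hX
  have hXs : X = ∑ i, p.1 i ^ 2 := by rw [hX, EuclideanSpace.norm_sq_eq]; simp
  have cs : d ^ 2 ≤ X * A := by
    rw [hXs]; exact Finset.sum_mul_sq_le_sq_mul_sq _ _ _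
  have hX0 : 0 ≤ X := by positivity
  have hA0 : 0 ≤ A := Finset.sum_nonneg fun i _ => sq_nonneg _
  have h4 : rho p ^ 4 = X ^ 2 + 4 * p.2 ^ 2 := by rw [rho_pow_four, hX]; ring
  have e : rho p ^ 2 * carre f f p = rho p ^ 4 * (A + X * b ^ 2) - X * (d + 2 * p.2 * b) ^ 2 := by
    rw [carre, gradInner, euler_eq, psi]
    simp_rw [← sq]
    rw [← hA, ← hd, ← hX]
    field_simp
    ring
  have key : 0 ≤ rho p ^ 2 * carre f f p := by
    rw [e, h4]
    -- Off the `t`-axis an extra factor `|x|²` exhibits the expression as a Cauchy–Schwarz defect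
    -- plus a square; on the axis the terms carrying `X` drop out.
    rcases hX0.eq_or_lt with h | h
    · rw [← h]; simp; positivity
    · have h5 : 0 ≤ X * ((X ^ 2 + 4 * p.2 ^ 2) * (A + X * b ^ 2) - X * (d + 2 * p.2 * b) ^ 2) := by
        have : X * ((X ^ 2 + 4 * p.2 ^ 2) * (A + X * b ^ 2) - X * (d + 2 * p.2 * b) ^ 2) =
            (X ^ 2 + 4 * p.2 ^ 2) * (X * A - d ^ 2) + (2 * p.2 * d - X ^ 2 * b) ^ 2 := by ring
        rw [this]
        have := mul_nonneg (by positivity : 0 ≤ X ^ 2 + 4 * p.2 ^ 2) (sub_nonneg.2 cs)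
        positivity
      exact nonneg_of_mul_nonneg_right h5 h
  exact nonneg_of_mul_nonneg_right key (by positivity)

end Products

end GrushinSpace

end

/-! ### Integration by parts for the dilation invariant measure -/

noncomputable section

namespace GrushinSpace

variable {n : ℕ}

/-- The integral with respect to the dilation invariant measure `ϱ^{-Q} dx dt`. -/
def wInt (f : GrushinSpace n → ℝ) : ℝ := ∫ p, rho p ^ (-(n + 2) : ℝ) * f p

instance isAddHaarMeasure_volume : (volume : Measure (GrushinSpace n)).IsAddHaarMeasure :=
  inferInstanceAs ((volume : Measure (EuclideanSpace ℝ (Fin n))).prod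
    (volume : Measure ℝ)).IsAddHaarMeasure

theorem ae_ne_zero : ∀ᵐ p : GrushinSpace n, p ≠ 0 := by
  rw [ae_iff]; simp

theorem wInt_congr {f g : GrushinSpace n → ℝ} (h : ∀ p, p ≠ 0 → f p = g p) :
    wInt f = wInt g := by
  refine integral_congr_ae ?_
  filter_upwards [ae_ne_zero] with p hp
  rw [h p hp]

namespace IsTestFunction

variable {u v : GrushinSpace n → ℝ}

theorem integrable_weight (hu : IsTestFunction u) :
    Integrable fun p => rho p ^ (-(n + 2) : ℝ) * u p :=
  (hu.smoothOff_mul (smoothOff_rho_rpow _)).integrable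

theorem wInt_add (hu : IsTestFunction u) (hv : IsTestFunction v) :
    wInt (fun p => u p + v p) = wInt u + wInt v := by
  unfold wInt
  rw [← integral_add hu.integrable_weight hv.integrable_weight]
  simp only [mul_add]

theorem wInt_sub (hu : IsTestFunction u) (hv : IsTestFunction v) :
    wInt (fun p => u p - v p) = wInt u - wInt v := by
  unfold wInt
  rw [← integral_sub hu.integrable_weight hv.integrable_weight]
  simp only [mul_sub]

theorem integral_fderiv_apply (hu : IsTestFunction u) (w : GrushinSpace n) :
    ∫ p, fderiv ℝ u p w = 0 := by
  have h1 : IsTestFunction fun p => fderiv ℝ u p w := hu.fderiv_apply contDiff_const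
  have := integral_mul_fderiv_eq_neg_fderiv_mul_of_integrable (μ := volume) (𝕜 := ℝ)
    (f := fun _ : GrushinSpace n => (1 : ℝ)) (g := u) (v := w) (by simp)
    (by simpa using h1.integrable) (by simpa using hu.integrable)
    (fun x _ => differentiableAt_const _) (fun x _ => hu.differentiable x)
  simpa using this

theorem integral_mul_fderiv (hu : IsTestFunction u) (hv : IsTestFunction v) (w : GrushinSpace n) :
    ∫ p, u p * fderiv ℝ v p w = -∫ p, fderiv ℝ u p w * v p := by
  have h1 : IsTestFunction fun p => fderiv ℝ u p w := hu.fderiv_apply contDiff_const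
  have h2 : IsTestFunction fun p => fderiv ℝ v p w := hv.fderiv_apply contDiff_const
  exact integral_mul_fderiv_eq_neg_fderiv_mul_of_integrable (h1.mul hv).integrable
    (hu.mul h2).integrable (hu.mul hv).integrable (fun x _ => hu.differentiable x)
    fun x _ => hv.differentiable x

theorem integral_euler (hu : IsTestFunction u) :
    ∫ p, GrushinSpace.euler u p = -(n + 2) * ∫ p, u p := by
  have hx : ∀ i : Fin n, ContDiff ℝ ∞ fun p : GrushinSpace n => p.1 i := fun i => by fun_prop
  have ht : ContDiff ℝ ∞ fun p : GrushinSpace n => 2 * p.2 := by fun_prop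
  have h1 : ∀ i : Fin n, ∫ p, p.1 i * GrushinSpace.dx i u p = -∫ p, u p := by
    intro i
    have h := (hu.smoothOff_mul (smoothOff_of_contDiff (hx i))).integral_fderiv_apply
      (EuclideanSpace.single i 1, 0)
    have e : ∀ p : GrushinSpace n, fderiv ℝ (fun q : GrushinSpace n => q.1 i * u q) p
        (EuclideanSpace.single i 1, 0) = p.1 i * GrushinSpace.dx i u p + u p := by
      intro p
      rw [fderiv_mul_apply ((hx i).differentiable (by simp) p) (hu.differentiable p)]
      have : HasFDerivAt (fun q : GrushinSpace n => q.1 i)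
          ((EuclideanSpace.proj i).comp (ContinuousLinearMap.fst ℝ _ ℝ)) p :=
        ((EuclideanSpace.proj (𝕜 := ℝ) i).comp (ContinuousLinearMap.fst ℝ _ ℝ)).hasFDerivAt
      rw [this.fderiv]
      simp [GrushinSpace.dx]
    simp_rw [e] at h
    rw [integral_add ((hu.dx i).smoothOff_mul (smoothOff_of_contDiff (hx i))).integrable
      hu.integrable] at h
    linarith
  have h2 : ∫ p, 2 * p.2 * GrushinSpace.dt u p = -2 * ∫ p, u p := by
    have h := (hu.smoothOff_mul (smoothOff_of_contDiff ht)).integral_fderiv_apply (0, 1)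
    have e : ∀ p : GrushinSpace n, fderiv ℝ (fun q : GrushinSpace n => 2 * q.2 * u q) p
        (0, 1) = 2 * p.2 * GrushinSpace.dt u p + 2 * u p := by
      intro p
      rw [fderiv_mul_apply (ht.differentiable (by simp) p) (hu.differentiable p)]
      have : HasFDerivAt (fun q : GrushinSpace n => 2 * q.2)
          ((2 : ℝ) • ContinuousLinearMap.snd ℝ (EuclideanSpace ℝ (Fin n)) ℝ) p :=
        hasFDerivAt_snd.const_mul 2
      rw [this.fderiv]
      simp [GrushinSpace.dt, mul_comm]
    simp_rw [e] at h
    rw [integral_add (hu.dt.smoothOff_mul (smoothOff_of_contDiff ht)).integrable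
      (hu.const_mul 2).integrable, integral_const_mul] at h
    linarith
  have e : ∀ p, GrushinSpace.euler u p =
      ∑ i, p.1 i * GrushinSpace.dx i u p + 2 * p.2 * GrushinSpace.dt u p :=
    fun p => euler_eq u p
  simp_rw [e]
  rw [integral_add (IsTestFunction.sum _ fun i => (hu.dx i).smoothOff_mul
      (smoothOff_of_contDiff (hx i))).integrable
    (hu.dt.smoothOff_mul (smoothOff_of_contDiff ht)).integrable, h2,
    integral_finsetSum _ fun i _ => ((hu.dx i).smoothOff_mul
      (smoothOff_of_contDiff (hx i))).integrable]
  simp_rw [h1]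
  simp
  ring

/-- The field generating the dilations has divergence `n + 2`, which the weight `ϱ^{-(n+2)}`
cancels. Antisymmetry of `E` is the product rule applied to this. -/
theorem wInt_euler (hu : IsTestFunction u) : wInt (GrushinSpace.euler u) = 0 := by
  have hF : IsTestFunction fun p => rho p ^ (-(n + 2) : ℝ) * u p :=
    hu.smoothOff_mul (smoothOff_rho_rpow _)
  have h := hF.integral_euler
  have e : ∫ p, GrushinSpace.euler (fun p => rho p ^ (-(n + 2) : ℝ) * u p) p =
      ∫ p, (rho p ^ (-(n + 2) : ℝ) * GrushinSpace.euler u p +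
        -(n + 2) * (rho p ^ (-(n + 2) : ℝ) * u p)) := by
    refine integral_congr_ae ?_
    filter_upwards [ae_ne_zero] with p hp
    rw [euler_rho_rpow_mul _ hp (hu.differentiable p)]
    ring
  rw [e, integral_add hu.euler.integrable_weight (hF.const_mul _).integrable,
    integral_const_mul] at h
  unfold wInt
  linarith

theorem wInt_mul_euler (hu : IsTestFunction u) (hv : IsTestFunction v) :
    wInt (fun p => u p * GrushinSpace.euler v p) =
      -wInt (fun p => GrushinSpace.euler u p * v p) := by
  have h := (hu.mul hv).wInt_euler
  rw [wInt_congr (g := fun p => u p * GrushinSpace.euler v p + GrushinSpace.euler u p * v p)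
    fun p _ => by rw [euler_mul (hu.differentiable p) (hv.differentiable p)]; ring,
    (hu.mul hv.euler).wInt_add (hu.euler.mul hv)] at h
  linarith

theorem wInt_psi_mul_euler (hu : IsTestFunction u) (hv : IsTestFunction v) :
    wInt (fun p => psi p * (u p * GrushinSpace.euler v p)) =
      -wInt (fun p => psi p * (GrushinSpace.euler u p * v p)) := by
  have h := (hu.smoothOff_mul smoothOff_psi).wInt_mul_euler hv
  rw [wInt_congr (f := fun p => psi p * (u p * GrushinSpace.euler v p))
    (g := fun p => psi p * u p * GrushinSpace.euler v p) fun p _ => by ring, h]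
  congr 1
  refine wInt_congr fun p hp => ?_
  rw [euler_psi_mul hp (hu.differentiable p)]
  ring

/-- No derivative falls on the coefficient `|x|²`, which does not depend on `t`. -/
theorem integral_mul_subLap (hu : IsTestFunction u) (hv : IsTestFunction v) :
    ∫ p, u p * GrushinSpace.subLap v p = -∫ p, GrushinSpace.gradInner u v p := by
  have hX := smoothOff_of_contDiff (contDiff_norm_fst_sq (n := n))
  have h1 : ∀ i, ∫ p, u p * GrushinSpace.dx i (GrushinSpace.dx i v) p =
      -∫ p, GrushinSpace.dx i u p * GrushinSpace.dx i v p := fun i =>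
    hu.integral_mul_fderiv (hv.dx i) _
  have h2 : ∫ p, (‖p.1‖ ^ 2 * u p) * GrushinSpace.dt (GrushinSpace.dt v) p =
      -∫ p, ‖p.1‖ ^ 2 * (GrushinSpace.dt u p * GrushinSpace.dt v p) := by
    rw [(show ∫ p, (‖p.1‖ ^ 2 * u p) * GrushinSpace.dt (GrushinSpace.dt v) p = _ from
      (hu.smoothOff_mul hX).integral_mul_fderiv hv.dt _)]
    congr 2; ext p
    rw [fderiv_mul_apply differentiableAt_norm_fst_sq (hu.differentiable p),
      fderiv_norm_fst_sq_apply]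
    simp only [inner_zero_right, GrushinSpace.dt]
    ring
  have e : ∀ p, u p * GrushinSpace.subLap v p =
      ∑ i, u p * GrushinSpace.dx i (GrushinSpace.dx i v) p +
        (‖p.1‖ ^ 2 * u p) * GrushinSpace.dt (GrushinSpace.dt v) p := by
    intro p
    rw [GrushinSpace.subLap, ← Finset.mul_sum]; ring
  simp_rw [e]
  unfold GrushinSpace.gradInner
  rw [integral_add (IsTestFunction.sum _ fun i => hu.mul ((hv.dx i).dx i)).integrable
    ((hu.smoothOff_mul hX).mul hv.dt.dt).integrable, h2,
    integral_finsetSum _ fun i _ => (hu.mul ((hv.dx i).dx i)).integrable,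
    integral_add (IsTestFunction.sum _ fun i => (hu.dx i).mul (hv.dx i)).integrable
    ((hu.dt.mul hv.dt).smoothOff_mul hX).integrable,
    integral_finsetSum _ fun i _ => ((hu.dx i).mul (hv.dx i)).integrable]
  simp_rw [h1]
  simp
  ring

/-- The angular operator is the negative generator of the angular form. -/
theorem wInt_mul_angOp (hu : IsTestFunction u) (hv : IsTestFunction v) :
    wInt (fun p => u p * GrushinSpace.angOp v p) = -wInt (GrushinSpace.carre u v) := by
  -- Since `ϱ^{-n} = ϱ^{-Q} ϱ²`, Green's formula is tested with `ϱ^{-n} u`. The gradient of the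
  -- weight produces `-nψ u Ev`, which accounts for the drift `nE` in `angOp`.
  have hF : IsTestFunction fun p => rho p ^ (-n : ℝ) * u p :=
    hu.smoothOff_mul (smoothOff_rho_rpow _)
  have hr : ∀ p : GrushinSpace n, p ≠ 0 →
      rho p ^ (-n : ℝ) = rho p ^ (-(n + 2) : ℝ) * rho p ^ 2 := by
    intro p hp
    rw [← Real.rpow_natCast, ← Real.rpow_add (rho_pos hp)]; norm_num
  have hA := hF.integral_mul_subLap hv
  have e1 : ∫ p, rho p ^ (-n : ℝ) * u p * GrushinSpace.subLap v p =
      wInt (fun p => rho p ^ 2 * (u p * GrushinSpace.subLap v p)) := by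
    refine integral_congr_ae ?_
    filter_upwards [ae_ne_zero] with p hp
    rw [hr p hp]; ring
  have e2 : ∫ p, GrushinSpace.gradInner (fun p => rho p ^ (-n : ℝ) * u p) v p =
      wInt (fun p => rho p ^ 2 * GrushinSpace.gradInner u v p -
        n * (psi p * (u p * GrushinSpace.euler v p))) := by
    refine integral_congr_ae ?_
    filter_upwards [ae_ne_zero] with p hp
    rw [gradInner_mul ((smoothOff_rho_rpow _).differentiableAt hp) (hu.differentiable p),
      gradInner_rho_rpow _ hp, hr p hp, show (-n - 2 : ℝ) = -(n + 2) by ring]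
    ring
  rw [e1, e2] at hA
  have hB := hu.wInt_psi_mul_euler hv.euler
  have t1 := (hu.mul hv.subLap).smoothOff_mul smoothOff_rho_sq
  have t2 := (hu.gradInner hv).smoothOff_mul smoothOff_rho_sq
  have t3 := (hu.mul hv.euler).smoothOff_mul smoothOff_psi
  have t4 := (hu.mul hv.euler.euler).smoothOff_mul smoothOff_psi
  have t5 := (hu.euler.mul hv.euler).smoothOff_mul smoothOff_psi
  have e3 : wInt (fun p => u p * GrushinSpace.angOp v p) =
      wInt (fun p => rho p ^ 2 * (u p * GrushinSpace.subLap v p) -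
        (psi p * (u p * GrushinSpace.euler (GrushinSpace.euler v) p) +
          n * (psi p * (u p * GrushinSpace.euler v p)))) :=
    wInt_congr fun p _ => by rw [GrushinSpace.angOp]; ring
  have e4 : wInt (GrushinSpace.carre u v) =
      wInt (fun p => rho p ^ 2 * GrushinSpace.gradInner u v p -
      psi p * (GrushinSpace.euler u p * GrushinSpace.euler v p)) := rfl
  rw [e3, e4, t1.wInt_sub (t4.add (t3.const_mul n)), t4.wInt_add (t3.const_mul n), hA,
    t2.wInt_sub (t3.const_mul n), t2.wInt_sub t5, hB]
  ring

theorem ae_eq_zero_of_wInt_sq (hu : IsTestFunction u) (h : wInt (fun p => u p ^ 2) = 0) :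
    ∀ᵐ p, u p = 0 := by
  have hi : Integrable fun p => rho p ^ (-(n + 2) : ℝ) * u p ^ 2 := by
    simpa only [sq] using (hu.mul hu).integrable_weight
  have := (integral_eq_zero_iff_of_nonneg (fun p => mul_nonneg
    (Real.rpow_nonneg (rho_nonneg p) _) (sq_nonneg (u p))) hi).1 h
  filter_upwards [this, ae_ne_zero] with p h1 h2
  simpa [(Real.rpow_pos_of_pos (rho_pos h2) _).ne'] using h1

/-- The angular operator commutes with multiplication by powers of `ϱ`. -/
theorem angOp_rho_rpow_mul (hu : IsTestFunction u) (s : ℝ) :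
    ∀ᵐ p, GrushinSpace.angOp (fun q => rho q ^ s * u q) p =
      rho p ^ s * GrushinSpace.angOp u p := by
  have hs := smoothOff_rho_rpow (n := n) s
  have hsu := hu.smoothOff_mul hs
  have hd := hsu.angOp.sub (hu.angOp.smoothOff_mul hs)
  set d : GrushinSpace n → ℝ := fun p => GrushinSpace.angOp (fun q => rho q ^ s * u q) p -
    rho p ^ s * GrushinSpace.angOp u p with hddef
  -- Weak argument: pairing the difference `d` with itself moves both operators into the form
  -- `carre`, through which powers of `ϱ` pass. No second derivatives of `ϱ` are computed, at the
  -- price of an almost everywhere statement.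
  have key : wInt (fun p => d p ^ 2) = 0 := by
    have e : wInt (fun p => d p ^ 2) =
        wInt (fun p => d p * GrushinSpace.angOp (fun q => rho q ^ s * u q) p -
          (rho p ^ s * d p) * GrushinSpace.angOp u p) :=
      wInt_congr fun p _ => by simp only [hddef]; ring
    have hsd := hd.smoothOff_mul hs
    rw [e, (hd.mul hsu.angOp).wInt_sub (hsd.mul hu.angOp), hd.wInt_mul_angOp hsu,
      hsd.wInt_mul_angOp hu]
    have : wInt (GrushinSpace.carre d fun q => rho q ^ s * u q) =
        wInt (GrushinSpace.carre (fun q => rho q ^ s * d q) u) := by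
      refine wInt_congr fun p hp => ?_
      rw [carre_comm, carre_rho_rpow_mul s hp (hu.differentiable p),
        carre_rho_rpow_mul s hp (hd.differentiable p), carre_comm]
    rw [this]; ring
  filter_upwards [hd.ae_eq_zero_of_wInt_sq key] with p hp
  simpa [hddef, sub_eq_zero] using hp

end IsTestFunction

end GrushinSpace

end

/-! ### Polar coordinates for the anisotropic dilations -/

noncomputable section

theorem lintegral_eq_mul_lintegral_comp_mul_left {a : ℝ} (ha : 0 < a) {g : ℝ → ENNReal}
    (hg : Measurable g) : ∫⁻ t, g t = ENNReal.ofReal a * ∫⁻ τ, g (a * τ) := by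
  conv_lhs => rw [← Real.smul_map_volume_mul_left ha.ne']
  rw [lintegral_smul_measure, lintegral_map hg (by fun_prop), abs_of_pos ha, smul_eq_mul]

open Set in
theorem setLIntegral_Ioi_eq_mul_comp_mul_left {a : ℝ} (ha : 0 < a) {g : ℝ → ENNReal}
    (hg : Measurable g) :
    ∫⁻ t in Ioi (0 : ℝ), g t = ENNReal.ofReal a * ∫⁻ τ in Ioi (0 : ℝ), g (a * τ) := by
  rw [← lintegral_indicator measurableSet_Ioi, ← lintegral_indicator measurableSet_Ioi,
    lintegral_eq_mul_lintegral_comp_mul_left ha (hg.indicator measurableSet_Ioi)]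
  congr 2
  ext τ
  by_cases h : 0 < τ
  · rw [indicator_of_mem (show a * τ ∈ Ioi 0 from mul_pos ha h),
      indicator_of_mem (show τ ∈ Ioi 0 from h)]
  · have h' : a * τ ∉ Ioi 0 := fun h2 => h (pos_of_mul_pos_right h2 ha.le)
    rw [indicator_of_notMem h', indicator_of_notMem (show τ ∉ Ioi 0 from h)]

namespace GrushinSpace

variable {n : ℕ}

/-- The point at height `s` over the point `(σ, τ)` of the cylinder: the point `δ_r (σ, τ)` with
`ϱ`-norm `s`. -/
def cyl (s : ℝ) (z : EuclideanSpace ℝ (Fin n) × ℝ) : GrushinSpace n :=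
  ((s * (1 + 4 * z.2 ^ 2) ^ (-1 / 4 : ℝ)) • z.1, s ^ 2 * (1 + 4 * z.2 ^ 2) ^ (-1 / 2 : ℝ) * z.2)

theorem continuous_rpow_one_add_four_sq (s : ℝ) : Continuous fun τ : ℝ => (1 + 4 * τ ^ 2) ^ s :=
  Continuous.rpow_const (by fun_prop) fun τ => Or.inl (by positivity)

theorem continuous_cyl : Continuous fun q : ℝ × (EuclideanSpace ℝ (Fin n) × ℝ) => cyl q.1 q.2 := by
  have h := fun s => (continuous_rpow_one_add_four_sq s).comp
    (continuous_snd.comp (continuous_snd (X := ℝ) (Y := EuclideanSpace ℝ (Fin n) × ℝ)))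
  have h1 := h (-1 / 4)
  have h2 := h (-1 / 2)
  simp only [Function.comp_def] at h1 h2
  unfold cyl
  fun_prop

open Set Metric in
/-- Polar coordinates adapted to the anisotropic dilations. -/
theorem lintegral_eq_lintegral_cyl (hn : 1 ≤ n) {F : GrushinSpace n → ENNReal}
    (hF : Measurable F) :
    ∫⁻ p, F p = ∫⁻ s in Ioi (0 : ℝ), ENNReal.ofReal (s ^ (n + 1)) *
      ∫⁻ z : sphere (0 : EuclideanSpace ℝ (Fin n)) 1 × ℝ,
        ENNReal.ofReal ((1 + 4 * z.2 ^ 2) ^ (-(n + 2) / 4 : ℝ)) * F (cyl s (z.1, z.2))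
          ∂((volume : Measure (EuclideanSpace ℝ (Fin n))).toSphere.prod volume) := by
  have := nontrivial_euclideanSpace (n := n) (by omega)
  set ν := (volume : Measure (EuclideanSpace ℝ (Fin n))).toSphere with hν
  have hdim : Module.finrank ℝ (EuclideanSpace ℝ (Fin n)) = n := by simp
  have hcw : ∀ s : ℝ, Measurable fun τ : ℝ => (1 + 4 * τ ^ 2) ^ s := fun s =>
    (continuous_rpow_one_add_four_sq s).measurable
  calc ∫⁻ p, F p = ∫⁻ t : ℝ, ∫⁻ x : EuclideanSpace ℝ (Fin n), F (x, t) :=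
        lintegral_prod_symm _ hF.aemeasurable
    _ = ∫⁻ t : ℝ, ∫⁻ σ : sphere (0 : EuclideanSpace ℝ (Fin n)) 1, ∫⁻ r in Ioi (0 : ℝ),
          ENNReal.ofReal (r ^ (n - 1)) * F (r • (σ : EuclideanSpace ℝ (Fin n)), t) ∂volume ∂ν := by
        congr 1; ext t
        rw [lintegral_eq_lintegral_toSphere volume (F := fun x => F (x, t)) (by fun_prop), hdim]
    _ = ∫⁻ σ : sphere (0 : EuclideanSpace ℝ (Fin n)) 1, ∫⁻ t : ℝ, ∫⁻ r in Ioi (0 : ℝ),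
          ENNReal.ofReal (r ^ (n - 1)) * F (r • (σ : EuclideanSpace ℝ (Fin n)), t) ∂volume
            ∂volume ∂ν := by
        refine lintegral_lintegral_swap (Measurable.aemeasurable ?_)
        refine Measurable.lintegral_prod_right'
          (f := fun q : (ℝ × sphere (0 : EuclideanSpace ℝ (Fin n)) 1) × ℝ =>
            ENNReal.ofReal (q.2 ^ (n - 1)) *
              F (q.2 • (q.1.2 : EuclideanSpace ℝ (Fin n)), q.1.1)) ?_
        fun_prop
    _ = ∫⁻ σ : sphere (0 : EuclideanSpace ℝ (Fin n)) 1, ∫⁻ r in Ioi (0 : ℝ), ∫⁻ t : ℝ,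
          ENNReal.ofReal (r ^ (n - 1)) * F (r • (σ : EuclideanSpace ℝ (Fin n)), t) ∂volume
            ∂volume ∂ν := by
        congr 1; ext σ
        exact lintegral_lintegral_swap (Measurable.aemeasurable (by fun_prop))
    _ = ∫⁻ σ : sphere (0 : EuclideanSpace ℝ (Fin n)) 1, ∫⁻ r in Ioi (0 : ℝ), ∫⁻ τ : ℝ,
          ENNReal.ofReal (r ^ (n + 1)) *
            F (r • (σ : EuclideanSpace ℝ (Fin n)), r ^ 2 * τ) ∂volume ∂volume ∂ν := by
        congr 1; ext σ
        refine setLIntegral_congr_fun measurableSet_Ioi fun r hr => ?_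
        have hr0 : 0 < r := hr
        -- Substitution `t = r²τ`; its Jacobian `r²` raises `r^{n-1}` to `r^{n+1}`.
        rw [lintegral_eq_mul_lintegral_comp_mul_left (pow_pos hr0 2) (by fun_prop),
          ← lintegral_const_mul _ (by fun_prop)]
        congr 1; ext τ
        rw [← mul_assoc, ← ENNReal.ofReal_mul (by positivity), ← pow_add,
          show 2 + (n - 1) = n + 1 by omega]
    _ = ∫⁻ σ : sphere (0 : EuclideanSpace ℝ (Fin n)) 1, ∫⁻ τ : ℝ, ∫⁻ r in Ioi (0 : ℝ),
          ENNReal.ofReal (r ^ (n + 1)) *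
            F (r • (σ : EuclideanSpace ℝ (Fin n)), r ^ 2 * τ) ∂volume ∂volume ∂ν := by
        congr 1; ext σ
        exact lintegral_lintegral_swap (Measurable.aemeasurable (by fun_prop))
    _ = ∫⁻ σ : sphere (0 : EuclideanSpace ℝ (Fin n)) 1, ∫⁻ τ : ℝ, ∫⁻ s in Ioi (0 : ℝ),
          ENNReal.ofReal (s ^ (n + 1)) * (ENNReal.ofReal ((1 + 4 * τ ^ 2) ^ (-(n + 2) / 4 : ℝ)) *
            F (cyl s (σ, τ))) ∂volume ∂volume ∂ν := by
        congr 1; ext σ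
        congr 1; ext τ
        -- Substitution `r = s(1+4τ²)^{-1/4}`, which makes the new radius `s` equal to `ϱ`.
        have hk : 0 < (1 + 4 * τ ^ 2) ^ (-1 / 4 : ℝ) := by positivity
        rw [setLIntegral_Ioi_eq_mul_comp_mul_left hk (by fun_prop),
          ← lintegral_const_mul _ (by fun_prop)]
        refine setLIntegral_congr_fun measurableSet_Ioi fun s hs => ?_
        have hs0 : 0 < s := hs
        rw [← mul_assoc, ← mul_assoc, ← ENNReal.ofReal_mul (by positivity),
          ← ENNReal.ofReal_mul (by positivity)]
        have e1 : (1 + 4 * τ ^ 2) ^ (-(n + 2) / 4 : ℝ) =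
            ((1 + 4 * τ ^ 2) ^ (-1 / 4 : ℝ)) ^ (n + 2) := by
          rw [← Real.rpow_mul_natCast (by positivity)]
          congr 1; push_cast; ring
        have e2 : (1 + 4 * τ ^ 2) ^ (-1 / 2 : ℝ) = ((1 + 4 * τ ^ 2) ^ (-1 / 4 : ℝ)) ^ 2 := by
          rw [← Real.rpow_mul_natCast (by positivity)]
          norm_num
        unfold cyl
        simp only
        rw [e1, e2]
        congr 2
        · ring
        · rw [mul_comm s, mul_pow, mul_comm (s ^ 2)]
    _ = ∫⁻ z : sphere (0 : EuclideanSpace ℝ (Fin n)) 1 × ℝ, ∫⁻ s in Ioi (0 : ℝ),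
          ENNReal.ofReal (s ^ (n + 1)) * (ENNReal.ofReal ((1 + 4 * z.2 ^ 2) ^ (-(n + 2) / 4 : ℝ)) *
            F (cyl s (z.1, z.2))) ∂volume ∂(ν.prod volume) := by
        rw [lintegral_prod]
        refine Measurable.aemeasurable ?_
        refine Measurable.lintegral_prod_right'
          (f := fun q : (sphere (0 : EuclideanSpace ℝ (Fin n)) 1 × ℝ) × ℝ =>
            ENNReal.ofReal (q.2 ^ (n + 1)) * (ENNReal.ofReal ((1 + 4 * q.1.2 ^ 2) ^
              (-(n + 2) / 4 : ℝ)) * F (cyl q.2 (q.1.1, q.1.2)))) ?_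
        have := continuous_cyl (n := n) |>.measurable
        refine Measurable.mul (by fun_prop) (Measurable.mul (by fun_prop) (hF.comp ?_))
        exact this.comp (by fun_prop :
          Measurable fun q : (sphere (0 : EuclideanSpace ℝ (Fin n)) 1 × ℝ) × ℝ =>
            (q.2, ((q.1.1 : EuclideanSpace ℝ (Fin n)), q.1.2)))
    _ = _ := by
        rw [lintegral_lintegral_swap]
        · refine setLIntegral_congr_fun measurableSet_Ioi fun s hs => ?_
          rw [lintegral_const_mul']
          exact ENNReal.ofReal_ne_top
        · refine Measurable.aemeasurable ?_
          have := continuous_cyl (n := n) |>.measurable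
          refine Measurable.mul (by fun_prop) (Measurable.mul (by fun_prop) (hF.comp ?_))
          exact this.comp (by fun_prop :
            Measurable fun q : (sphere (0 : EuclideanSpace ℝ (Fin n)) 1 × ℝ) × ℝ =>
              (q.2, ((q.1.1 : EuclideanSpace ℝ (Fin n)), q.1.2)))

end GrushinSpace

end

/-! ### The angular form on the cylinder and the Poincaré inequality on level sets -/

noncomputable section

namespace GrushinSpace

variable {n : ℕ}

theorem one_add_four_sq_rpow_eq_pow (τ s : ℝ) (k : ℕ) (h : s = -1 / 4 * k) :
    (1 + 4 * τ ^ 2) ^ s = ((1 + 4 * τ ^ 2) ^ (-1 / 4 : ℝ)) ^ k := by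
  rw [← Real.rpow_mul_natCast (by positivity), h]

theorem rpow_neg_quarter_pow_four_mul (τ : ℝ) :
    ((1 + 4 * τ ^ 2) ^ (-1 / 4 : ℝ)) ^ 4 * (1 + 4 * τ ^ 2) = 1 := by
  rw [← Real.rpow_mul_natCast (by positivity), ← Real.rpow_add_one (by positivity)]
  norm_num

theorem norm_cyl_fst {s : ℝ} (hs : 0 < s) {σ : EuclideanSpace ℝ (Fin n)} (hσ : ‖σ‖ = 1) (τ : ℝ) :
    ‖(cyl s (σ, τ)).1‖ = s * (1 + 4 * τ ^ 2) ^ (-1 / 4 : ℝ) := by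
  simp only [cyl, norm_smul, hσ, mul_one]
  exact Real.norm_of_nonneg (by positivity)

theorem rho_cyl {s : ℝ} (hs : 0 < s) {σ : EuclideanSpace ℝ (Fin n)} (hσ : ‖σ‖ = 1) (τ : ℝ) :
    rho (cyl s (σ, τ)) = s := by
  refine (pow_left_inj₀ (rho_nonneg _) hs.le four_ne_zero).1 ?_
  rw [rho_pow_four, norm_cyl_fst hs hσ]
  simp only [cyl]
  rw [one_add_four_sq_rpow_eq_pow τ (-1 / 2) 2 (by norm_num)]
  have := rpow_neg_quarter_pow_four_mul τ
  set k := (1 + 4 * τ ^ 2) ^ (-1 / 4 : ℝ)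
  linear_combination s ^ 4 * this

theorem psi_cyl {s : ℝ} (hs : 0 < s) {σ : EuclideanSpace ℝ (Fin n)} (hσ : ‖σ‖ = 1) (τ : ℝ) :
    psi (cyl s (σ, τ)) = (1 + 4 * τ ^ 2) ^ (-1 / 2 : ℝ) := by
  rw [psi, norm_cyl_fst hs hσ, rho_cyl hs hσ,
    one_add_four_sq_rpow_eq_pow τ (-1 / 2) 2 (by norm_num)]
  field_simp

theorem hasDerivAt_cyl (s τ : ℝ) (σ : EuclideanSpace ℝ (Fin n)) :
    HasDerivAt (fun τ => cyl s (σ, τ)) ((-2 * s * τ * (1 + 4 * τ ^ 2) ^ (-5 / 4 : ℝ)) • σ,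
      s ^ 2 * (1 + 4 * τ ^ 2) ^ (-3 / 2 : ℝ)) τ := by
  have h1 := ((hasDerivAt_one_add_four_sq_rpow (-1 / 4) τ).const_mul s).smul_const σ
  have h2 := ((hasDerivAt_one_add_four_sq_rpow (-1 / 2) τ).const_mul (s ^ 2)).mul (hasDerivAt_id τ)
  have h3 := h1.prodMk h2
  convert! h3 using 1
  rw [show (-1 / 4 - 1 : ℝ) = -5 / 4 by norm_num, show (-1 / 2 - 1 : ℝ) = -3 / 2 by norm_num]
  have e : (1 + 4 * τ ^ 2) ^ (-1 / 2 : ℝ) = (1 + 4 * τ ^ 2) ^ (-3 / 2 : ℝ) * (1 + 4 * τ ^ 2) := by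
    rw [← Real.rpow_add_one (by positivity)]; norm_num
  rw [e]
  ext
  · simp; ring
  · simp; ring

/-- The derivative of `w` along the generators of the cylinder. -/
def cylDeriv (w : GrushinSpace n → ℝ) (s : ℝ) (z : EuclideanSpace ℝ (Fin n) × ℝ) : ℝ :=
  fderiv ℝ w (cyl s z) ((-2 * s * z.2 * (1 + 4 * z.2 ^ 2) ^ (-5 / 4 : ℝ)) • z.1,
      s ^ 2 * (1 + 4 * z.2 ^ 2) ^ (-3 / 2 : ℝ))

/-- The squared length of the derivative of `w` along the spheres of the cylinder. -/
def cylSphGrad (w : GrushinSpace n → ℝ) (s : ℝ) (z : EuclideanSpace ℝ (Fin n) × ℝ) : ℝ :=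
  (s * (1 + 4 * z.2 ^ 2) ^ (-1 / 4 : ℝ)) ^ 2 *
    (∑ i, dx i w (cyl s z) ^ 2 - fderiv ℝ w (cyl s z) (z.1, 0) ^ 2)

theorem fderiv_apply_eq (w : GrushinSpace n → ℝ) (p : GrushinSpace n) (a b : ℝ)
    (σ : EuclideanSpace ℝ (Fin n)) :
    fderiv ℝ w p (a • σ, b) = a * fderiv ℝ w p (σ, 0) + b * dt w p := by
  have : ((a • σ, b) : GrushinSpace n) = a • (σ, 0) + b • (0, 1) := by ext <;> simp
  rw [this, map_add, map_smul, map_smul]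
  rfl

/-- In the coordinates `(σ, τ)` the form is diagonal. Multiplied by the density
`(1+4τ²)^{-(n+2)/4}`, its two coefficients become the weights of `cylinder_poincare` with `N = n`.
-/
theorem carre_self_cyl (w : GrushinSpace n → ℝ) {s : ℝ} (hs : 0 < s)
    {σ : EuclideanSpace ℝ (Fin n)} (hσ : ‖σ‖ = 1) (τ : ℝ) :
    carre w w (cyl s (σ, τ)) = (1 + 4 * τ ^ 2) ^ (3 / 2 : ℝ) * cylDeriv w s (σ, τ) ^ 2 +
      (1 + 4 * τ ^ 2) ^ (1 / 2 : ℝ) * cylSphGrad w s (σ, τ) := by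
  have hm : 0 < 1 + 4 * τ ^ 2 := by positivity
  have hE : euler w (cyl s (σ, τ)) = s * (1 + 4 * τ ^ 2) ^ (-1 / 4 : ℝ) *
      fderiv ℝ w (cyl s (σ, τ)) (σ, 0) +
      2 * (s ^ 2 * (1 + 4 * τ ^ 2) ^ (-1 / 2 : ℝ) * τ) * dt w (cyl s (σ, τ)) :=
    fderiv_apply_eq _ _ _ _ _
  have hD : cylDeriv w s (σ, τ) = -2 * s * τ * (1 + 4 * τ ^ 2) ^ (-5 / 4 : ℝ) *
      fderiv ℝ w (cyl s (σ, τ)) (σ, 0) +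
      s ^ 2 * (1 + 4 * τ ^ 2) ^ (-3 / 2 : ℝ) * dt w (cyl s (σ, τ)) :=
    fderiv_apply_eq _ _ _ _ _
  rw [carre, gradInner, psi_cyl hs hσ, rho_cyl hs hσ, norm_cyl_fst hs hσ, hE, hD, cylSphGrad,
    one_add_four_sq_rpow_eq_pow τ (-1 / 2) 2 (by norm_num),
    one_add_four_sq_rpow_eq_pow τ (-5 / 4) 5 (by norm_num),
    one_add_four_sq_rpow_eq_pow τ (-3 / 2) 6 (by norm_num),
    show (3 / 2 : ℝ) = -(-3 / 2) by norm_num, show (1 / 2 : ℝ) = -(-1 / 2) by norm_num,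
    Real.rpow_neg hm.le, Real.rpow_neg hm.le,
    one_add_four_sq_rpow_eq_pow τ (-1 / 2) 2 (by norm_num),
    one_add_four_sq_rpow_eq_pow τ (-3 / 2) 6 (by norm_num)]
  have hk := rpow_neg_quarter_pow_four_mul τ
  have hk0 : 0 < (1 + 4 * τ ^ 2) ^ (-1 / 4 : ℝ) := by positivity
  simp only
  set k := (1 + 4 * τ ^ 2) ^ (-1 / 4 : ℝ)
  simp_rw [← sq]
  set a := fderiv ℝ w (cyl s (σ, τ)) (σ, 0)
  set b := dt w (cyl s (σ, τ))
  set A := ∑ i, dx i w (cyl s (σ, τ)) ^ 2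
  field_simp
  linear_combination (-(s ^ 2 * b ^ 2 * k ^ 2) - a ^ 2) * hk

open Metric in
/-- The mean of `w` over the sphere of radius `s` in the hyperplane `t = 0`. -/
def sphMean (w : GrushinSpace n → ℝ) (s : ℝ) : ℝ :=
  (∫ σ : sphere (0 : EuclideanSpace ℝ (Fin n)) 1, w (s • (σ : EuclideanSpace ℝ (Fin n)), 0)
    ∂volume.toSphere) / (volume : Measure (EuclideanSpace ℝ (Fin n))).toSphere.real Set.univ

open Metric in
/-- Poincaré inequality on the level sets of `ϱ`. -/
theorem fiber_poincare (hn : 3 ≤ n) {w : GrushinSpace n → ℝ} (hw : IsTestFunction w) {s : ℝ}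
    (hs : 0 < s) :
    ∫⁻ z : sphere (0 : EuclideanSpace ℝ (Fin n)) 1 × ℝ,
      ENNReal.ofReal ((1 + 4 * z.2 ^ 2) ^ (-(n + 2) / 4 : ℝ)) *
        ENNReal.ofReal (4 * (psi (cyl (n := n) s (↑z.1, z.2)) *
          (w (cyl s (↑z.1, z.2)) - sphMean w s) ^ 2))
          ∂((volume : Measure (EuclideanSpace ℝ (Fin n))).toSphere.prod volume) ≤
    ∫⁻ z : sphere (0 : EuclideanSpace ℝ (Fin n)) 1 × ℝ,
      ENNReal.ofReal ((1 + 4 * z.2 ^ 2) ^ (-(n + 2) / 4 : ℝ)) *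
        ENNReal.ofReal (carre w w (cyl s (↑z.1, z.2)))
          ∂((volume : Measure (EuclideanSpace ℝ (Fin n))).toSphere.prod volume) := by
  have := nontrivial_euclideanSpace (n := n) (by omega)
  set S := sphere (0 : EuclideanSpace ℝ (Fin n)) 1
  set ν := (volume : Measure (EuclideanSpace ℝ (Fin n))).toSphere with hν
  have hw1 : ContDiff ℝ 1 w := hw.contDiff.of_le (by simp)
  have hdc : Continuous (fderiv ℝ w) := hw1.continuous_fderiv (by simp)
  obtain ⟨K1, hK1⟩ := hw.hasCompactSupport.exists_bound_of_continuous hw.continuous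
  obtain ⟨K2, hK2⟩ := (hw.hasCompactSupport.fderiv (𝕜 := ℝ)).exists_bound_of_continuous hdc
  have hK20 : 0 ≤ K2 := (norm_nonneg _).trans (hK2 0)
  have hK10 : 0 ≤ K1 := (norm_nonneg _).trans (hK1 0)
  have hι : Continuous fun z : S × ℝ => ((z.1 : EuclideanSpace ℝ (Fin n)), z.2) := by fun_prop
  have hcyl : Continuous fun z : EuclideanSpace ℝ (Fin n) × ℝ => cyl s z :=
    continuous_cyl.comp (by fun_prop : Continuous fun z : EuclideanSpace ℝ (Fin n) × ℝ => (s, z))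
  have hcr := fun a => (continuous_rpow_one_add_four_sq a).comp
    (continuous_snd (X := EuclideanSpace ℝ (Fin n)) (Y := ℝ))
  simp only [Function.comp_def] at hcr
  have hcD : Continuous (cylDeriv w s) := by
    have h1 := hcr (-5 / 4)
    have h2 := hcr (-3 / 2)
    unfold cylDeriv
    fun_prop
  have hcG : Continuous (cylSphGrad w s) := by
    have h1 := hcr (-1 / 4)
    unfold cylSphGrad dx
    fun_prop
  have hn3 : (3 : ℝ) ≤ n := by exact_mod_cast hn
  have hdxb : ∀ (p : GrushinSpace n) (σ : EuclideanSpace ℝ (Fin n)), ‖σ‖ = 1 →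
      |fderiv ℝ w p (σ, 0)| ≤ K2 := by
    intro p σ hσ
    refine ((fderiv ℝ w p).le_opNorm _).trans ?_
    rw [Prod.norm_mk, hσ]
    simpa using hK2 p
  have hdtb : ∀ (p : GrushinSpace n), |dt w p| ≤ K2 := by
    intro p
    refine ((fderiv ℝ w p).le_opNorm _).trans ?_
    rw [Prod.norm_mk]
    simpa using hK2 p
  have hm1 : ∀ τ : ℝ, 1 ≤ 1 + 4 * τ ^ 2 := fun τ => by nlinarith [sq_nonneg τ]
  -- One constant dominating the function, its `τ`-derivative and its spherical gradient; the factor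
  -- `n + 1` counts the `n` partial derivatives and the derivative along `σ`.
  set M := K1 + (s + s ^ 2) * K2 + s ^ 2 * ((n + 1) * K2 ^ 2) with hM
  have hM1 : K1 ≤ M := by
    have : 0 ≤ (s + s ^ 2) * K2 + s ^ 2 * ((n + 1) * K2 ^ 2) := by positivity
    linarith
  have hM2 : (s + s ^ 2) * K2 ≤ M := by
    have : 0 ≤ s ^ 2 * ((n + 1) * K2 ^ 2) := by positivity
    linarith
  have hM3 : s ^ 2 * ((n + 1) * K2 ^ 2) ≤ M := by
    have : 0 ≤ (s + s ^ 2) * K2 := by positivity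
    linarith
  have key := cylinder_poincare (X := S) (ν := ν) (Measure.toSphere_ne_zero _) hn3
    (f := fun z => w (cyl s (↑z.1, z.2))) (f' := fun z => cylDeriv w s (↑z.1, z.2))
    (g := fun z => cylSphGrad w s (↑z.1, z.2)) (M := M) (hw.continuous.comp (hcyl.comp hι))
    (hcD.comp hι) (hcG.comp hι) ?_ (fun z => (hK1 _).trans hM1) ?_ ?_ ?_
  · obtain ⟨i1, i2, h⟩ := key
    rw [← integral_const_mul] at h
    have h' := ENNReal.ofReal_le_ofReal h
    rw [ofReal_integral_eq_lintegral_ofReal (i1.const_mul 4)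
      (Filter.Eventually.of_forall fun z => by positivity)] at h'
    have e0 : ∀ z : S × ℝ, (1 + 4 * z.2 ^ 2) ^ (1 - n / 4 : ℝ) * cylDeriv w s (↑z.1, z.2) ^ 2 +
        (1 + 4 * z.2 ^ 2) ^ (-n / 4 : ℝ) * cylSphGrad w s (↑z.1, z.2) =
        (1 + 4 * z.2 ^ 2) ^ (-(n + 2) / 4 : ℝ) * carre w w (cyl s (↑z.1, z.2)) := by
      intro z
      have hm : 0 < 1 + 4 * z.2 ^ 2 := by positivity
      rw [carre_self_cyl w hs (by simp), mul_add, ← mul_assoc, ← mul_assoc, ← Real.rpow_add hm,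
        ← Real.rpow_add hm]
      ring_nf
    rw [ofReal_integral_eq_lintegral_ofReal i2 (Filter.Eventually.of_forall fun z => by
      simp only [Pi.zero_apply]
      rw [e0]
      exact mul_nonneg (by positivity) (carre_self_nonneg _ _))] at h'
    refine le_trans (le_of_eq ?_) (h'.trans (le_of_eq ?_))
    · congr 1; ext z
      have hm : 0 < 1 + 4 * z.2 ^ 2 := by positivity
      rw [← ENNReal.ofReal_mul (by positivity), psi_cyl hs (by simp)]
      congr 1
      have : (1 + 4 * z.2 ^ 2) ^ (-n / 4 - 1 : ℝ) = (1 + 4 * z.2 ^ 2) ^ (-(n + 2) / 4 : ℝ) *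
          (1 + 4 * z.2 ^ 2) ^ (-1 / 2 : ℝ) := by
        rw [← Real.rpow_add hm]; ring_nf
      rw [this, sphMean]
      have e : ∀ σ : S, cyl s ((σ : EuclideanSpace ℝ (Fin n)), (0 : ℝ)) =
          (s • (σ : EuclideanSpace ℝ (Fin n)), 0) := by
        intro σ; simp [cyl]
      simp_rw [e]
      ring
    · congr 1; ext z
      rw [e0, ENNReal.ofReal_mul (by positivity)]
  · intro x τ
    have := (hw.differentiable (cyl s (↑x, τ))).hasFDerivAt.comp_hasDerivAt τ
      (hasDerivAt_cyl s τ (x : EuclideanSpace ℝ (Fin n)))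
    exact this
  · intro x τ
    have hm : 0 < 1 + 4 * τ ^ 2 := by positivity
    have hD : cylDeriv w s (x, τ) = -2 * s * τ * (1 + 4 * τ ^ 2) ^ (-5 / 4 : ℝ) *
        fderiv ℝ w (cyl s (↑x, τ)) (x, 0) +
        s ^ 2 * (1 + 4 * τ ^ 2) ^ (-3 / 2 : ℝ) * dt w (cyl s (↑x, τ)) :=
      fderiv_apply_eq _ _ _ _ _
    -- Absorbing the factor `τ` costs half a power and turns the exponent `-5/4` into the required
    -- `-3/4`.
    have hτ : 2 * |τ| ≤ (1 + 4 * τ ^ 2) ^ (1 / 2 : ℝ) := by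
      rw [← Real.sqrt_eq_rpow]
      apply Real.le_sqrt_of_sq_le
      rw [mul_pow, sq_abs]; linarith
    have e1 : (1 + 4 * τ ^ 2) ^ (1 / 2 : ℝ) * (1 + 4 * τ ^ 2) ^ (-5 / 4 : ℝ) =
        (1 + 4 * τ ^ 2) ^ (-3 / 4 : ℝ) := by
      rw [← Real.rpow_add hm]; norm_num
    have e2 : (1 + 4 * τ ^ 2) ^ (-3 / 2 : ℝ) ≤ (1 + 4 * τ ^ 2) ^ (-3 / 4 : ℝ) :=
      Real.rpow_le_rpow_of_exponent_le (hm1 τ) (by norm_num)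
    have hm54 : 0 < (1 + 4 * τ ^ 2) ^ (-5 / 4 : ℝ) := by positivity
    have hm32 : 0 < (1 + 4 * τ ^ 2) ^ (-3 / 2 : ℝ) := by positivity
    have hm34 : 0 < (1 + 4 * τ ^ 2) ^ (-3 / 4 : ℝ) := by positivity
    have e3 : 2 * |τ| * (1 + 4 * τ ^ 2) ^ (-5 / 4 : ℝ) ≤ (1 + 4 * τ ^ 2) ^ (-3 / 4 : ℝ) := by
      rw [← e1]; gcongr
    refine le_trans ?_ (mul_le_mul_of_nonneg_right hM2 hm34.le)
    rw [hD]
    refine (abs_add_le _ _).trans ?_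
    rw [abs_mul, abs_mul _ (dt w _), abs_mul, abs_mul, abs_mul, abs_mul, abs_of_pos hm54,
      abs_of_pos hm32, abs_of_pos hs, abs_of_pos (pow_pos hs 2),
      show |(-2 : ℝ)| = 2 by norm_num]
    calc 2 * s * |τ| * (1 + 4 * τ ^ 2) ^ (-5 / 4 : ℝ) * |fderiv ℝ w (cyl s (↑x, τ)) (x, 0)| +
          s ^ 2 * (1 + 4 * τ ^ 2) ^ (-3 / 2 : ℝ) * |dt w (cyl s (↑x, τ))|
        = s * (2 * |τ| * (1 + 4 * τ ^ 2) ^ (-5 / 4 : ℝ)) * |fderiv ℝ w (cyl s (↑x, τ)) (x, 0)| +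
          s ^ 2 * (1 + 4 * τ ^ 2) ^ (-3 / 2 : ℝ) * |dt w (cyl s (↑x, τ))| := by ring
      _ ≤ s * (1 + 4 * τ ^ 2) ^ (-3 / 4 : ℝ) * K2 +
          s ^ 2 * (1 + 4 * τ ^ 2) ^ (-3 / 4 : ℝ) * K2 := by
        have := hdxb (cyl s (↑x, τ)) x (by simp)
        have := hdtb (cyl s (↑x, τ))
        gcongr
      _ = _ := by ring
  · intro z
    have hk : (1 + 4 * z.2 ^ 2) ^ (-1 / 4 : ℝ) ≤ 1 :=
      Real.rpow_le_one_of_one_le_of_nonpos (hm1 _) (by norm_num)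
    have hk0 : 0 < (1 + 4 * z.2 ^ 2) ^ (-1 / 4 : ℝ) := by positivity
    refine le_trans ?_ hM3
    rw [cylSphGrad, abs_mul, abs_of_nonneg (sq_nonneg _)]
    refine mul_le_mul ?_ ?_ (abs_nonneg _) (by positivity)
    · exact pow_le_pow_left₀ (by positivity) (mul_le_of_le_one_right hs.le hk) 2
    · refine (abs_sub _ _).trans ?_
      have h1 : |∑ i, dx i w (cyl s (↑z.1, z.2)) ^ 2| ≤ n * K2 ^ 2 := by
        rw [abs_of_nonneg (Finset.sum_nonneg fun i _ => sq_nonneg _)]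
        refine (Finset.sum_le_card_nsmul _ _ (K2 ^ 2) fun i _ => ?_).trans (by simp)
        rw [← sq_abs]
        exact pow_le_pow_left₀ (abs_nonneg _) (hdxb _ _ (by simp)) 2
      have h2 : |fderiv ℝ w (cyl s (↑z.1, z.2)) (z.1, 0) ^ 2| ≤ K2 ^ 2 := by
        rw [abs_pow]
        exact pow_le_pow_left₀ (abs_nonneg _) (hdxb _ _ (by simp)) 2
      linarith
  · intro τ
    -- For fixed `τ` the slice is a round sphere of radius `a` in the hyperplane `t = b`. The
    -- inequality is applied on the unit sphere after scaling, whence the factor `a²` in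
    -- `cylSphGrad`.
    set a := s * (1 + 4 * τ ^ 2) ^ (-1 / 4 : ℝ) with ha
    set b := s ^ 2 * (1 + 4 * τ ^ 2) ^ (-1 / 2 : ℝ) * τ with hb
    set c := (∫ y : S, w (cyl s (↑y, τ)) ∂ν) / ν.real Set.univ with hc
    have hV0 : ν.real Set.univ ≠ 0 := by
      rw [measureReal_def]
      exact (ENNReal.toReal_pos (by simpa using (Measure.toSphere_ne_zero (μ := volume)))
        (measure_ne_top _ _)).ne'
    have hA : ContDiff ℝ 1 fun x : EuclideanSpace ℝ (Fin n) => ((a • x, b) : GrushinSpace n) := by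
      fun_prop
    have hφ : ContDiff ℝ 1 fun x : EuclideanSpace ℝ (Fin n) => w (a • x, b) - c :=
      (hw1.comp hA).sub contDiff_const
    have ix : Integrable (fun y : S => w (cyl s (↑y, τ))) ν :=
      Continuous.integrable_of_hasCompactSupport
        (hw.continuous.comp (hcyl.comp (by fun_prop))) (HasCompactSupport.of_compactSpace _)
    have h0 : ∫ σ : S, (w (a • σ, b) - c) ∂ν = 0 := by
      have : ∫ σ : S, (w (cyl s (σ, τ)) - c) ∂ν = 0 := by
        rw [integral_sub ix (integrable_const _), integral_const, smul_eq_mul, hc,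
          mul_div_cancel₀ _ hV0, sub_self]
      exact this
    have hf : ∀ x v : EuclideanSpace ℝ (Fin n),
        fderiv ℝ (fun x : EuclideanSpace ℝ (Fin n) => w (a • x, b) - c) x v =
        a * fderiv ℝ w (a • x, b) (v, 0) := by
      intro x v
      have h1 : HasFDerivAt (fun x : EuclideanSpace ℝ (Fin n) => ((a • x, b) : GrushinSpace n))
          ((a • ContinuousLinearMap.id ℝ _).prod 0) x :=
        ((hasFDerivAt_id x).const_smul a).prodMk (hasFDerivAt_const b x)
      have h2 := ((hw.differentiable _).hasFDerivAt.comp x h1).sub_const c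
      have h3 : fderiv ℝ (fun x : EuclideanSpace ℝ (Fin n) => w (a • x, b) - c) x v =
          fderiv ℝ w (a • x, b) (a • v, 0) := by
        rw [show (fun x : EuclideanSpace ℝ (Fin n) => w (a • x, b) - c) =
          fun x => (w ∘ fun x : EuclideanSpace ℝ (Fin n) => ((a • x, b) : GrushinSpace n)) x - c
          from rfl, h2.fderiv]
        simp
      rw [h3, fderiv_apply_eq]; ring
    have hp := sphere_poincare (by omega) hφ h0
    refine hp.trans (le_of_eq ?_)
    congr 1; ext σ
    simp_rw [hf]
    simp only [cylSphGrad, dx, mul_pow]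
    rw [← Finset.mul_sum, ← mul_sub, ← mul_pow]
    rfl

end GrushinSpace

end

/-! ### The spectral gap of the angular operator -/

noncomputable section

namespace GrushinSpace

variable {n : ℕ}

theorem toSphere_real_univ_pos (hn : 1 ≤ n) :
    0 < (volume : Measure (EuclideanSpace ℝ (Fin n))).toSphere.real Set.univ := by
  have := nontrivial_euclideanSpace hn
  rw [measureReal_def]
  exact ENNReal.toReal_pos (fun h => Measure.toSphere_ne_zero _ (Measure.measure_univ_eq_zero.1 h))
    (measure_ne_top _ _)

section Radial

variable {φ : ℝ → ℝ}

theorem eventually_comp_rho_eq_zero (hφ0 : (0 : ℝ) ∉ tsupport φ) :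
    (fun p : GrushinSpace n => φ (rho p)) =ᶠ[nhds 0] fun _ => 0 := by
  have h1 := notMem_tsupport_iff_eventuallyEq.1 hφ0
  have h2 : Filter.Tendsto (rho : GrushinSpace n → ℝ) (nhds 0) (nhds 0) := by
    simpa using (continuous_rho (n := n)).tendsto 0
  exact h2.eventually h1

theorem isTestFunction_comp_rho (hφ : ContDiff ℝ ∞ φ) (hc : HasCompactSupport φ)
    (hφ0 : (0 : ℝ) ∉ tsupport φ) : IsTestFunction fun p : GrushinSpace n => φ (rho p) := by
  refine ⟨?_, ?_, notMem_tsupport_iff_eventuallyEq.2 (eventually_comp_rho_eq_zero hφ0)⟩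
  · rw [contDiff_iff_contDiffAt]
    intro p
    by_cases hp : p = 0
    · subst hp
      exact contDiffAt_const.congr_of_eventuallyEq (eventually_comp_rho_eq_zero hφ0)
    · exact hφ.contDiffAt.comp p (smoothOff_rho p hp)
  · obtain ⟨R, hR⟩ := hc.isCompact.isBounded.subset_closedBall 0
    refine HasCompactSupport.intro ((isCompact_closedBall (0 : EuclideanSpace ℝ (Fin n)) R).prod
      (isCompact_closedBall (0 : ℝ) (R ^ 2))) fun p hp => ?_
    by_contra h
    have h1 : rho p ≤ R := by
      simpa [abs_of_nonneg (rho_nonneg p)] using hR (subset_tsupport _ h)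
    have hR0 := (rho_nonneg p).trans h1
    have h2 : ‖p.1‖ ^ 4 + 4 * p.2 ^ 2 ≤ R ^ 4 := by
      rw [← rho_pow_four]; exact pow_le_pow_left₀ (rho_nonneg p) h1 4
    refine hp ⟨?_, ?_⟩
    · rw [mem_closedBall_zero_iff]
      exact le_of_pow_le_pow_left₀ four_ne_zero hR0 (by nlinarith [sq_nonneg p.2])
    · rw [mem_closedBall_zero_iff, Real.norm_eq_abs]
      refine abs_le_of_sq_le_sq ?_ (sq_nonneg R)
      nlinarith [sq_nonneg p.2, pow_nonneg (norm_nonneg p.1) 4]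

theorem fderiv_comp_rho (hφ : Differentiable ℝ φ) {p : GrushinSpace n} (hp : p ≠ 0)
    (v : GrushinSpace n) : fderiv ℝ (fun q : GrushinSpace n => φ (rho q)) p v =
      deriv φ (rho p) * fderiv ℝ (rho : GrushinSpace n → ℝ) p v := by
  have := (hφ (rho p)).hasDerivAt.comp_hasFDerivAt p (smoothOff_rho.differentiableAt hp).hasFDerivAt
  rw [show (fun q : GrushinSpace n => φ (rho q)) = φ ∘ rho from rfl, this.fderiv]
  simp

theorem euler_comp_rho (hφ : Differentiable ℝ φ) {p : GrushinSpace n} (hp : p ≠ 0) :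
    euler (fun q : GrushinSpace n => φ (rho q)) p = rho p * deriv φ (rho p) := by
  rw [euler, fderiv_comp_rho hφ hp]
  have := euler_rho_rpow 1 hp
  simp only [Real.rpow_one, one_mul] at this
  rw [← euler, this, mul_comm]

theorem carre_comp_rho (hφ : Differentiable ℝ φ) {p : GrushinSpace n} (hp : p ≠ 0)
    (g : GrushinSpace n → ℝ) : carre (fun q : GrushinSpace n => φ (rho q)) g p = 0 := by
  have h := carre_rho_rpow 1 hp g
  simp only [Real.rpow_one] at h
  have : carre (fun q : GrushinSpace n => φ (rho q)) g p = deriv φ (rho p) * carre rho g p := by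
    simp only [carre, gradInner, euler, dx, dt, fderiv_comp_rho hφ hp, mul_assoc]
    rw [← Finset.mul_sum]
    ring
  rw [this, h, mul_zero]

end Radial

-- The function `|x|^{-2}` is locally integrable on `ℝⁿ` for `n ≥ 3`: in polar coordinates it leaves
-- `r^{n-3}`. It is needed because `ψ` vanishes on the `t`-axis.
open Metric in
theorem integrable_div_norm_fst_sq (hn : 3 ≤ n) {f : GrushinSpace n → ℝ} (hf : Continuous f)
    (hc : HasCompactSupport f) : Integrable fun p => f p / ‖p.1‖ ^ 2 := by
  have := nontrivial_euclideanSpace (n := n) (by omega)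
  obtain ⟨M, hM⟩ := hc.exists_bound_of_continuous hf
  obtain ⟨R, hR⟩ := hc.isCompact.isBounded.subset_ball 0
  have h1 : Integrable ((ball (0 : EuclideanSpace ℝ (Fin n)) R).indicator
      fun x => (‖x‖ ^ 2)⁻¹) := by
    rw [integrable_indicator_iff measurableSet_ball,
      integrableOn_fun_norm_addHaar volume (f := fun y : ℝ => (y ^ 2)⁻¹)]
    have hI : IntegrableOn (fun y : ℝ => y ^ (n - 3)) (Set.Ioo 0 R) :=
      ((continuous_pow (n - 3)).integrableOn_Icc (a := 0) (b := R)).mono_set Set.Ioo_subset_Icc_self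
    refine hI.congr_fun (fun y hy => ?_) measurableSet_Ioo
    have hy0 : y ≠ 0 := hy.1.ne'
    simp only [finrank_euclideanSpace, Fintype.card_fin, smul_eq_mul]
    rw [show n - 1 = (n - 3) + 2 by omega, pow_add, mul_assoc, mul_inv_cancel₀ (pow_ne_zero 2 hy0),
      mul_one]
  have h2 : Integrable ((ball (0 : ℝ) R).indicator fun _ => M) := by
    rw [integrable_indicator_iff measurableSet_ball]
    exact integrableOn_const measure_ball_lt_top.ne
  refine (h1.mul_prod h2).mono' ?_ (Filter.Eventually.of_forall fun p => ?_)
  · exact (hf.measurable.div (by fun_prop)).aestronglyMeasurable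
  · by_cases hp : f p = 0
    · have hM0 : 0 ≤ M := (norm_nonneg _).trans (hM p)
      simp only [hp, zero_div, norm_zero]
      exact mul_nonneg (Set.indicator_nonneg (fun _ _ => by positivity) _)
        (Set.indicator_nonneg (fun _ _ => hM0) _)
    · have h3 := hR (subset_tsupport _ hp)
      rw [mem_ball_zero_iff, Prod.norm_def, max_lt_iff] at h3
      rw [Set.indicator_of_mem (by simpa using h3.1), Set.indicator_of_mem (by simpa using h3.2),
        norm_div, norm_pow, norm_norm, div_eq_inv_mul]
      gcongr
      exact hM p

open Metric in
theorem continuous_sphMean {w : GrushinSpace n → ℝ} (hw : Continuous w) :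
    Continuous (sphMean w) := by
  have h := continuous_parametric_integral_of_continuous
    (μ := (volume : Measure (EuclideanSpace ℝ (Fin n))).toSphere)
    (f := fun (s : ℝ) (σ : sphere (0 : EuclideanSpace ℝ (Fin n)) 1) =>
      w (s • (σ : EuclideanSpace ℝ (Fin n)), 0)) (by
      simp only [Function.uncurry_def]; fun_prop) isCompact_univ
  simp only [Measure.restrict_univ] at h
  exact h.div_const _

namespace IsTestFunction

variable {w : GrushinSpace n → ℝ}

/-- Poincaré inequality for the angular gradient. -/
theorem four_mul_wInt_le (hn : 3 ≤ n) (hw : IsTestFunction w) :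
    Integrable (fun p => rho p ^ (-(n + 2) : ℝ) * (psi p * (w p - sphMean w (rho p)) ^ 2)) ∧
    4 * wInt (fun p => psi p * (w p - sphMean w (rho p)) ^ 2) ≤ wInt (GrushinSpace.carre w w) := by
  have hm : Measurable fun p : GrushinSpace n =>
      psi p * (w p - sphMean w (rho p)) ^ 2 := by
    have h1 := (continuous_rho (n := n)).measurable
    have h2 := (continuous_sphMean hw.continuous).measurable
    have h3 := hw.continuous.measurable
    unfold psi
    fun_prop
  have hr : Measurable fun p : GrushinSpace n => rho p ^ (-(n + 2) : ℝ) :=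
    continuous_rho.measurable.pow_const _
  have hcm : Measurable (GrushinSpace.carre w w) := (hw.carre hw).continuous.measurable
  have hr0 : ∀ p : GrushinSpace n, 0 ≤ rho p ^ (-(n + 2) : ℝ) := fun p =>
    Real.rpow_nonneg (rho_nonneg p) _
  have key : ∫⁻ p, ENNReal.ofReal (rho p ^ (-(n + 2) : ℝ) *
      (4 * (psi p * (w p - sphMean w (rho p)) ^ 2))) ≤
      ∫⁻ p, ENNReal.ofReal (rho p ^ (-(n + 2) : ℝ) * GrushinSpace.carre w w p) := by
    rw [lintegral_eq_lintegral_cyl (by omega) (by fun_prop),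
      lintegral_eq_lintegral_cyl (by omega) (by fun_prop)]
    refine setLIntegral_mono' measurableSet_Ioi fun s hs => ?_
    have hs : 0 < s := hs
    refine mul_le_mul_right ?_ _
    have h := fiber_poincare hn hw hs
    have h' := mul_le_mul_right h (ENNReal.ofReal (s ^ (-(n + 2) : ℝ)))
    rw [← lintegral_const_mul' _ _ ENNReal.ofReal_ne_top,
      ← lintegral_const_mul' _ _ ENNReal.ofReal_ne_top] at h'
    refine le_trans (le_of_eq ?_) (h'.trans (le_of_eq ?_))
    · congr 1; ext z
      rw [rho_cyl hs (by simp), ENNReal.ofReal_mul (Real.rpow_nonneg hs.le _)]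
      ring
    · congr 1; ext z
      rw [rho_cyl hs (by simp), ENNReal.ofReal_mul (Real.rpow_nonneg hs.le _)]
      ring
  have hi := (hw.carre hw).integrable_weight
  have hpos : ∀ p, 0 ≤ rho p ^ (-(n + 2) : ℝ) * (4 * (psi p * (w p - sphMean w (rho p)) ^ 2)) :=
    fun p => mul_nonneg (hr0 p) (by have := psi_nonneg p; positivity)
  -- Finiteness of the left side is inherited from the test function on the right of `key`; this is
  -- why the comparison is made with lower integrals.
  have hi4 : Integrable fun p => rho p ^ (-(n + 2) : ℝ) *
      (4 * (psi p * (w p - sphMean w (rho p)) ^ 2)) := by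
    refine ⟨(by fun_prop : Measurable _).aestronglyMeasurable, ?_⟩
    rw [hasFiniteIntegral_iff_ofReal (Filter.Eventually.of_forall hpos)]
    refine key.trans_lt ?_
    have := hi.2
    rwa [hasFiniteIntegral_iff_ofReal (Filter.Eventually.of_forall fun p =>
      mul_nonneg (hr0 p) (carre_self_nonneg w p))] at this
  rw [← ofReal_integral_eq_lintegral_ofReal hi4 (Filter.Eventually.of_forall hpos),
    ← ofReal_integral_eq_lintegral_ofReal hi (Filter.Eventually.of_forall fun p =>
      mul_nonneg (hr0 p) (carre_self_nonneg w p)), ENNReal.ofReal_le_ofReal_iff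
      (integral_nonneg fun p => mul_nonneg (hr0 p) (carre_self_nonneg w p))] at key
  refine ⟨?_, ?_⟩
  · refine (hi4.const_mul (1 / 4)).congr (Filter.Eventually.of_forall fun p => ?_)
    simp only; ring
  · refine le_trans (le_of_eq ?_) key
    rw [wInt, ← integral_const_mul]
    congr 1; ext p; ring

open Metric in
/-- The angular operator is orthogonal to radial functions. -/
theorem wInt_sphMean_mul_angOp (hn : 1 ≤ n) (hw : IsTestFunction w) :
    Integrable (fun p => rho p ^ (-(n + 2) : ℝ) *
      (sphMean w (rho p) * GrushinSpace.angOp w p)) ∧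
    wInt (fun p => sphMean w (rho p) * GrushinSpace.angOp w p) = 0 := by
  set ν := (volume : Measure (EuclideanSpace ℝ (Fin n))).toSphere with hν
  -- For each `σ` the restriction of `w` to a line is the profile of a radial test function,
  -- orthogonal to `Aw`. Averaging over `σ` by Fubini gives the claim for `sphMean` with no need to
  -- show it smooth.
  have hw0 : ∀ σ : sphere (0 : EuclideanSpace ℝ (Fin n)) 1,
      ∫ p, w (rho p • (σ : EuclideanSpace ℝ (Fin n)), 0) *
        (rho p ^ (-(n + 2) : ℝ) * GrushinSpace.angOp w p) = 0 := by
    intro σ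
    have hσ : ‖(σ : EuclideanSpace ℝ (Fin n))‖ = 1 := by simp
    have hι : Topology.IsClosedEmbedding fun s : ℝ =>
        ((s • (σ : EuclideanSpace ℝ (Fin n)), 0) : GrushinSpace n) := by
      refine (Isometry.of_dist_eq fun a b => ?_).isClosedEmbedding
      rw [Prod.dist_eq, dist_self, dist_eq_norm, ← sub_smul, norm_smul, hσ, mul_one,
        Real.dist_eq, max_eq_left (norm_nonneg _), Real.norm_eq_abs]
    have hφ : ContDiff ℝ ∞ fun s : ℝ => w (s • (σ : EuclideanSpace ℝ (Fin n)), 0) :=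
      hw.contDiff.comp (by fun_prop)
    have hφ0 : (0 : ℝ) ∉ tsupport fun s : ℝ => w (s • (σ : EuclideanSpace ℝ (Fin n)), 0) := by
      rw [notMem_tsupport_iff_eventuallyEq]
      have : Filter.Tendsto (fun s : ℝ =>
          ((s • (σ : EuclideanSpace ℝ (Fin n)), 0) : GrushinSpace n))
          (nhds 0) (nhds 0) := by
        have := hι.continuous.tendsto 0
        rwa [zero_smul] at this
      exact this.eventually hw.eventuallyEq_zero
    have ht := isTestFunction_comp_rho (n := n) hφ (hw.hasCompactSupport.comp_isClosedEmbedding hι)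
      hφ0
    have h := ht.wInt_mul_angOp hw
    have h2 : wInt (GrushinSpace.carre (fun p : GrushinSpace n =>
        w (rho p • (σ : EuclideanSpace ℝ (Fin n)), 0)) w) = 0 := by
      rw [wInt_congr (g := fun _ => 0) fun p hp =>
        carre_comp_rho (hφ.differentiable (by simp)) hp w]
      simp [wInt]
    rw [h2, neg_zero] at h
    refine Eq.trans ?_ h
    refine integral_congr_ae (Filter.Eventually.of_forall fun p => ?_)
    simp only; ring
  obtain ⟨K, hK⟩ := hw.hasCompactSupport.exists_bound_of_continuous hw.continuous
  have hI : Integrable (fun z : sphere (0 : EuclideanSpace ℝ (Fin n)) 1 × GrushinSpace n =>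
      w (rho z.2 • (z.1 : EuclideanSpace ℝ (Fin n)), 0) *
        (rho z.2 ^ (-(n + 2) : ℝ) * GrushinSpace.angOp w z.2)) (ν.prod volume) := by
    refine Integrable.bdd_mul (c := K) (hw.angOp.integrable_weight.comp_snd ν) ?_
      (Filter.Eventually.of_forall fun z => hK _)
    have := continuous_rho (n := n)
    exact (hw.continuous.comp (by fun_prop)).aestronglyMeasurable
  have hV0 : ν.real Set.univ ≠ 0 := (toSphere_real_univ_pos hn).ne'
  have hmean : ∀ p : GrushinSpace n, ∫ σ : sphere (0 : EuclideanSpace ℝ (Fin n)) 1,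
      w (rho p • (σ : EuclideanSpace ℝ (Fin n)), 0) *
        (rho p ^ (-(n + 2) : ℝ) * GrushinSpace.angOp w p) ∂ν =
      ν.real Set.univ * (rho p ^ (-(n + 2) : ℝ) *
        (sphMean w (rho p) * GrushinSpace.angOp w p)) := by
    intro p
    rw [integral_mul_const, sphMean, ← hν]
    field_simp
  have h1 := hI.integral_prod_right
  have h2 := integral_integral_swap (f := fun (σ : sphere (0 : EuclideanSpace ℝ (Fin n)) 1) p =>
    w (rho p • (σ : EuclideanSpace ℝ (Fin n)), 0) *
      (rho p ^ (-(n + 2) : ℝ) * GrushinSpace.angOp w p)) hI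
  simp only [hmean] at h1 h2
  simp only [hw0, integral_zero, integral_const_mul] at h2
  refine ⟨(h1.const_mul (ν.real Set.univ)⁻¹).congr (Filter.Eventually.of_forall fun p => ?_), ?_⟩
  · simp only
    rw [inv_mul_cancel_left₀ hV0]
  · exact (mul_eq_zero.1 h2.symm).resolve_left hV0

theorem integrable_angOp_sq_div_psi (hn : 3 ≤ n) (hw : IsTestFunction w) :
    Integrable fun p => rho p ^ (-(n + 2) : ℝ) * (GrushinSpace.angOp w p ^ 2 / psi p) := by
  have h : IsTestFunction fun p =>
      rho p ^ (-n : ℝ) * (GrushinSpace.angOp w p * GrushinSpace.angOp w p) :=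
    (hw.angOp.mul hw.angOp).smoothOff_mul (smoothOff_rho_rpow _)
  refine (integrable_div_norm_fst_sq hn h.continuous h.hasCompactSupport).congr ?_
  filter_upwards [ae_ne_zero] with p hp
  have hr := rho_pos hp
  have : rho p ^ (-n : ℝ) = rho p ^ (-(n + 2) : ℝ) * rho p ^ 2 := by
    rw [← Real.rpow_natCast, ← Real.rpow_add hr]; norm_num
  rw [this, psi]
  field_simp

theorem ae_fst_ne_zero (hn : 1 ≤ n) : ∀ᵐ p : GrushinSpace n, p.1 ≠ 0 := by
  have := nontrivial_euclideanSpace (n := n) (by omega)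
  have h : ∀ᵐ x : EuclideanSpace ℝ (Fin n), x ≠ 0 := by rw [ae_iff]; simp
  exact Measure.quasiMeasurePreserving_fst.ae h

/-- Spectral gap of the angular operator. -/
theorem four_mul_wInt_carre_le (hn : 3 ≤ n) (hw : IsTestFunction w) :
    4 * wInt (GrushinSpace.carre w w) ≤ wInt fun p => GrushinSpace.angOp w p ^ 2 / psi p := by
  obtain ⟨i1, h1⟩ := hw.four_mul_wInt_le hn
  obtain ⟨i2, h2⟩ := hw.wInt_sphMean_mul_angOp (by omega)
  have i3 := hw.integrable_angOp_sq_div_psi hn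
  have i4 := (hw.mul hw.angOp).integrable_weight
  have h4 := hw.wInt_mul_angOp hw
  -- The left side is `0 + Γ(w)`. The weights `2` and `1/8` are tuned so that the Poincaré
  -- inequality bounds the first term on the right by `Γ(w)/2`, leaving `Γ(w)/2 ≤ (1/8)∫(Aw)²/ψ`.
  have key : wInt (fun p => sphMean w (rho p) * GrushinSpace.angOp w p) -
      wInt (fun p => w p * GrushinSpace.angOp w p) ≤
      2 * wInt (fun p => psi p * (w p - sphMean w (rho p)) ^ 2) +
      (1 / 8) * wInt fun p => GrushinSpace.angOp w p ^ 2 / psi p := by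
    unfold wInt
    rw [← integral_sub i2 i4, ← integral_const_mul, ← integral_const_mul,
      ← integral_add (i1.const_mul 2) (i3.const_mul _)]
    refine integral_mono_ae (i2.sub i4) ((i1.const_mul 2).add (i3.const_mul _)) ?_
    filter_upwards [ae_ne_zero, ae_fst_ne_zero (by omega)] with p hp hp1
    have hr := rho_pos hp
    have hψ : 0 < psi p := by unfold psi; have := norm_pos_iff.2 hp1; positivity
    have hk : 0 < rho p ^ (-(n + 2) : ℝ) := Real.rpow_pos_of_pos hr _
    set d := w p - sphMean w (rho p)
    set B := GrushinSpace.angOp w p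
    have hd : sphMean w (rho p) = w p - d := by simp [d]
    have e : -(d * B) ≤ 2 * (psi p * d ^ 2) + 1 / 8 * (B ^ 2 / psi p) := by
      have : 2 * (psi p * d ^ 2) + 1 / 8 * (B ^ 2 / psi p) + d * B =
          2 * psi p * (d + B / (4 * psi p)) ^ 2 := by field_simp; ring
      have h0 : 0 ≤ 2 * psi p * (d + B / (4 * psi p)) ^ 2 := by positivity
      linarith
    have := mul_le_mul_of_nonneg_left e hk.le
    rw [hd]
    linarith
  rw [h2, h4] at key
  linarith

end IsTestFunction

end GrushinSpace

end

/-! ### Agreement with the gradient, operator and radial derivative of the statement -/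

noncomputable section

namespace GrushinSpace

variable {n : ℕ}

section Slices

variable {f g : GrushinSpace n → ℝ} {p : GrushinSpace n}

theorem fderiv_slice_apply (hf : DifferentiableAt ℝ f p) (v : EuclideanSpace ℝ (Fin n)) :
    fderiv ℝ (fun x => f (x, p.2)) p.1 v = fderiv ℝ f p (v, 0) := by
  have h := hf.hasFDerivAt.comp p.1 (hasFDerivAt_prodMk_left (𝕜 := ℝ) p.1 p.2)
  have : (fun x => f (x, p.2)) = f ∘ fun x => (x, p.2) := rfl
  rw [this, h.fderiv]
  simp

theorem deriv_slice (hf : DifferentiableAt ℝ f p) : deriv (fun t => f (p.1, t)) p.2 = dt f p := by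
  have h := hf.hasFDerivAt.comp p.2 (hasFDerivAt_prodMk_right (𝕜 := ℝ) p.1 p.2)
  have : (fun t => f (p.1, t)) = f ∘ fun t => (p.1, t) := rfl
  rw [this, h.hasDerivAt.deriv]
  simp [dt]

theorem norm_grad_sq (hf : DifferentiableAt ℝ f p) : ‖grad f p‖ ^ 2 = gradInner f f p := by
  have h : ∀ i, gradient (fun x => f (x, p.2)) p.1 i = dx i f p := by
    intro i
    have h1 := EuclideanSpace.inner_single_left i (1 : ℝ) (gradient (fun x => f (x, p.2)) p.1)
    rw [real_inner_comm, gradient, InnerProductSpace.toDual_symm_apply, fderiv_slice_apply hf] at h1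
    simpa [gradient, dx] using h1.symm
  rw [WithLp.prod_norm_sq_eq_of_L2]
  change ‖gradient (fun x => f (x, p.2)) p.1‖ ^ 2 +
    ‖‖p.1‖ * deriv (fun t => f (p.1, t)) p.2‖ ^ 2 = _
  simp only [EuclideanSpace.norm_sq_eq (gradient _ _), h, deriv_slice hf, gradInner,
    Real.norm_eq_abs, sq_abs, mul_pow]
  simp only [sq]

theorem grad_congr (h : f =ᶠ[nhds p] g) : grad f p = grad g p := by
  have h1 : (fun x => f (x, p.2)) =ᶠ[nhds p.1] fun x => g (x, p.2) :=
    (Continuous.tendsto (by fun_prop : Continuous fun x : EuclideanSpace ℝ (Fin n) => (x, p.2))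
      p.1).eventually h
  have h2 : (fun t => f (p.1, t)) =ᶠ[nhds p.2] fun t => g (p.1, t) :=
    (Continuous.tendsto (by fun_prop : Continuous fun t : ℝ => (p.1, t)) p.2).eventually h
  rw [grad, grad, gradient, gradient, h1.fderiv_eq, h2.deriv_eq]

theorem norm_grad_rho_sq (hp : p ≠ 0) : ‖grad rho p‖ ^ 2 = psi p := by
  rw [norm_grad_sq (smoothOff_rho.differentiableAt hp)]
  have h1 := gradInner_rho_rpow 1 hp rho
  have h2 := euler_rho_rpow 1 hp
  simp only [Real.rpow_one] at h1 h2
  rw [h1, h2]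
  have := rho_pos hp
  rw [show (1 - 2 : ℝ) = -1 by norm_num, Real.rpow_neg_one]
  field_simp

/-- The curve `r ↦ δ_r σ` through `p` has velocity `ϱ⁻¹(x, 2t)` there. -/
theorem radialDeriv_eq (hf : DifferentiableAt ℝ f p) (hp : p ≠ 0) :
    radialDeriv f p = (rho p)⁻¹ * euler f p := by
  have hr := rho_pos hp
  have e : dil (rho p) (dil (rho p)⁻¹ p) = p := by
    ext <;> simp [dil] <;> field_simp
  have h1 : HasDerivAt (fun r => dil r (dil (rho p)⁻¹ p)) ((rho p)⁻¹ • (p.1, 2 * p.2)) (rho p) := by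
    have ha := (hasDerivAt_id (rho p)).smul_const (dil (rho p)⁻¹ p).1
    have hb := ((hasDerivAt_id (rho p)).pow 2).mul_const (dil (rho p)⁻¹ p).2
    convert! ha.prodMk hb using 1
    ext
    · simp [dil]
    · simp [dil]; field_simp
  have h2 : HasFDerivAt f (fderiv ℝ f p) (dil (rho p) (dil (rho p)⁻¹ p)) := by
    rw [e]; exact hf.hasFDerivAt
  have h3 := h2.comp_hasDerivAt (rho p) h1
  rw [radialDeriv]
  refine h3.deriv.trans ?_
  rw [map_smul, smul_eq_mul, euler]

end Slices

theorem IsTestFunction.op_eq {f : GrushinSpace n → ℝ} (hf : IsTestFunction f) (p : GrushinSpace n) :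
    op f p = GrushinSpace.subLap f p := by
  have h1 : ∀ i, iteratedFDeriv ℝ 2 (fun x => f (x, p.2)) p.1
      ![EuclideanSpace.single i 1, EuclideanSpace.single i 1] =
        GrushinSpace.dx i (GrushinSpace.dx i f) p := by
    intro i
    have hs : ContDiff ℝ ∞ fun x : EuclideanSpace ℝ (Fin n) => f (x, p.2) :=
      hf.contDiff.comp (by fun_prop)
    have hd : DifferentiableAt ℝ (fderiv ℝ fun x : EuclideanSpace ℝ (Fin n) => f (x, p.2)) p.1 :=
      (hs.fderiv_right (m := ∞) (by simp)).contDiffAt.differentiableAt (by simp)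
    have e1 : ∀ x v : EuclideanSpace ℝ (Fin n), fderiv ℝ (fun x => f (x, p.2)) x v =
        fderiv ℝ f (x, p.2) (v, 0) := fun x v =>
      fderiv_slice_apply (p := (x, p.2)) (hf.differentiable _) v
    rw [iteratedFDeriv_two_apply]
    simp only [Matrix.cons_val_zero, Matrix.cons_val_one]
    have e2 : fderiv ℝ (fderiv ℝ fun x => f (x, p.2)) p.1 (EuclideanSpace.single i 1)
        (EuclideanSpace.single i 1) = fderiv ℝ (fun x => fderiv ℝ (fun x => f (x, p.2)) x
          (EuclideanSpace.single i 1)) p.1 (EuclideanSpace.single i 1) := by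
      rw [fderiv_clm_apply hd (differentiableAt_const _)]
      simp
    rw [e2]
    simp only [e1]
    exact fderiv_slice_apply (f := GrushinSpace.dx i f) ((hf.dx i).differentiable p) _
  have h2 : iteratedDeriv 2 (fun t => f (p.1, t)) p.2 = GrushinSpace.dt (GrushinSpace.dt f) p := by
    rw [iteratedDeriv_succ, iteratedDeriv_one]
    have e1 : deriv (fun t => f (p.1, t)) = fun t => GrushinSpace.dt f (p.1, t) := by
      ext t
      exact deriv_slice (p := (p.1, t)) (hf.differentiable _)
    rw [e1]
    exact deriv_slice (hf.dt.differentiable p)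
  rw [op, h2, InnerProductSpace.laplacian_eq_iteratedFDeriv_orthonormalBasis _
    (EuclideanSpace.basisFun (Fin n) ℝ), GrushinSpace.subLap]
  simp only [EuclideanSpace.basisFun_apply, h1]

end GrushinSpace

end

/-! ### The conjugated operator and its weighted norm -/

noncomputable section

namespace GrushinSpace

variable {n : ℕ}

theorem gradInner_eq_carre (f g : GrushinSpace n → ℝ) {p : GrushinSpace n} (hp : p ≠ 0) :
    gradInner f g p = (rho p ^ 2)⁻¹ * (carre f g p + psi p * (euler f p * euler g p)) := by
  have := rho_pos hp
  rw [carre, sub_add_cancel, inv_mul_cancel_left₀ (by positivity)]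

theorem gradInner_rho_rpow_mul_self (s : ℝ) {f : GrushinSpace n → ℝ} {p : GrushinSpace n}
    (hp : p ≠ 0) (hf : DifferentiableAt ℝ f p) :
    gradInner (fun q => rho q ^ s * f q) (fun q => rho q ^ s * f q) p =
      rho p ^ (2 * s - 2) * (carre f f p + psi p * (euler f p + s * f p) ^ 2) := by
  have hr := rho_pos hp
  have e : rho p ^ (2 * s - 2) = (rho p ^ 2)⁻¹ * (rho p ^ s * rho p ^ s) := by
    rw [← Real.rpow_add hr, ← Real.rpow_natCast, ← Real.rpow_neg hr.le, ← Real.rpow_add hr]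
    congr 1; push_cast; ring
  rw [gradInner_eq_carre _ _ hp, carre_rho_rpow_mul s hp hf, carre_comm,
    carre_rho_rpow_mul s hp hf, euler_rho_rpow_mul s hp hf, e]
  ring

namespace IsTestFunction

variable {w : GrushinSpace n → ℝ}

theorem wInt_const_mul (c : ℝ) (f : GrushinSpace n → ℝ) :
    wInt (fun p => c * f p) = c * wInt f := by
  unfold wInt
  rw [← integral_const_mul]
  congr 1; ext p; ring

theorem psi_mul_sq (hw : IsTestFunction w) : IsTestFunction fun p => psi p * w p ^ 2 := by
  simpa only [sq] using (hw.mul hw).smoothOff_mul smoothOff_psi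

theorem wInt_psi_mul_euler_self (hw : IsTestFunction w) :
    wInt (fun p => psi p * (w p * GrushinSpace.euler w p)) = 0 := by
  have h := hw.wInt_psi_mul_euler hw
  rw [wInt_congr (f := fun p => psi p * (GrushinSpace.euler w p * w p))
    (g := fun p => psi p * (w p * GrushinSpace.euler w p)) fun p _ => by ring] at h
  linarith

/-- The cross term `2ψ w Ew` equals `E(ψw²)` and integrates to zero. -/
theorem wInt_psi_sq_euler_add (hw : IsTestFunction w) (c : ℝ) :
    wInt (fun p => psi p * (GrushinSpace.euler w p + c * w p) ^ 2) =
      wInt (fun p => psi p * GrushinSpace.euler w p ^ 2) +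
        c ^ 2 * wInt (fun p => psi p * w p ^ 2) := by
  have hm := (hw.mul hw.euler).smoothOff_mul smoothOff_psi
  have e : wInt (fun p => psi p * (GrushinSpace.euler w p + c * w p) ^ 2) =
      wInt (fun p => (psi p * GrushinSpace.euler w p ^ 2 + c ^ 2 * (psi p * w p ^ 2)) +
        2 * c * (psi p * (w p * GrushinSpace.euler w p))) :=
    wInt_congr fun p _ => by ring
  rw [e, (hw.euler.psi_mul_sq.add (hw.psi_mul_sq.const_mul _)).wInt_add (hm.const_mul _),
    hw.euler.psi_mul_sq.wInt_add (hw.psi_mul_sq.const_mul _), wInt_const_mul, wInt_const_mul,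
    hw.wInt_psi_mul_euler_self]
  ring

/-- By `euler_carre`, `2Γ(Ew, w) = E Γ(w, w)` pointwise, and `E` has zero mean. -/
theorem wInt_carre_euler_self (hw : IsTestFunction w) :
    wInt (GrushinSpace.carre (GrushinSpace.euler w) w) = 0 := by
  have h := (hw.carre hw).wInt_euler
  rw [wInt_congr (g := fun p => 2 * GrushinSpace.carre (GrushinSpace.euler w) w p) fun p hp => by
    rw [euler_carre hw hw hp, carre_comm w]; ring, wInt_const_mul] at h
  linarith

theorem wInt_carre_euler_euler (hw : IsTestFunction w) :
    wInt (GrushinSpace.carre (GrushinSpace.euler (GrushinSpace.euler w)) w) =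
      -wInt (GrushinSpace.carre (GrushinSpace.euler w) (GrushinSpace.euler w)) := by
  have h := (hw.euler.carre hw).wInt_euler
  rw [wInt_congr (g := fun p => GrushinSpace.carre (GrushinSpace.euler (GrushinSpace.euler w)) w p +
    GrushinSpace.carre (GrushinSpace.euler w) (GrushinSpace.euler w) p) fun p hp =>
    euler_carre hw.euler hw hp, (hw.euler.euler.carre hw).wInt_add (hw.euler.carre hw.euler)] at h
  linarith

theorem wInt_carre_euler_sub (hw : IsTestFunction w) (c : ℝ) :
    wInt (GrushinSpace.carre (fun p => GrushinSpace.euler w p + c * w p)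
      fun p => GrushinSpace.euler w p + c * w p) =
      wInt (GrushinSpace.carre (GrushinSpace.euler w) (GrushinSpace.euler w)) +
        c ^ 2 * wInt (GrushinSpace.carre w w) := by
  have hadd : ∀ (k : GrushinSpace n → ℝ) p,
      GrushinSpace.carre (fun p => GrushinSpace.euler w p + c * w p) k p =
      GrushinSpace.carre (GrushinSpace.euler w) k p + c * GrushinSpace.carre w k p := by
    intro k p
    have hd : ∀ v, fderiv ℝ (fun p => GrushinSpace.euler w p + c * w p) p v =
        fderiv ℝ (GrushinSpace.euler w) p v + c * fderiv ℝ w p v := by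
      intro v
      rw [fderiv_fun_add (hw.euler.differentiable p) ((hw.const_mul c).differentiable p),
        fderiv_const_mul (hw.differentiable p)]
      simp
    simp only [GrushinSpace.carre, GrushinSpace.gradInner, GrushinSpace.euler, GrushinSpace.dx,
      GrushinSpace.dt] at hd ⊢
    simp only [hd, add_mul, Finset.sum_add_distrib, mul_assoc, ← Finset.mul_sum]
    ring
  have e : wInt (GrushinSpace.carre (fun p => GrushinSpace.euler w p + c * w p)
      fun p => GrushinSpace.euler w p + c * w p) =
      wInt (fun p => (GrushinSpace.carre (GrushinSpace.euler w) (GrushinSpace.euler w) p +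
        c ^ 2 * GrushinSpace.carre w w p) +
        2 * c * GrushinSpace.carre (GrushinSpace.euler w) w p) := by
    refine wInt_congr fun p _ => ?_
    rw [hadd, carre_comm _ (fun p => GrushinSpace.euler w p + c * w p),
      carre_comm w (fun p => GrushinSpace.euler w p + c * w p), hadd, hadd,
      carre_comm w (GrushinSpace.euler w)]
    ring
  rw [e, ((hw.euler.carre hw.euler).add ((hw.carre hw).const_mul _)).wInt_add
    ((hw.euler.carre hw).const_mul _), (hw.euler.carre hw.euler).wInt_add
    ((hw.carre hw).const_mul _), wInt_const_mul, wInt_const_mul, hw.wInt_carre_euler_self]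
  ring

/-- The Grushin operator in logarithmic polar coordinates, after conjugation with a power of `ϱ`. -/
theorem rho_sq_mul_subLap (hw : IsTestFunction w) :
    ∀ᵐ p, rho p ^ 2 * GrushinSpace.subLap (fun q => rho q ^ (-(n - 2) / 2 : ℝ) * w q) p =
      rho p ^ (-(n - 2) / 2 : ℝ) * (psi p * (GrushinSpace.euler (GrushinSpace.euler w) p +
        2 * GrushinSpace.euler w p - (n ^ 2 - 4) / 4 * w p) + GrushinSpace.angOp w p) := by
  filter_upwards [hw.angOp_rho_rpow_mul (-(n - 2) / 2 : ℝ), ae_ne_zero] with p h hp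
  set s : ℝ := -(n - 2) / 2 with hs
  have h1 : ∀ q : GrushinSpace n, q ≠ 0 → GrushinSpace.euler (fun q => rho q ^ s * w q) q =
      rho q ^ s * (GrushinSpace.euler w q + s * w q) := fun q hq =>
    euler_rho_rpow_mul s hq (hw.differentiable q)
  have h2 : GrushinSpace.euler (GrushinSpace.euler fun q => rho q ^ s * w q) p =
      rho p ^ s * (GrushinSpace.euler (fun q => GrushinSpace.euler w q + s * w q) p +
        s * (GrushinSpace.euler w p + s * w p)) := by
    rw [← euler_rho_rpow_mul s hp ((hw.euler.add (hw.const_mul s)).differentiable p)]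
    have : (GrushinSpace.euler fun q => rho q ^ s * w q) =ᶠ[nhds p]
        fun q => rho q ^ s * (GrushinSpace.euler w q + s * w q) := by
      filter_upwards [isOpen_ne.mem_nhds hp] with q hq using h1 q hq
    rw [GrushinSpace.euler, this.fderiv_eq]
    rfl
  rw [euler_add (hw.euler.differentiable p) ((hw.const_mul s).differentiable p),
    euler_const_mul s (hw.differentiable p)] at h2
  have h3 : rho p ^ 2 * GrushinSpace.subLap (fun q => rho q ^ s * w q) p =
      GrushinSpace.angOp (fun q => rho q ^ s * w q) p + psi p *
        (GrushinSpace.euler (GrushinSpace.euler fun q => rho q ^ s * w q) p +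
          n * GrushinSpace.euler (fun q => rho q ^ s * w q) p) := by
    rw [GrushinSpace.angOp]; ring
  -- Conjugation replaces `E` by `E + s`. In `(E+s)² + n(E+s)` the first-order coefficient is `2s +
  -- n = 2` and the constant is `s(s+n) = -(n²-4)/4`.
  rw [h3, h, h2, h1 p hp, hs]
  ring

/-- The first-order part pairs to `-2Γ(Ew, w) = 0`, and antisymmetry turns `-Γ(E²w, w)` into `Γ(Ew,
Ew)`. -/
theorem wInt_mul_angOp_of_euler (hw : IsTestFunction w) (b : ℝ) :
    wInt (fun p => (GrushinSpace.euler (GrushinSpace.euler w) p +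
        2 * GrushinSpace.euler w p - b * w p) * GrushinSpace.angOp w p) =
      wInt (GrushinSpace.carre (GrushinSpace.euler w) (GrushinSpace.euler w)) +
        b * wInt (GrushinSpace.carre w w) := by
  have e : wInt (fun p => (GrushinSpace.euler (GrushinSpace.euler w) p +
        2 * GrushinSpace.euler w p - b * w p) * GrushinSpace.angOp w p) =
      wInt (fun p => (GrushinSpace.euler (GrushinSpace.euler w) p * GrushinSpace.angOp w p +
        2 * (GrushinSpace.euler w p * GrushinSpace.angOp w p)) -
          b * (w p * GrushinSpace.angOp w p)) :=
    wInt_congr fun p _ => by ring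
  have i1 := hw.euler.euler.mul hw.angOp
  have i2 := (hw.euler.mul hw.angOp).const_mul 2
  have i3 := (hw.mul hw.angOp).const_mul b
  rw [e, (i1.add i2).wInt_sub i3, i1.wInt_add i2, wInt_const_mul, wInt_const_mul,
    hw.euler.euler.wInt_mul_angOp hw, hw.euler.wInt_mul_angOp hw, hw.wInt_mul_angOp hw,
    hw.wInt_carre_euler_self, hw.wInt_carre_euler_euler]
  ring

theorem wInt_psi_mul_sq_of_euler (hw : IsTestFunction w) (b : ℝ) :
    wInt (fun p => psi p * (GrushinSpace.euler (GrushinSpace.euler w) p +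
        2 * GrushinSpace.euler w p - b * w p) ^ 2) =
      wInt (fun p => psi p * GrushinSpace.euler (GrushinSpace.euler w) p ^ 2) +
        (4 + 2 * b) * wInt (fun p => psi p * GrushinSpace.euler w p ^ 2) +
        b ^ 2 * wInt (fun p => psi p * w p ^ 2) := by
  have i0 := hw.psi_mul_sq.const_mul (b ^ 2)
  have i1 := hw.euler.psi_mul_sq.const_mul 4
  have i2 := hw.euler.euler.psi_mul_sq
  have m1 := ((hw.mul hw.euler).smoothOff_mul smoothOff_psi).const_mul (-4 * b)
  have m2 := ((hw.mul hw.euler.euler).smoothOff_mul smoothOff_psi).const_mul (-2 * b)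
  have m3 := ((hw.euler.mul hw.euler.euler).smoothOff_mul smoothOff_psi).const_mul 4
  have e : wInt (fun p => psi p * (GrushinSpace.euler (GrushinSpace.euler w) p +
        2 * GrushinSpace.euler w p - b * w p) ^ 2) =
      wInt (fun p => ((((psi p * GrushinSpace.euler (GrushinSpace.euler w) p ^ 2 +
        4 * (psi p * GrushinSpace.euler w p ^ 2)) + b ^ 2 * (psi p * w p ^ 2)) +
        -4 * b * (psi p * (w p * GrushinSpace.euler w p))) +
        -2 * b * (psi p * (w p * GrushinSpace.euler (GrushinSpace.euler w) p))) +
        4 * (psi p * (GrushinSpace.euler w p * GrushinSpace.euler (GrushinSpace.euler w) p))) :=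
    wInt_congr fun p _ => by ring
  rw [e, (((((i2.add i1).add i0).add m1).add m2).wInt_add m3),
    ((((i2.add i1).add i0).add m1).wInt_add m2), (((i2.add i1).add i0).wInt_add m1),
    ((i2.add i1).wInt_add i0), i2.wInt_add i1, wInt_const_mul, wInt_const_mul, wInt_const_mul,
    wInt_const_mul, wInt_const_mul, hw.wInt_psi_mul_euler_self, hw.euler.wInt_psi_mul_euler_self,
    hw.wInt_psi_mul_euler hw.euler]
  simp only [← sq]
  ring

/-- The weighted `L²` norm of the Grushin operator in logarithmic polar coordinates. -/
theorem integral_subLap_sq_div_psi (hn : 3 ≤ n) (hw : IsTestFunction w) :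
    Integrable (fun p =>
      GrushinSpace.subLap (fun q => rho q ^ (-(n - 2) / 2 : ℝ) * w q) p ^ 2 / psi p) ∧
    ∫ p, GrushinSpace.subLap (fun q => rho q ^ (-(n - 2) / 2 : ℝ) * w q) p ^ 2 / psi p =
      wInt (fun p => psi p * GrushinSpace.euler (GrushinSpace.euler w) p ^ 2) +
      (4 + 2 * ((n ^ 2 - 4) / 4)) * wInt (fun p => psi p * GrushinSpace.euler w p ^ 2) +
      ((n ^ 2 - 4) / 4) ^ 2 * wInt (fun p => psi p * w p ^ 2) +
      2 * wInt (GrushinSpace.carre (GrushinSpace.euler w) (GrushinSpace.euler w)) +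
      2 * ((n ^ 2 - 4) / 4) * wInt (GrushinSpace.carre w w) +
      wInt (fun p => GrushinSpace.angOp w p ^ 2 / psi p) := by
  set b : ℝ := (n ^ 2 - 4) / 4 with hb
  set X : GrushinSpace n → ℝ := fun p => GrushinSpace.euler (GrushinSpace.euler w) p +
        2 * GrushinSpace.euler w p - b * w p with hX
  have hXt : IsTestFunction X := (hw.euler.euler.add (hw.euler.const_mul 2)).sub (hw.const_mul b)
  have i1 := hXt.psi_mul_sq.integrable_weight
  have i2 := ((hXt.mul hw.angOp).const_mul 2).integrable_weight
  have i3 := hw.integrable_angOp_sq_div_psi hn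
  have e : (fun p => GrushinSpace.subLap (fun q => rho q ^ (-(n - 2) / 2 : ℝ) * w q) p ^ 2 / psi p)
      =ᵐ[volume] fun p => (rho p ^ (-(n + 2) : ℝ) * (psi p * X p ^ 2) + rho p ^ (-(n + 2) : ℝ) *
        (2 * (X p * GrushinSpace.angOp w p))) +
        rho p ^ (-(n + 2) : ℝ) * (GrushinSpace.angOp w p ^ 2 / psi p) := by
    filter_upwards [hw.rho_sq_mul_subLap, ae_ne_zero, ae_fst_ne_zero (by omega)] with p h hp hp1
    have hr := rho_pos hp
    have hψ : 0 < psi p := by unfold psi; have := norm_pos_iff.2 hp1; positivity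
    have e1 : rho p ^ (-(n + 2) : ℝ) = (rho p ^ 4)⁻¹ * (rho p ^ (-(n - 2) / 2 : ℝ)) ^ 2 := by
      rw [← Real.rpow_mul_natCast hr.le, ← Real.rpow_natCast, ← Real.rpow_neg hr.le,
        ← Real.rpow_add hr]
      congr 1; push_cast; ring
    have e2 : GrushinSpace.subLap (fun q => rho q ^ (-(n - 2) / 2 : ℝ) * w q) p =
        (rho p ^ 2)⁻¹ * (rho p ^ (-(n - 2) / 2 : ℝ) * (psi p * X p + GrushinSpace.angOp w p)) := by
      rw [hX, ← h, inv_mul_cancel_left₀ (by positivity)]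
    rw [e2, e1]
    field_simp
    ring
  refine ⟨((i1.add i2).add i3).congr e.symm, ?_⟩
  have i4 := integral_add (i1.add i2) i3
  simp only [Pi.add_apply] at i4
  rw [integral_congr_ae e, i4, integral_add i1 i2]
  have h1 := hw.wInt_psi_mul_sq_of_euler b
  have h2 := hw.wInt_mul_angOp_of_euler b
  have h3 : wInt (fun p => 2 * (X p * GrushinSpace.angOp w p)) =
    2 * wInt fun p => X p * GrushinSpace.angOp w p := wInt_const_mul _ _
  change wInt (fun p => psi p * X p ^ 2) + wInt (fun p => 2 * (X p * GrushinSpace.angOp w p)) +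
    wInt (fun p => GrushinSpace.angOp w p ^ 2 / psi p) = _
  rw [h3, h1, h2]
  ring

end IsTestFunction

end GrushinSpace

end

/-! ### Radial test functions for the sharpness of the constants -/

noncomputable section

/-- Substitution `s = e^{kv}`: in logarithmic radius, stretching the profile by `k` multiplies its
integral by `k`. -/
theorem lintegral_Ioi_inv_mul_comp_log_div {k : ℝ} (hk : 0 < k) {h : ℝ → ENNReal}  :
    ∫⁻ s in Set.Ioi (0 : ℝ), ENNReal.ofReal s⁻¹ * h (Real.log s / k) =
      ENNReal.ofReal k * ∫⁻ v, h v := by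
  have hd : ∀ v ∈ Set.univ, HasDerivWithinAt (fun v => Real.exp (k * v)) (Real.exp (k * v) * k)
      Set.univ v := fun v _ => by
    have := ((hasDerivAt_id v).const_mul k).exp
    simpa using this
  have hinj : Set.InjOn (fun v => Real.exp (k * v)) Set.univ := fun a _ b _ hab =>
    mul_left_cancel₀ hk.ne' (Real.exp_injective hab)
  have himg : (fun v => Real.exp (k * v)) '' Set.univ = Set.Ioi 0 := by
    ext s
    constructor
    · rintro ⟨v, -, rfl⟩; exact Real.exp_pos _
    · intro hs
      refine ⟨Real.log s / k, trivial, ?_⟩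
      simp only
      rw [mul_div_cancel₀ _ hk.ne', Real.exp_log hs]
  rw [← himg, lintegral_image_eq_lintegral_abs_deriv_mul MeasurableSet.univ hd hinj,
    Measure.restrict_univ, ← lintegral_const_mul' _ _ ENNReal.ofReal_ne_top]
  congr 1; ext v
  have he := Real.exp_pos (k * v)
  rw [Real.log_exp, mul_div_cancel_left₀ _ hk.ne', ← mul_assoc, ← ENNReal.ofReal_mul (abs_nonneg _),
    abs_of_pos (by positivity)]
  congr 2
  field_simp

namespace GrushinSpace

variable {n : ℕ}

open Metric in
/-- The total mass of the angle function on the level sets of `ϱ`. -/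
def psiMass (n : ℕ) : ENNReal :=
  ∫⁻ z : sphere (0 : EuclideanSpace ℝ (Fin n)) 1 × ℝ,
    ENNReal.ofReal ((1 + 4 * z.2 ^ 2) ^ (-(n + 2) / 4 : ℝ) * (1 + 4 * z.2 ^ 2) ^ (-1 / 2 : ℝ))
      ∂((volume : Measure (EuclideanSpace ℝ (Fin n))).toSphere.prod volume)

theorem psiMass_ne_zero (hn : 1 ≤ n) : psiMass n ≠ 0 := by
  have := nontrivial_euclideanSpace hn
  have h0 := Measure.toSphere_ne_zero (volume : Measure (EuclideanSpace ℝ (Fin n)))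
  have hc := fun a => ((continuous_rpow_one_add_four_sq a).comp
    (continuous_snd (X := Metric.sphere (0 : EuclideanSpace ℝ (Fin n)) 1) (Y := ℝ))).measurable
  simp only [Function.comp_def] at hc
  have hc1 := hc (-(n + 2) / 4)
  have hc2 := hc (-1 / 2)
  rw [psiMass, ← pos_iff_ne_zero, lintegral_pos_iff_support (by fun_prop)]
  have : (Function.support fun z : Metric.sphere (0 : EuclideanSpace ℝ (Fin n)) 1 × ℝ =>
      ENNReal.ofReal ((1 + 4 * z.2 ^ 2) ^ (-(n + 2) / 4 : ℝ) *
        (1 + 4 * z.2 ^ 2) ^ (-1 / 2 : ℝ))) = Set.univ := by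
    ext z
    simp only [Function.mem_support, Set.mem_univ, iff_true]
    exact (ENNReal.ofReal_pos.2 (by positivity)).ne'
  rw [this, ← Set.univ_prod_univ, Measure.prod_prod]
  exact ENNReal.mul_pos (fun h => h0 (Measure.measure_univ_eq_zero.1 h)) (by simp)

theorem lintegral_psi_mul_comp_log_rho (hn : 1 ≤ n) {k : ℝ} (hk : 0 < k) {h : ℝ → ℝ}
    (hm : Measurable h) :
    ∫⁻ p : GrushinSpace n, ENNReal.ofReal (rho p ^ (-(n + 2) : ℝ) *
      (psi p * h (Real.log (rho p) / k))) =
      ENNReal.ofReal k * (∫⁻ v, ENNReal.ofReal (h v)) * psiMass n := by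
  have hr := (continuous_rho (n := n)).measurable
  have hψ : Measurable (psi : GrushinSpace n → ℝ) := by unfold psi; fun_prop
  rw [lintegral_eq_lintegral_cyl hn (by fun_prop),
    ← lintegral_Ioi_inv_mul_comp_log_div hk, ← lintegral_mul_const _ (by fun_prop)]
  refine setLIntegral_congr_fun measurableSet_Ioi fun s hs => ?_
  have hs : 0 < s := hs
  have e : ∀ z : Metric.sphere (0 : EuclideanSpace ℝ (Fin n)) 1 × ℝ,
      ENNReal.ofReal ((1 + 4 * z.2 ^ 2) ^ (-(n + 2) / 4 : ℝ)) *
        ENNReal.ofReal (rho (cyl s ((z.1 : EuclideanSpace ℝ (Fin n)), z.2)) ^ (-(n + 2) : ℝ) *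
          (psi (cyl s ((z.1 : EuclideanSpace ℝ (Fin n)), z.2)) *
            h (Real.log (rho (cyl s ((z.1 : EuclideanSpace ℝ (Fin n)), z.2))) / k))) =
      (ENNReal.ofReal (s ^ (-(n + 2) : ℝ)) * ENNReal.ofReal (h (Real.log s / k))) *
        ENNReal.ofReal ((1 + 4 * z.2 ^ 2) ^ (-(n + 2) / 4 : ℝ) *
          (1 + 4 * z.2 ^ 2) ^ (-1 / 2 : ℝ)) := by
    intro z
    rw [rho_cyl hs (by simp), psi_cyl hs (by simp), ENNReal.ofReal_mul (by positivity),
      ENNReal.ofReal_mul (by positivity), ENNReal.ofReal_mul (by positivity)]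
    ring
  simp only [e]
  rw [lintegral_const_mul' _ _ (by finiteness), ← mul_assoc, ← mul_assoc,
    ← ENNReal.ofReal_mul (by positivity), ← psiMass]
  congr 3
  rw [← Real.rpow_natCast, ← Real.rpow_add hs, ← Real.rpow_neg_one]
  congr 1; push_cast; ring

theorem wInt_psi_mul_comp_log_rho (hn : 1 ≤ n) {k : ℝ} (hk : 0 < k) {h : ℝ → ℝ}
    (hm : Measurable h) (h0 : ∀ v, 0 ≤ h v) :
    wInt (fun p : GrushinSpace n => psi p * h (Real.log (rho p) / k)) =
      k * (∫ v, h v) * (psiMass n).toReal := by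
  have hr := (continuous_rho (n := n)).measurable
  have hψ : Measurable (psi : GrushinSpace n → ℝ) := by unfold psi; fun_prop
  rw [wInt, integral_eq_lintegral_of_nonneg_ae, lintegral_psi_mul_comp_log_rho hn hk hm,
    ENNReal.toReal_mul, ENNReal.toReal_mul, ENNReal.toReal_ofReal hk.le,
    ← integral_eq_lintegral_of_nonneg_ae (Filter.Eventually.of_forall h0) hm.aestronglyMeasurable]
  · refine Filter.Eventually.of_forall fun p => ?_
    have := psi_nonneg p
    have := h0 (Real.log (rho p) / k)
    have := Real.rpow_nonneg (rho_nonneg p) (-(n + 2) : ℝ)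
    simp only [Pi.zero_apply]
    positivity
  · exact (by fun_prop : Measurable _).aestronglyMeasurable

section LogProfile

variable {η : ℝ → ℝ} {k : ℝ}

theorem comp_log_eventually_eq_zero (h1 : ∀ v ≤ 0, η v = 0) (hk : 0 < k) :
    (fun s => η (Real.log s / k)) =ᶠ[nhds 0] fun _ => 0 := by
  filter_upwards [Metric.ball_mem_nhds (0 : ℝ) one_pos] with s hs
  rw [mem_ball_zero_iff, Real.norm_eq_abs] at hs
  refine h1 _ (div_nonpos_of_nonpos_of_nonneg ?_ hk.le)
  rw [← Real.log_abs]
  exact Real.log_nonpos (abs_nonneg s) hs.le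

theorem contDiff_comp_log (hη : ContDiff ℝ ∞ η) (h1 : ∀ v ≤ 0, η v = 0) (hk : 0 < k) :
    ContDiff ℝ ∞ fun s => η (Real.log s / k) := by
  rw [contDiff_iff_contDiffAt]
  intro s
  by_cases hs : s = 0
  · subst hs
    exact contDiffAt_const.congr_of_eventuallyEq (comp_log_eventually_eq_zero h1 hk)
  · exact hη.contDiffAt.comp s ((Real.contDiffAt_log.2 hs).div_const k)

theorem hasCompactSupport_comp_log (hc : HasCompactSupport η) (hk : 0 < k) :
    HasCompactSupport fun s => η (Real.log s / k) := by
  obtain ⟨R, hR⟩ := hc.isCompact.isBounded.subset_closedBall 0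
  refine HasCompactSupport.intro (isCompact_closedBall (0 : ℝ) (Real.exp (k * R))) fun s hs => ?_
  by_contra h
  have h2 := hR (subset_tsupport _ h)
  rw [mem_closedBall_zero_iff, Real.norm_eq_abs] at h2
  refine hs ?_
  rw [mem_closedBall_zero_iff, Real.norm_eq_abs]
  by_cases h0 : s = 0
  · subst h0; simpa using (Real.exp_pos _).le
  · rw [← Real.log_le_iff_le_exp (abs_pos.2 h0), Real.log_abs]
    have := (le_abs_self _).trans h2
    rw [div_le_iff₀ hk] at this
    linarith

theorem isTestFunction_comp_log_rho (hη : ContDiff ℝ ∞ η) (hc : HasCompactSupport η)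
    (h1 : ∀ v ≤ 0, η v = 0) (hk : 0 < k) :
    IsTestFunction fun p : GrushinSpace n => η (Real.log (rho p) / k) :=
  isTestFunction_comp_rho (contDiff_comp_log hη h1 hk) (hasCompactSupport_comp_log hc hk)
    (notMem_tsupport_iff_eventuallyEq.2 (comp_log_eventually_eq_zero h1 hk))

theorem euler_comp_log_rho (hη : ContDiff ℝ ∞ η) (h1 : ∀ v ≤ 0, η v = 0) (hk : 0 < k)
    {p : GrushinSpace n} (hp : p ≠ 0) :
    euler (fun p : GrushinSpace n => η (Real.log (rho p) / k)) p =
      k⁻¹ * deriv η (Real.log (rho p) / k) := by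
  have hr := rho_pos hp
  rw [euler_comp_rho ((contDiff_comp_log hη h1 hk).differentiable (by simp)) hp]
  have hd := ((hη.differentiable (by simp) (Real.log (rho p) / k)).hasDerivAt).comp (rho p)
    ((Real.hasDerivAt_log hr.ne').div_const k)
  have : deriv (fun s => η (Real.log s / k)) (rho p) =
    deriv η (Real.log (rho p) / k) * ((rho p)⁻¹ / k) := hd.deriv
  rw [this]
  field_simp

end LogProfile

/-- Radial test functions whose logarithmic derivatives are small compared with the function. -/
theorem exists_isTestFunction_radial (hn : 1 ≤ n) (K : ℝ) (hK : 0 ≤ K) {ε : ℝ} (hε : 0 < ε) :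
    ∃ w : GrushinSpace n → ℝ, IsTestFunction w ∧ wInt (carre w w) = 0 ∧
      wInt (carre (euler w) (euler w)) = 0 ∧ wInt (fun p => angOp w p ^ 2 / psi p) = 0 ∧
      wInt (fun p => psi p * euler (euler w) p ^ 2) + K * wInt (fun p => psi p * euler w p ^ 2) <
        ε * wInt (fun p => psi p * w p ^ 2) := by
  -- A bump supported in `[1, 2]`. Vanishing on `v ≤ 0` keeps `η(log ϱ / k)` away from the origin.
  let η : ContDiffBump (3 / 2 : ℝ) := ⟨1 / 4, 1 / 2, by norm_num, by norm_num⟩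
  have hη : ContDiff ℝ ∞ η := η.contDiff
  have hη' : ContDiff ℝ ∞ (deriv η) := ContDiff.deriv' (by simpa using hη)
  have hη'' : ContDiff ℝ ∞ (deriv (deriv η)) := ContDiff.deriv' (by simpa using hη')
  have hsupp : ∀ v : ℝ, v < 1 → η v = 0 := fun v hv => η.zero_of_le_dist (by
    rw [Real.dist_eq, abs_sub_comm]
    refine le_trans ?_ (le_abs_self _)
    change (1 / 2 : ℝ) ≤ _
    linarith)
  have h1 : ∀ v ≤ 0, η v = 0 := fun v hv => hsupp v (by linarith)
  have h1' : ∀ v ≤ 0, deriv η v = 0 := fun v hv => by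
    have : (η : ℝ → ℝ) =ᶠ[nhds v] fun _ => 0 := by
      filter_upwards [Iio_mem_nhds (show v < 1 by linarith)] with x hx using hsupp x hx
    rw [this.deriv_eq, deriv_const]
  set I0 := ∫ v, η v ^ 2 with hI0
  set I1 := ∫ v, deriv η v ^ 2 with hI1
  set I2 := ∫ v, deriv (deriv η) v ^ 2 with hI2
  have hI0p : 0 < I0 := by
    have hc : Continuous fun v => η v ^ 2 := η.continuous.pow 2
    refine hc.integral_pos_of_hasCompactSupport_nonneg_nonzero (x := 3 / 2) ?_
      (fun v => sq_nonneg _) ?_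
    · have := η.hasCompactSupport.mul_left (f := η)
      simpa only [sq] using! this
    · rw [η.one_of_mem_closedBall (by simp [η])]
      norm_num
  have hI1p : 0 ≤ I1 := integral_nonneg fun _ => sq_nonneg _
  have hI2p : 0 ≤ I2 := integral_nonneg fun _ => sq_nonneg _
  set M := I2 + K * I1 with hM
  have hM0 : 0 ≤ M := by positivity
  -- The two energies are `k^{-3}` and `k^{-1}` times fixed integrals and the mass is `k` times one.
  -- As `k ≥ 1`, the crude bounds by `k⁻¹` below give `M < ε I0 k` as the only requirement.
  set k := 1 + M / (ε * I0) with hk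
  have hk1 : 1 ≤ k := by
    have : 0 ≤ M / (ε * I0) := by positivity
    linarith
  have hk0 : 0 < k := by linarith
  have hMk : M < ε * I0 * k := by
    rw [hk, mul_add, mul_div_cancel₀ _ (by positivity)]
    have : 0 < ε * I0 := by positivity
    linarith
  set w : GrushinSpace n → ℝ := fun p => η (Real.log (rho p) / k) with hw
  have hwt : IsTestFunction w := isTestFunction_comp_log_rho hη η.hasCompactSupport h1 hk0
  have hcw : ∀ (g : GrushinSpace n → ℝ) p, p ≠ 0 → carre w g p = 0 := fun g p hp =>
    carre_comp_rho ((contDiff_comp_log hη h1 hk0).differentiable (by simp)) hp g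
  have hE : ∀ p, p ≠ 0 → euler w p = k⁻¹ * deriv η (Real.log (rho p) / k) := fun p hp =>
    euler_comp_log_rho hη h1 hk0 hp
  have hEw : ∀ p : GrushinSpace n, p ≠ 0 → euler w =ᶠ[nhds p]
      fun p => k⁻¹ * deriv η (Real.log (rho p) / k) := fun p hp => by
    filter_upwards [isOpen_ne.mem_nhds hp] with q hq using hE q hq
  have ht1 : IsTestFunction fun p : GrushinSpace n => deriv η (Real.log (rho p) / k) :=
    isTestFunction_comp_log_rho hη' η.hasCompactSupport.deriv h1' hk0
  have hEE : ∀ p, p ≠ 0 → euler (euler w) p = k⁻¹ ^ 2 * deriv (deriv η) (Real.log (rho p) / k) := by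
    intro p hp
    have e1 : euler (euler w) p = euler (fun p => k⁻¹ * deriv η (Real.log (rho p) / k)) p := by
      rw [euler, (hEw p hp).fderiv_eq]; rfl
    rw [e1, euler_const_mul _ (ht1.differentiable p), euler_comp_log_rho hη' h1' hk0 hp]
    ring
  have hcE : ∀ p, p ≠ 0 → carre (euler w) (euler w) p = 0 := by
    intro p hp
    have hη'k := contDiff_comp_log hη' h1' hk0
    have e1 : carre (euler w) (euler w) p =
        carre (fun p => k⁻¹ * deriv η (Real.log (rho p) / k)) (euler w) p := by
      simp only [carre, gradInner, dx, dt, euler] at hEw ⊢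
      rw [(hEw p hp).fderiv_eq]
    rw [e1]
    exact carre_comp_rho (φ := fun s => k⁻¹ * deriv η (Real.log s / k))
      ((hη'k.differentiable (by simp)).const_mul _) hp _
  -- Pair `Aw` with itself: the result is `-Γ(Aw, w)`, which is zero because `w` is radial.
  have hB : ∀ᵐ p, angOp w p = 0 := by
    refine hwt.angOp.ae_eq_zero_of_wInt_sq ?_
    have h := hwt.angOp.wInt_mul_angOp hwt
    rw [wInt_congr (f := carre (angOp w) w) (g := fun _ => 0) fun p hp => by
      rw [carre_comm]; exact hcw _ p hp] at h
    simp only [← sq] at h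
    rw [h]; simp [wInt]
  refine ⟨w, hwt, ?_, ?_, ?_, ?_⟩
  · rw [wInt_congr (g := fun _ => 0) fun p hp => hcw _ p hp]; simp [wInt]
  · rw [wInt_congr (g := fun _ => 0) hcE]; simp [wInt]
  · rw [wInt, ← integral_zero (GrushinSpace n) ℝ]
    refine integral_congr_ae ?_
    filter_upwards [hB] with p hp
    simp [hp]
  · have hm0 := wInt_psi_mul_comp_log_rho hn hk0 (h := fun v => η v ^ 2)
      (η.continuous.pow 2).measurable fun _ => sq_nonneg _
    have hm1 := wInt_psi_mul_comp_log_rho hn hk0 (h := fun v => deriv η v ^ 2)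
      (hη'.continuous.pow 2).measurable fun _ => sq_nonneg _
    have hm2 := wInt_psi_mul_comp_log_rho hn hk0 (h := fun v => deriv (deriv η) v ^ 2)
      (hη''.continuous.pow 2).measurable fun _ => sq_nonneg _
    have e1 : wInt (fun p => psi p * euler w p ^ 2) = k⁻¹ ^ 2 * (k * I1 * (psiMass n).toReal) := by
      rw [← hm1, ← IsTestFunction.wInt_const_mul]
      refine wInt_congr fun p hp => ?_
      rw [hE p hp]; ring
    have e2 : wInt (fun p => psi p * euler (euler w) p ^ 2) =
        k⁻¹ ^ 4 * (k * I2 * (psiMass n).toReal) := by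
      rw [← hm2, ← IsTestFunction.wInt_const_mul]
      refine wInt_congr fun p hp => ?_
      rw [hEE p hp]; ring
    -- An infinite mass is excluded because the integral of `ψw²` for the test function `w` is
    -- finite and proportional to it.
    have hmass : 0 < (psiMass n).toReal := by
      refine ENNReal.toReal_pos (psiMass_ne_zero hn) fun htop => ?_
      have hfin := hwt.psi_mul_sq.integrable_weight.lintegral_lt_top
      have := lintegral_psi_mul_comp_log_rho (n := n) hn hk0 (h := fun v => η v ^ 2)
        (η.continuous.pow 2).measurable
      rw [this, htop, ENNReal.mul_top] at hfin
      · exact lt_irrefl _ hfin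
      · refine mul_ne_zero (ENNReal.ofReal_pos.2 hk0).ne' fun h0 => hI0p.ne' ?_
        rw [hI0, integral_eq_lintegral_of_nonneg_ae (Filter.Eventually.of_forall fun _ =>
          sq_nonneg _) (η.continuous.pow 2).aestronglyMeasurable, h0]
        rfl
    rw [e1, e2, hm0]
    have hki : k⁻¹ ≤ 1 := inv_le_one_of_one_le₀ hk1
    have hki0 : 0 < k⁻¹ := inv_pos.2 hk0
    have h4 : k⁻¹ ^ 4 ≤ k⁻¹ := pow_le_of_le_one hki0.le hki (by norm_num)
    have h2 : k⁻¹ ^ 2 ≤ k⁻¹ := pow_le_of_le_one hki0.le hki (by norm_num)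
    calc k⁻¹ ^ 4 * (k * I2 * (psiMass n).toReal) + K * (k⁻¹ ^ 2 * (k * I1 * (psiMass n).toReal))
        ≤ k⁻¹ * (k * I2 * (psiMass n).toReal) + K * (k⁻¹ * (k * I1 * (psiMass n).toReal)) := by
          gcongr
      _ = M * (psiMass n).toReal := by rw [hM]; field_simp
      _ < ε * I0 * k * (psiMass n).toReal := by gcongr
      _ = _ := by ring

end GrushinSpace

end

/-! ### Translation of the integrals under the power substitution -/

noncomputable section

namespace GrushinSpace

namespace IsTestFunction

variable {n : ℕ} {u w : GrushinSpace n → ℝ}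

theorem op_sq_div_ae_eq (hu : IsTestFunction u) :
    (fun p => op u p ^ 2 / ‖grad rho p‖ ^ 2) =ᵐ[volume]
      fun p => GrushinSpace.subLap u p ^ 2 / psi p := by
  filter_upwards [ae_ne_zero] with p hp
  rw [hu.op_eq, norm_grad_rho_sq hp]

theorem norm_grad_sq_div_ae_eq (hw : IsTestFunction w) :
    (fun p => ‖grad (fun q => rho q ^ (-(n - 2) / 2 : ℝ) * w q) p‖ ^ 2 / rho p ^ 2) =ᵐ[volume]
      fun p => rho p ^ (-(n + 2) : ℝ) * (GrushinSpace.carre w w p +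
        psi p * (GrushinSpace.euler w p + -(n - 2) / 2 * w p) ^ 2) := by
  filter_upwards [ae_ne_zero] with p hp
  have hr := rho_pos hp
  rw [norm_grad_sq ((hw.smoothOff_mul (smoothOff_rho_rpow _)).differentiable p),
    gradInner_rho_rpow_mul_self _ hp (hw.differentiable p), div_eq_mul_inv, mul_comm, ← mul_assoc,
    ← Real.rpow_natCast, ← Real.rpow_neg hr.le, ← Real.rpow_add hr]
  congr 2; push_cast; ring

/-- Agreement off the origin is all that is asked of `f`, so the default value of `radialDeriv` at
the origin plays no role. -/
theorem rpow_mul_norm_grad_sq_ae_eq (hw : IsTestFunction w) {f : GrushinSpace n → ℝ}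
    (hf : ∀ p, p ≠ 0 → f p = w p) {N : ℝ} (hN : N = n + 2) :
    (fun p => rho p ^ (2 - N) * ‖grad f p‖ ^ 2) =ᵐ[volume]
      fun p => rho p ^ (-(n + 2) : ℝ) * (GrushinSpace.carre w w p +
        psi p * GrushinSpace.euler w p ^ 2) := by
  filter_upwards [ae_ne_zero] with p hp
  have hr := rho_pos hp
  have hfw : f =ᶠ[nhds p] w := by
    filter_upwards [isOpen_ne.mem_nhds hp] with q hq using hf q hq
  have e : rho p ^ (2 - N) = rho p ^ (-(n + 2) : ℝ) * rho p ^ 2 := by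
    rw [← Real.rpow_natCast, ← Real.rpow_add hr, hN]
    congr 1; push_cast; ring
  rw [grad_congr hfw, norm_grad_sq (hw.differentiable p), gradInner_eq_carre _ _ hp, e]
  field_simp

theorem sq_mul_norm_grad_rho_sq_div_ae_eq (w : GrushinSpace n → ℝ) :
    (fun p => (rho p ^ (-(n - 2) / 2 : ℝ) * w p) ^ 2 * ‖grad rho p‖ ^ 2 / rho p ^ 4) =ᵐ[volume]
      fun p => rho p ^ (-(n + 2) : ℝ) * (psi p * w p ^ 2) := by
  filter_upwards [ae_ne_zero] with p hp
  have hr := rho_pos hp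
  have e : rho p ^ (-(n + 2) : ℝ) = (rho p ^ (-(n - 2) / 2 : ℝ)) ^ 2 * (rho p ^ 4)⁻¹ := by
    rw [← Real.rpow_natCast (rho p) 4, ← Real.rpow_mul_natCast hr.le, ← Real.rpow_neg hr.le,
      ← Real.rpow_add hr]
    congr 1; push_cast; ring
  rw [norm_grad_rho_sq hp, e]
  ring

theorem radialDeriv_mul_rpow (hw : IsTestFunction w) {N : ℝ} (hN : N = n + 2) {p : GrushinSpace n}
    (hp : p ≠ 0) : radialDeriv (fun q => rho q ^ (-(n - 2) / 2 : ℝ) * w q) p *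
      rho p ^ ((N - 2) / 2) = GrushinSpace.euler w p + -(n - 2) / 2 * w p := by
  have hr := rho_pos hp
  rw [radialDeriv_eq ((hw.smoothOff_mul (smoothOff_rho_rpow _)).differentiable p) hp,
    euler_rho_rpow_mul _ hp (hw.differentiable p)]
  have e : (rho p)⁻¹ * rho p ^ (-(n - 2) / 2 : ℝ) * rho p ^ ((N - 2) / 2) = 1 := by
    rw [← Real.rpow_neg_one, ← Real.rpow_add hr, ← Real.rpow_add hr, hN]
    ring_nf
    exact Real.rpow_zero _
  linear_combination (GrushinSpace.euler w p + -(n - 2) / 2 * w p) * e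

theorem rho_rpow_mul_mul_rpow (hw : IsTestFunction w)
    {N : ℝ} (hN : N = n + 2) (q : GrushinSpace n) :
    rho q ^ (-(n - 2) / 2 : ℝ) * w q * rho q ^ ((N - 4) / 2) = w q := by
  by_cases hq : q = 0
  · subst hq
    have : w 0 = 0 := hw.eventuallyEq_zero.self_of_nhds
    simp [this]
  · have e : rho q ^ (-(n - 2) / 2 : ℝ) * rho q ^ ((N - 4) / 2) = 1 := by
      rw [← Real.rpow_add (rho_pos hq), hN]
      ring_nf
      exact Real.rpow_zero _
    linear_combination w q * e

/-- Every test function is `ϱ^{-(Q-4)/2} w` for a test function `w`. -/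
theorem exists_eq_rho_rpow_mul (hu : IsTestFunction u) {N : ℝ} (hN : N = n + 2) :
    ∃ w : GrushinSpace n → ℝ, IsTestFunction w ∧ (u = fun q => rho q ^ (-(n - 2) / 2 : ℝ) * w q) ∧
      (∀ q, u q * rho q ^ ((N - 4) / 2) = w q) := by
  refine ⟨fun q => u q * rho q ^ ((N - 4) / 2), hu.mul_smoothOff (smoothOff_rho_rpow _), ?_,
    fun q => rfl⟩
  ext q
  linear_combination -hu.rho_rpow_mul_mul_rpow hN q

end IsTestFunction

end GrushinSpace

end

noncomputable section

namespace GrushinSpace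

variable {n : ℕ}

/-- The weighted integrals of a test function `ϱ^{-(Q-4)/2} w` and of its derivatives, in terms of
`w`. -/
theorem IsTestFunction.weighted_integrals (hn : 3 ≤ n) {N : ℝ} (hN : N = n + 2)
    {u w : GrushinSpace n → ℝ} (hw : IsTestFunction w)
    (hu : u = fun q => rho q ^ (-(n - 2) / 2 : ℝ) * w q)
    (huw : ∀ q, u q * rho q ^ ((N - 4) / 2) = w q) :
    (Integrable (fun p => op u p ^ 2 / ‖grad rho p‖ ^ 2) ∧
      (∫ p, op u p ^ 2 / ‖grad rho p‖ ^ 2) =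
        wInt (fun p => psi p * GrushinSpace.euler (GrushinSpace.euler w) p ^ 2) +
        (4 + 2 * ((n ^ 2 - 4) / 4)) * wInt (fun p => psi p * GrushinSpace.euler w p ^ 2) +
        ((n ^ 2 - 4) / 4) ^ 2 * wInt (fun p => psi p * w p ^ 2) +
        2 * wInt (GrushinSpace.carre (GrushinSpace.euler w) (GrushinSpace.euler w)) +
        2 * ((n ^ 2 - 4) / 4) * wInt (GrushinSpace.carre w w) +
        wInt (fun p => GrushinSpace.angOp w p ^ 2 / psi p)) ∧
    (Integrable (fun p => ‖grad u p‖ ^ 2 / rho p ^ 2) ∧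
      (∫ p, ‖grad u p‖ ^ 2 / rho p ^ 2) = wInt (GrushinSpace.carre w w) +
        (wInt (fun p => psi p * GrushinSpace.euler w p ^ 2) +
          (-(n - 2) / 2) ^ 2 * wInt (fun p => psi p * w p ^ 2))) ∧
    (Integrable (fun p => u p ^ 2 * ‖grad rho p‖ ^ 2 / rho p ^ 4) ∧
      (∫ p, u p ^ 2 * ‖grad rho p‖ ^ 2 / rho p ^ 4) = wInt (fun p => psi p * w p ^ 2)) ∧
    (Integrable (fun p => rho p ^ (2 - N) * ‖grad (fun q => u q * rho q ^ ((N - 4) / 2)) p‖ ^ 2) ∧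
      (∫ p, rho p ^ (2 - N) * ‖grad (fun q => u q * rho q ^ ((N - 4) / 2)) p‖ ^ 2) =
        wInt (GrushinSpace.carre w w) + wInt (fun p => psi p * GrushinSpace.euler w p ^ 2)) ∧
    (Integrable (fun p =>
        rho p ^ (2 - N) * ‖grad (fun q => radialDeriv u q * rho q ^ ((N - 2) / 2)) p‖ ^ 2) ∧
      (∫ p, rho p ^ (2 - N) * ‖grad (fun q => radialDeriv u q * rho q ^ ((N - 2) / 2)) p‖ ^ 2) =
        wInt (GrushinSpace.carre (GrushinSpace.euler w) (GrushinSpace.euler w)) +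
          (-(n - 2) / 2) ^ 2 * wInt (GrushinSpace.carre w w) +
        (wInt (fun p => psi p * GrushinSpace.euler (GrushinSpace.euler w) p ^ 2) +
          (-(n - 2) / 2) ^ 2 * wInt (fun p => psi p * GrushinSpace.euler w p ^ 2))) := by
  have hut : IsTestFunction u := hu ▸ hw.smoothOff_mul (smoothOff_rho_rpow _)
  have hg := hw.euler.add (hw.const_mul (-(n - 2) / 2))
  have hgE : ∀ p, GrushinSpace.euler (fun p => GrushinSpace.euler w p + -(n - 2) / 2 * w p) p =
      GrushinSpace.euler (GrushinSpace.euler w) p + -(n - 2) / 2 * GrushinSpace.euler w p :=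
      fun p => by
    rw [euler_add (hw.euler.differentiable p) ((hw.const_mul _).differentiable p),
      euler_const_mul _ (hw.differentiable p)]
  refine ⟨?_, ?_, ?_, ?_, ?_⟩
  · obtain ⟨i, e⟩ := hw.integral_subLap_sq_div_psi hn
    rw [← hu] at i e
    exact ⟨i.congr hut.op_sq_div_ae_eq.symm, (integral_congr_ae hut.op_sq_div_ae_eq).trans e⟩
  · have e := hw.norm_grad_sq_div_ae_eq
    rw [← hu] at e
    refine ⟨((hw.carre hw).add hg.psi_mul_sq).integrable_weight.congr e.symm, ?_⟩
    rw [integral_congr_ae e, ← hw.wInt_psi_sq_euler_add]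
    exact (hw.carre hw).wInt_add hg.psi_mul_sq
  · have e := sq_mul_norm_grad_rho_sq_div_ae_eq w
    subst hu
    exact ⟨hw.psi_mul_sq.integrable_weight.congr e.symm, integral_congr_ae e⟩
  · have e := hw.rpow_mul_norm_grad_sq_ae_eq (fun q _ => huw q) hN
    refine ⟨((hw.carre hw).add hw.euler.psi_mul_sq).integrable_weight.congr e.symm, ?_⟩
    rw [integral_congr_ae e]
    exact (hw.carre hw).wInt_add hw.euler.psi_mul_sq
  · have e := hg.rpow_mul_norm_grad_sq_ae_eq (fun q hq => hw.radialDeriv_mul_rpow hN hq) hN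
    rw [← hu] at e
    refine ⟨((hg.carre hg).add hg.euler.psi_mul_sq).integrable_weight.congr e.symm, ?_⟩
    rw [integral_congr_ae e]
    refine ((hg.carre hg).wInt_add hg.euler.psi_mul_sq).trans ?_
    simp only [hgE]
    rw [hw.wInt_carre_euler_sub, hw.euler.wInt_psi_sq_euler_add]

end GrushinSpace

end

/-! ### The two inequalities and their sharpness -/

open GrushinSpace in
theorem corollary1p4 (n Q : ℕ) (hQn : Q = n + 2) (hQ : 5 ≤ Q) :
    (∀ u : GrushinSpace n → ℝ, IsTestFunction u →
      -- all the integrals are finite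
      Integrable (fun p => op u p ^ 2 / ‖grad rho p‖ ^ 2) ∧
      Integrable (fun p => ‖grad u p‖ ^ 2 / rho p ^ 2) ∧
      Integrable (fun p => u p ^ 2 * ‖grad rho p‖ ^ 2 / rho p ^ 4) ∧
      Integrable (fun p => rho p ^ (2 - Q : ℝ) *
        ‖grad (fun q => u q * rho q ^ ((Q - 4) / 2 : ℝ)) p‖ ^ 2) ∧
      Integrable (fun p => rho p ^ (2 - Q : ℝ) *
        ‖grad (fun q => radialDeriv u q * rho q ^ ((Q - 2) / 2 : ℝ)) p‖ ^ 2) ∧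
      -- the Hardy-Rellich inequality
      (Q : ℝ) ^ 2 / 4 * (∫ p, ‖grad u p‖ ^ 2 / rho p ^ 2)
          + (∫ p, rho p ^ (2 - Q : ℝ) *
              ‖grad (fun q => radialDeriv u q * rho q ^ ((Q - 2) / 2 : ℝ)) p‖ ^ 2)
        ≤ (∫ p, op u p ^ 2 / ‖grad rho p‖ ^ 2) ∧
      -- the Rellich inequality
      (Q : ℝ) ^ 2 * ((Q : ℝ) - 4) ^ 2 / 16 * (∫ p, u p ^ 2 * ‖grad rho p‖ ^ 2 / rho p ^ 4)
          + (Q : ℝ) ^ 2 / 4 * (∫ p, rho p ^ (2 - Q : ℝ) *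
              ‖grad (fun q => u q * rho q ^ ((Q - 4) / 2 : ℝ)) p‖ ^ 2)
          + (∫ p, rho p ^ (2 - Q : ℝ) *
              ‖grad (fun q => radialDeriv u q * rho q ^ ((Q - 2) / 2 : ℝ)) p‖ ^ 2)
        ≤ (∫ p, op u p ^ 2 / ‖grad rho p‖ ^ 2)) ∧
    -- the constant `Q² / 4` is sharp
    (∀ C : ℝ, (Q : ℝ) ^ 2 / 4 < C → ∃ u : GrushinSpace n → ℝ, IsTestFunction u ∧
      (∫ p, op u p ^ 2 / ‖grad rho p‖ ^ 2) < C * ∫ p, ‖grad u p‖ ^ 2 / rho p ^ 2) ∧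
    -- the constant `Q² (Q - 4)² / 16` is sharp
    (∀ C : ℝ, (Q : ℝ) ^ 2 * ((Q : ℝ) - 4) ^ 2 / 16 < C →
      ∃ u : GrushinSpace n → ℝ, IsTestFunction u ∧
        (∫ p, op u p ^ 2 / ‖grad rho p‖ ^ 2)
          < C * ∫ p, u p ^ 2 * ‖grad rho p‖ ^ 2 / rho p ^ 4) := by
  have hn : 3 ≤ n := by omega
  have hN : (Q : ℝ) = n + 2 := by rw [hQn]; push_cast; ring
  refine ⟨fun u hu => ?_, fun C hC => ?_, fun C hC => ?_⟩
  · obtain ⟨w, hw, huw, hwu⟩ := hu.exists_eq_rho_rpow_mul hN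
    obtain ⟨⟨i1, e1⟩, ⟨i2, e2⟩, ⟨i3, e3⟩, ⟨i4, e4⟩, ⟨i5, e5⟩⟩ :=
      hw.weighted_integrals hn hN huw hwu
    refine ⟨i1, i2, i3, i4, i5, ?_, ?_⟩
    all_goals
      have h1 := hw.four_mul_wInt_carre_le hn
      have h2 : 0 ≤ wInt (carre (euler w) (euler w)) := integral_nonneg fun p =>
        mul_nonneg (Real.rpow_nonneg (rho_nonneg p) _) (carre_self_nonneg _ p)
    -- The coefficients of `‖E²w‖²`, `‖Ew‖²` and `‖w‖²` agree on both sides. For `Γ(w)` they are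
    -- `(n²-4)/2` against `(n²+4)/2`, and the deficit `4` is exactly the spectral gap `h1`; `Γ(Ew)`
    -- is left over with coefficient one.
    · rw [e1, e2, e5, hN]
      linarith
    · rw [e1, e3, e4, e5, hN]
      linarith
  all_goals
    rw [hN] at hC
    have hn3 : (3 : ℝ) ≤ n := by exact_mod_cast hn
    have ha : 0 < (-((n : ℝ) - 2) / 2) ^ 2 := sq_pos_of_neg (by linarith)
    have hK : (0 : ℝ) ≤ 4 + 2 * ((n ^ 2 - 4) / 4) := by nlinarith
  -- At `C = Q²/4` this difference is zero, as `(n+2)²/4 · (n-2)²/4 = ((n²-4)/4)²`. The excess of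
  -- `C` is the room available for the derivative terms.
  · have hε : 0 < C * (-((n : ℝ) - 2) / 2) ^ 2 - ((n ^ 2 - 4) / 4) ^ 2 := by
      have := mul_lt_mul_of_pos_right hC ha
      linarith
    obtain ⟨w, hw, h0, h1, h2, h3⟩ := exists_isTestFunction_radial (n := n) (by omega) _ hK hε
    have hwu := hw.rho_rpow_mul_mul_rpow hN
    obtain ⟨⟨-, e1⟩, ⟨-, e2⟩, -⟩ := hw.weighted_integrals hn hN rfl hwu
    refine ⟨_, hw.smoothOff_mul (smoothOff_rho_rpow (-((n : ℝ) - 2) / 2)), ?_⟩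
    rw [e1, e2, h0, h1, h2]
    have h4 : 0 ≤ wInt (fun p => psi p * euler w p ^ 2) := integral_nonneg fun p =>
      mul_nonneg (Real.rpow_nonneg (rho_nonneg p) _) (mul_nonneg (psi_nonneg p) (sq_nonneg _))
    have h5 : 0 ≤ C := le_trans (by positivity) hC.le
    -- The term `C‖Ew‖²` on the right is favourable and is dropped.
    have h6 := mul_nonneg h5 h4
    linarith
  · have hε : 0 < C - (((n : ℝ) ^ 2 - 4) / 4) ^ 2 := by linarith
    obtain ⟨w, hw, h0, h1, h2, h3⟩ := exists_isTestFunction_radial (n := n) (by omega) _ hK hε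
    have hwu := hw.rho_rpow_mul_mul_rpow hN
    obtain ⟨⟨-, e1⟩, -, ⟨-, e3⟩, -⟩ := hw.weighted_integrals hn hN rfl hwu
    refine ⟨_, hw.smoothOff_mul (smoothOff_rho_rpow (-((n : ℝ) - 2) / 2)), ?_⟩
    rw [e1, e3, h0, h1, h2]
    linarith
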